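/- Let $d\in\{1,2\}$ and let $\beta<0$. Identify mean-zero distributions on the torus $\mathbb T^d$ with their Fourier coefficients $\varphi=(\varphi_k)_{k\in\mathbb Z^d\setminus\{0\}}$, $\varphi_k\in\mathbb C$, put $\varphi_0:=0$, and for $s\in\mathbb R$ let $$H^s=\Big\{\varphi:\ \|\varphi\|_{H^s}^2=\sum_{k\ne0}|k|^{2s}|\varphi_k|^2<\infty\Big\},$$ regarded as a real Hilbert space. Let $\mu_2=\prod_{k\neq0}\mu_2^k$ be the product of the Gaussian measures $d\mu_2^k(z)=\frac{|k|^2}{2\pi}e^{-\frac12|k|^2|z|^2}\,dx\,dy$ ($z=x+iy$). It is a probability measure carried by $H^\beta$. Let $$B_k(\varphi)=\sum_{l,m\in\mathbb Z^d}\varphi_{k-m}\,\varphi_{l+m}\,\overline{\varphi_l},\qquad k\neq0,$$ let $\Pi_N$ be the projection onto the frequencies $1\le|k|\le N$, and for $d=2$ and $N\in\mathbb N$ let $$(:B:)^N(\varphi)=\Pi_N B(\Pi_N\varphi)-4\Big(\sum_{1\le|m|\le N}\frac1{|m|^2}\Big)\Pi_N\varphi .$$ The gradient of a map $F:H^\beta\to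 H^\beta$ at $\varphi$ is the bounded real-linear operator $\nabla F(\varphi):H^1\to H^\beta$ with $\nabla F(\varphi)v=\lim_{\varepsilon\to0}\varepsilon^{-1}\big(F(\varphi+\varepsilon v)-F(\varphi)\big)$ in $H^\beta$ for all $v\in H^1$. Write $\|T\|_{HS}^2=\sum_i\|T\hat e_i\|_{H^\beta}^2$, where $(\hat e_i)_i$ is an orthonormal basis of the real Hilbert space $H^1$, for the Hilbert–Schmidt norm of an operator $T: H^1\to H^\beta$. **$d=1$.** For $\mu_2$-a.e. $\varphi\in H^\beta$ and all $v\in H^1$, the series defining $B_k(\varphi+v)$ converge absolutely and $B(\varphi+v)\in H^\beta$; the gradient $\nabla B(\varphi)$ exists for $\mu_2$-a.e. $\varphi$, and $\nabla B\in L^{2p}(\mu_2;HS(H^1,H^\beta))$ for every integer $p\ge1$. **$d=2$.** For every $N$ the gradient $\nabla(:B:)^N(\varphi)$ exists at every $\varphi\in H^\beta$, and for every integer $p\ge1$ it belongs to $L^{2p}(\mu_2;HS(H^1,H^\beta))$ uniformly in $N$: $$\sup_N\int\|\nabla(:B:)^N(\varphi)\|_{HS}^{2p}\,d\mu_2(\varphi)<\infty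 .$$ Moreover, $(:B:)^N$ converges in $L^{2p}(\mu_2;H^\beta)$ for every integer $p\ge1$ as $N\to\infty$, and the limit has a version $:B:$, the same for all $p$, whose gradient $\nabla{:}B{:}(\varphi)$ exists for $\mu_2$-a.e. $\varphi$ and satisfies $\nabla{:}B{:}\in L^{2p}(\mu_2;HS(H^1,H^\beta))$ for every integer $p\ge1$. -/

import Mathlib

open Filter Topology MeasureTheory
open scoped ENNReal NNReal ComplexConjugate InnerProductSpace

noncomputable section

namespace NLS

/-- The nonzero frequencies `ℤ^d \ {0}`. -/
abbrev Freq (d : ℕ) : Type := {k : Fin d → ℤ // k ≠ 0}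

/-- The Euclidean length `|k|` of a frequency. -/
def Freq.abs {d : ℕ} (k : Freq d) : ℝ := Real.sqrt (∑ i, ((k.1 i : ℤ) : ℝ) ^ 2)

theorem Freq.one_le_abs {d : ℕ} (k : Freq d) : 1 ≤ k.abs := by
  obtain ⟨i, hi⟩ := Function.ne_iff.mp k.2
  rw [Freq.abs, Real.one_le_sqrt]
  have h1 : (1 : ℝ) ≤ ((k.1 i : ℤ) : ℝ) ^ 2 := by
    have h2 : (1 : ℤ) ≤ (k.1 i) ^ 2 := by
      have h3 : 0 < (k.1 i) ^ 2 := by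
        have : k.1 i ≠ 0 := hi
        positivity
      omega
    exact_mod_cast h2
  exact h1.trans (Finset.single_le_sum (f := fun j => ((k.1 j : ℤ) : ℝ) ^ 2)
    (fun j _ => sq_nonneg _) (Finset.mem_univ i))

theorem Freq.abs_pos {d : ℕ} (k : Freq d) : 0 < k.abs := zero_lt_one.trans_le k.one_le_abs

theorem Freq.finite_abs_le (d N : ℕ) : {k : Freq d | k.abs ≤ N}.Finite := by
  have hf : (Set.Icc (fun _ : Fin d => -(N : ℤ)) (fun _ => (N : ℤ))).Finite := Set.finite_Icc _ _
  refine (hf.preimage (f := (Subtype.val : Freq d → Fin d → ℤ))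
    Subtype.val_injective.injOn).subset ?_
  intro k hk
  have hi : ∀ i, |k.1 i| ≤ (N : ℤ) := by
    intro i
    have h1 : |((k.1 i : ℤ) : ℝ)| ≤ Freq.abs k := Real.abs_le_sqrt
      (Finset.single_le_sum (f := fun j => ((k.1 j : ℤ) : ℝ) ^ 2)
        (fun j _ => sq_nonneg _) (Finset.mem_univ i))
    have h2 : |((k.1 i : ℤ) : ℝ)| ≤ (N : ℝ) := h1.trans hk
    exact_mod_cast h2
  exact ⟨fun i => (abs_le.mp (hi i)).1, fun i => (abs_le.mp (hi i)).2⟩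

/-- The frequencies with `1 ≤ |k| ≤ N`. -/
def Freq.ball (d N : ℕ) : Finset (Freq d) := (Freq.finite_abs_le d N).toFinset

/-! ### Sobolev spaces -/

/-- `H^s`: the families of Fourier coefficients with `∑_k |k|^{2s} |φ_k|² < ∞`. -/
def MemSob {d : ℕ} (s : ℝ) (φ : Freq d → ℂ) : Prop :=
  Summable fun k => k.abs ^ (2 * s) * ‖φ k‖ ^ 2

theorem weight_sq {d : ℕ} (s : ℝ) (k : Freq d) (z : ℂ) :
    ‖(k.abs ^ s) • z‖ ^ 2 = k.abs ^ (2 * s) * ‖z‖ ^ 2 := by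
  rw [norm_smul, mul_pow, Real.norm_of_nonneg (Real.rpow_nonneg k.abs_pos.le s),
    ← Real.rpow_natCast, ← Real.rpow_mul k.abs_pos.le]
  congr 2
  push_cast
  ring

theorem memSob_iff {d : ℕ} (s : ℝ) (φ : Freq d → ℂ) :
    MemSob s φ ↔ Memℓp (fun k => (k.abs ^ s) • φ k) 2 := by
  rw [memℓp_gen_iff (by norm_num)]
  simp only [ENNReal.toReal_ofNat, Real.rpow_ofNat]
  simp only [weight_sq, MemSob]

/-- `H^s` as a real linear subspace of the space of all families of coefficients. -/
def sobSubmodule (d : ℕ) (s : ℝ) : Submodule ℝ (Freq d → ℂ) where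
  carrier := {φ | MemSob s φ}
  zero_mem' := by simp [MemSob, summable_zero]
  add_mem' := by
    intro φ ψ hφ hψ
    have h := ((memSob_iff s φ).1 hφ).add ((memSob_iff s ψ).1 hψ)
    refine (memSob_iff s _).2 ?_
    convert h using 1
    ext k
    simp
  smul_mem' := by
    intro c φ hφ
    have h := ((memSob_iff s φ).1 hφ).const_smul c
    refine (memSob_iff s _).2 ?_
    convert h using 1
    ext k
    simp
    ring

/-- The Sobolev space `H^s` of the `d`-dimensional torus (mean-zero functions or distributions,
given by their Fourier coefficients), as a type. -/
def Sob (d : ℕ) (s : ℝ) : Type := ↥(sobSubmodule d s)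

namespace Sob

variable {d : ℕ} {s : ℝ}

instance : AddCommGroup (Sob d s) := inferInstanceAs (AddCommGroup ↥(sobSubmodule d s))

instance : Module ℝ (Sob d s) := inferInstanceAs (Module ℝ ↥(sobSubmodule d s))

/-- The σ-algebra generated by the Fourier coefficients; it is also the Borel σ-algebra of the
norm, since `H^s` is separable. -/
instance : MeasurableSpace (Sob d s) := inferInstanceAs (MeasurableSpace ↥(sobSubmodule d s))

/-- The Fourier coefficients of an element of `H^s`. -/
def coeff (φ : Sob d s) : Freq d → ℂ := Subtype.val φ

/-- The element of `H^s` with given coefficients. -/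
def mk (φ : Freq d → ℂ) (h : MemSob s φ) : Sob d s := Subtype.mk φ h

@[ext]
theorem ext {φ ψ : Sob d s} (h : φ.coeff = ψ.coeff) : φ = ψ := Subtype.ext h

theorem coeff_add (φ ψ : Sob d s) : (φ + ψ).coeff = φ.coeff + ψ.coeff := rfl

theorem coeff_smul (c : ℝ) (φ : Sob d s) : (c • φ).coeff = c • φ.coeff := rfl

theorem memSob (φ : Sob d s) : MemSob s φ.coeff := Subtype.property φ

/-- The bijection `φ ↦ (|k|^s φ_k)_k` of `H^s` onto `ℓ²`. -/
def toEll2 (d : ℕ) (s : ℝ) : Sob d s ≃ₗ[ℝ] lp (fun _ : Freq d => ℂ) 2 where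
  toFun φ := ⟨fun k => (k.abs ^ s) • φ.coeff k, (memSob_iff s _).1 φ.memSob⟩
  map_add' φ ψ := by
    ext k
    exact smul_add _ _ _
  map_smul' c φ := by
    ext k
    simp [coeff_smul]
    ring
  invFun u := mk (fun k => (k.abs ^ (-s)) • u k) ((memSob_iff s _).2 (by
    convert lp.memℓp u using 1
    ext k
    rw [smul_smul, ← Real.rpow_add k.abs_pos, add_neg_cancel, Real.rpow_zero, one_smul]))
  left_inv φ := by
    ext k
    change (k.abs ^ (-s)) • (k.abs ^ s) • φ.coeff k = φ.coeff k
    rw [smul_smul, ← Real.rpow_add k.abs_pos, neg_add_cancel, Real.rpow_zero, one_smul]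
  right_inv u := by
    ext k
    change (k.abs ^ s) • (k.abs ^ (-s)) • u k = u k
    rw [smul_smul, ← Real.rpow_add k.abs_pos, add_neg_cancel, Real.rpow_zero, one_smul]

/-- The norm `‖φ‖² = ∑_k |k|^{2s} |φ_k|²`, see `norm_sq`. -/
instance : NormedAddCommGroup (Sob d s) :=
  NormedAddCommGroup.induced _ _ (toEll2 d s) (toEll2 d s).injective

/-- The real inner product `Re ∑_k |k|^{2s} φ_k conj(ψ_k)` that goes with the norm. -/
instance : InnerProductSpace ℝ (Sob d s) where
  norm_smul_le c φ := by
    change ‖toEll2 d s (c • φ)‖ ≤ ‖c‖ * ‖toEll2 d s φ‖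
    rw [map_smul, norm_smul]
  inner φ ψ := inner ℝ (toEll2 d s φ) (toEll2 d s ψ)
  norm_sq_eq_re_inner φ := by
    change ‖toEll2 d s φ‖ ^ 2 = _
    exact norm_sq_eq_re_inner (𝕜 := ℝ) _
  conj_inner_symm φ ψ := inner_conj_symm (𝕜 := ℝ) _ _
  add_left φ ψ χ := by
    change inner ℝ (toEll2 d s (φ + ψ)) _ = _
    rw [map_add, inner_add_left]
  smul_left φ ψ c := by
    change inner ℝ (toEll2 d s (c • φ)) _ = _
    rw [map_smul, inner_smul_left]

theorem inner_def (φ ψ : Sob d s) :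
    inner ℝ φ ψ = inner ℝ (toEll2 d s φ) (toEll2 d s ψ) := rfl

theorem norm_sq (φ : Sob d s) : ‖φ‖ ^ 2 = ∑' k, k.abs ^ (2 * s) * ‖φ.coeff k‖ ^ 2 := by
  change ‖toEll2 d s φ‖ ^ 2 = _
  have h := lp.norm_rpow_eq_tsum (p := 2) (by norm_num) (toEll2 d s φ)
  simp only [ENNReal.toReal_ofNat, Real.rpow_ofNat] at h
  rw [h]
  exact tsum_congr fun k => weight_sq s k _

instance : CompleteSpace (Sob d s) := by
  let e : Sob d s ≃ₗᵢ[ℝ] lp (fun _ : Freq d => ℂ) 2 := ⟨toEll2 d s, fun _ => rfl⟩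
  exact (completeSpace_congr (e := e.toEquiv) e.isometry.isUniformEmbedding).2 inferInstance

/-- The inclusion `H^s ⊆ H^t` for `t ≤ s`. -/
def incl {d : ℕ} {s t : ℝ} (h : t ≤ s) : Sob d s →ₗ[ℝ] Sob d t where
  toFun φ := mk φ.coeff (Summable.of_nonneg_of_le
    (fun k => mul_nonneg (Real.rpow_nonneg k.abs_pos.le _) (sq_nonneg _))
    (fun k => mul_le_mul_of_nonneg_right
      (Real.rpow_le_rpow_of_exponent_le k.one_le_abs (by linarith)) (sq_nonneg _)) φ.memSob)
  map_add' _ _ := rfl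
  map_smul' _ _ := rfl

open Classical in
/-- `φ` as an element of `H^s` if it lies there, and `0` otherwise. -/
def ofCoeff (s : ℝ) (φ : Freq d → ℂ) : Sob d s := if h : MemSob s φ then mk φ h else 0

theorem memSob_of_finite_support {φ : Freq d → ℂ} (h : φ.support.Finite) : MemSob s φ := by
  refine summable_of_ne_finset_zero (s := h.toFinset) fun k hk => ?_
  have : φ k = 0 := by simpa using hk
  simp [this]

open Classical in
/-- The vectors `|j|^{-s} e_j` and `i |j|^{-s} e_j`. -/
def basisVec (d : ℕ) (s : ℝ) (j : Freq d × Fin 2) : Sob d s :=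
  mk (Pi.single j.1 ((j.1.abs ^ (-s)) • (![1, Complex.I] j.2)))
    (memSob_of_finite_support ((Set.finite_singleton j.1).subset Pi.support_single_subset))

theorem toEll2_basisVec (j : Freq d × Fin 2) :
    toEll2 d s (basisVec d s j) = lp.single 2 j.1 (![1, Complex.I] j.2) := by
  classical
  ext k
  change (k.abs ^ s) • (Pi.single j.1 ((j.1.abs ^ (-s)) • (![1, Complex.I] j.2)) :
    Freq d → ℂ) k = _
  rw [lp.single_apply]
  by_cases h : k = j.1
  · subst h
    rw [Pi.single_eq_same, Pi.single_eq_same, smul_smul, ← Real.rpow_add (Freq.abs_pos _),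
      add_neg_cancel, Real.rpow_zero, one_smul]
  · rw [Pi.single_eq_of_ne h, Pi.single_eq_of_ne h, smul_zero]

theorem inner_basisVec (j : Freq d × Fin 2) (φ : Sob d s) :
    inner ℝ (basisVec d s j) φ = inner ℝ (![1, Complex.I] j.2 : ℂ) (toEll2 d s φ j.1) := by
  rw [inner_def, toEll2_basisVec, lp.inner_single_left]

theorem orthonormal_basisVec (d : ℕ) (s : ℝ) : Orthonormal ℝ (basisVec d s) := by
  classical
  rw [orthonormal_iff_ite]
  rintro ⟨j, a⟩ ⟨k, b⟩
  rw [inner_basisVec, toEll2_basisVec, lp.single_apply]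
  by_cases h : j = k
  · subst h
    rw [Pi.single_eq_same]
    fin_cases a <;> fin_cases b <;> simp [Complex.inner]
  · simp [h]

/-- The orthonormal basis `{|j|^{-s} e_j, i |j|^{-s} e_j}` of the real Hilbert space `H^s`. -/
def basis (d : ℕ) (s : ℝ) : HilbertBasis (Freq d × Fin 2) ℝ (Sob d s) :=
  HilbertBasis.mkOfOrthogonalEqBot (orthonormal_basisVec d s) (by
    rw [Submodule.eq_bot_iff]
    intro φ hφ
    have h : ∀ j, inner ℝ (basisVec d s j) φ = 0 := fun j =>
      (Submodule.mem_orthogonal _ _).1 hφ _ (Submodule.subset_span ⟨j, rfl⟩)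
    apply (toEll2 d s).injective
    rw [map_zero]
    ext k
    have h0 := h (k, 0)
    have h1 := h (k, 1)
    rw [inner_basisVec] at h0 h1
    apply Complex.ext
    · simpa [Complex.inner] using h0
    · simpa [Complex.inner] using h1)

end Sob

/-! ### The Gaussian measure -/

/-- The law of one Fourier mode: density `|k|^a / (2π) exp(-|k|^a |z|² / 2)` on `ℂ = ℝ²`. -/
def gaussMode {d : ℕ} (a : ℝ) (k : Freq d) : Measure ℂ :=
  volume.withDensity fun z =>
    ENNReal.ofReal (k.abs ^ a / (2 * Real.pi) * Real.exp (-(k.abs ^ a / 2) * ‖z‖ ^ 2))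

instance {d : ℕ} (a : ℝ) (k : Freq d) : IsProbabilityMeasure (gaussMode a k) := by
  have hk : 0 < k.abs ^ a := Real.rpow_pos_of_pos k.abs_pos a
  have hI := Complex.integral_exp_neg_mul_rpow (p := 2) (b := k.abs ^ a / 2) one_le_two
    (by positivity)
  simp only [Real.rpow_ofNat] at hI
  have hG : Real.pi * (k.abs ^ a / 2) ^ (-(2 : ℝ) / 2) * Real.Gamma (2 / 2 + 1)
      = 2 * Real.pi / k.abs ^ a := by
    rw [show (-(2 : ℝ) / 2) = -1 by norm_num, Real.rpow_neg_one,
      show ((2 : ℝ) / 2 + 1) = 2 by norm_num, Real.Gamma_two]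
    field_simp
  rw [hG] at hI
  have hint : Integrable fun z : ℂ => Real.exp (-(k.abs ^ a / 2) * ‖z‖ ^ 2) := by
    by_contra hn
    rw [integral_undef hn] at hI
    have : 0 < 2 * Real.pi / k.abs ^ a := by positivity
    linarith
  constructor
  rw [gaussMode, withDensity_apply _ MeasurableSet.univ, Measure.restrict_univ,
    ← ofReal_integral_eq_lintegral_ofReal (hint.const_mul _)
      (ae_of_all _ fun z => by positivity), integral_const_mul, hI]
  rw [show k.abs ^ a / (2 * Real.pi) * (2 * Real.pi / k.abs ^ a) = 1 by field_simp]
  exact ENNReal.ofReal_one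

/-- The product measure `μ_a = ∏_k μ_a^k` on all families of Fourier coefficients. -/
def gaussSeq (d : ℕ) (a : ℝ) : Measure (Freq d → ℂ) := Measure.infinitePi (gaussMode a)

/-- The measure `μ_a` on the subspace `H^β`. -/
def gauss (d : ℕ) (a β : ℝ) : Measure (Sob d β) := (gaussSeq d a).comap Sob.coeff

/-! ### The cubic nonlinearity -/

/-- The coefficient at an arbitrary frequency, the zero mode being `0`. -/
def ext0 {d : ℕ} (φ : Freq d → ℂ) (n : Fin d → ℤ) : ℂ := if h : n ≠ 0 then φ ⟨n, h⟩ else 0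

/-- The term `φ_{k-m} φ_{l+m} conj(φ_l)` for the pair `x = (l, m)`. -/
def cubicTerm {d : ℕ} (φ : Freq d → ℂ) (k : Freq d) (x : (Fin d → ℤ) × (Fin d → ℤ)) : ℂ :=
  ext0 φ (k.1 - x.2) * ext0 φ (x.1 + x.2) * conj (ext0 φ x.1)

/-- `B_k(φ) = ∑_{l,m} φ_{k-m} φ_{l+m} conj(φ_l)`. -/
def cubic {d : ℕ} (φ : Freq d → ℂ) (k : Freq d) : ℂ := ∑' x, cubicTerm φ k x

/-- `B(φ)` is well defined as an element of `H^β`: the series for its coefficients converge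
absolutely and their sums are the coefficients of an element of `H^β`. -/
def CubicDefined {d : ℕ} (β : ℝ) (φ : Freq d → ℂ) : Prop :=
  (∀ k, Summable (cubicTerm φ k)) ∧ MemSob β (cubic φ)

/-- The vector field `B` on `H^β` (to be used where `CubicDefined` holds). -/
def B (d : ℕ) (β : ℝ) (φ : Sob d β) : Sob d β := Sob.ofCoeff β (cubic φ.coeff)

open Classical in
/-- The projection `Π_N` onto the frequencies `1 ≤ |k| ≤ N`. -/
def proj {d : ℕ} (N : ℕ) (φ : Freq d → ℂ) : Freq d → ℂ :=
  fun k => if k ∈ Freq.ball d N then φ k else 0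

theorem memSob_proj {d : ℕ} (s : ℝ) (N : ℕ) (φ : Freq d → ℂ) : MemSob s (proj N φ) := by
  classical
  refine Sob.memSob_of_finite_support ((Freq.ball d N).finite_toSet.subset fun k hk => ?_)
  by_contra h
  exact hk (if_neg h)

/-- The renormalisation constant `4 ∑_{1 ≤ |m| ≤ N} |m|^{-2}`. -/
def renorm (d N : ℕ) : ℝ := 4 * ∑ m ∈ Freq.ball d N, 1 / m.abs ^ 2

/-- The truncated renormalised vector field
`(:B:)^N(φ) = Π_N B(Π_N φ) - 4 (∑_{1 ≤ |m| ≤ N} |m|^{-2}) Π_N φ`. -/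
def wickB (d N : ℕ) (β : ℝ) (φ : Sob d β) : Sob d β :=
  Sob.mk (proj N (cubic (proj N φ.coeff))) (memSob_proj β N _)
    - renorm d N • Sob.mk (proj N φ.coeff) (memSob_proj β N _)

/-! ### Gradients and Hilbert–Schmidt norms -/

/-- `T` is the gradient of `F` at `φ` along the Cameron–Martin space `H^1`: for all `v ∈ H^1`,
`(F(φ + ε v) - F(φ)) / ε → T v` in `H^β` as `ε → 0`. -/
def IsGradientAt {d : ℕ} {β : ℝ} (h : β ≤ 1) (F : Sob d β → Sob d β) (φ : Sob d β)
    (T : Sob d 1 →L[ℝ] Sob d β) : Prop :=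
  ∀ v : Sob d 1, Tendsto (fun ε : ℝ => ε⁻¹ • (F (φ + ε • Sob.incl h v) - F φ)) (𝓝[≠] 0) (𝓝 (T v))

/-- The Hilbert–Schmidt norm `(∑_i ‖T b_i‖²)^{1/2}` for an orthonormal basis `b`; it is finite iff
`T` is Hilbert–Schmidt. -/
def hsNorm {ι E G : Type*} [NormedAddCommGroup E] [InnerProductSpace ℝ E]
    [NormedAddCommGroup G] [InnerProductSpace ℝ G] (b : HilbertBasis ι ℝ E) (T : E →L[ℝ] G) :
    ℝ≥0∞ :=
  (∑' i, ‖T (b i)‖ₑ ^ 2) ^ (1 / 2 : ℝ)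

/-- `T ∈ L^q(μ; HS(H^1, H^β))`. For operators between separable Hilbert spaces, strong
measurability as a map into the Hilbert–Schmidt operators is the same as strong measurability of
`φ ↦ T(φ) v` for every `v`. -/
def MemLpHS {d : ℕ} {β : ℝ} (T : Sob d β → Sob d 1 →L[ℝ] Sob d β) (q : ℕ)
    (μ : Measure (Sob d β)) : Prop :=
  (∀ v, AEStronglyMeasurable (fun φ => T φ v) μ) ∧
    ∫⁻ φ, hsNorm (Sob.basis d 1) (T φ) ^ q ∂μ < ∞

end NLS

end

noncomputable section

namespace NLS

open ProbabilityTheory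

variable {d : ℕ}

/-! ### Moments of Gaussian vectors -/

/-! The cubic field is a real-trilinear form in `(φ, φ, φ)`: its `k`-th coefficient sums `φ_a φ_b
conj(φ_l)` over the resonances `a + b - l = k`. Along a direction `v` it is therefore a cubic
polynomial in `ε`. The existence of a gradient reduces to giving a meaning, in `H^β`, to each of the
four Taylor coefficients (`isGradientAt_of_expansion`).

In dimension one everything is deterministic. Almost every `φ` lies in `H^{2/5}`, since `∑
|k|^{4/5-2} < ∞`, and the form is bounded from `(H^{2/5})³` to `L²`, hence to `H^β`
(`tsum_triAbs_sq_le`). The gradient is Hilbert–Schmidt because `H^1 → H^{2/5}` is, and its moments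
are those of the Gaussian norm `‖φ‖_{H^{2/5}}` (`lintegral_sobSq_pow`).

In dimension two the contractions `a = l` and `b = l` diverge logarithmically. The renormalisation
constant equals `2 ∑ E|φ_m|²`, one copy of the variance sum for each contraction, so the truncated
fields have Wick polynomials of degree three as coefficients (`coeff_wickB`). Their gradients on
basis vectors have Wick polynomials of degree two (`coeff_gradTwo_single`). Moments of order `2p` of
such polynomials are controlled by the `p`-th power of a weighted sum of squared kernels. This is
proved by decoupling: a Wick polynomial is the average, over an independent copy, of a form in the
rotated pair `(φ ± ψ)/√2` (`lintegral_pow_le_of_average`), and there one argument at a time can be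
integrated as a Gaussian linear form.

For both the fields and the gradients the kernel sum is dominated by the same quantity, `∑_{a+b-l=k}
|k|^{2β} |a|^{-2} |b|^{-2} |l|^{-2}`: in the gradient, the weight `|j|^{-2}` of the `H^1` basis
replaces the variance of the differentiated mode. It is finite by a weighted arithmetic–geometric
mean inequality (`qsum_wt_lt_top`). Differences of truncations see only its tail, whence uniform
bounds and Cauchy estimates in every `L^{2p}`.

The limit field and limit gradient are taken pointwise along one subsequence of truncations. On a
single set of full measure the field and gradient converge at `φ`, while the terms with at least two
entries from `H^1` converge absolutely for every `v`. Passing to the limit in the exact expansion of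
the truncations then gives the expansion of the limit in all directions at once
(`ae_isGradientAt_wickLim`). -/

/-- Minkowski's inequality for the `p`-th moments of finitely many nonnegative functions. -/
theorem lintegral_sum_pow_le {Ω κ : Type*} [MeasurableSpace Ω] {μ : Measure Ω} (s : Finset κ)
    {g : κ → Ω → ℝ≥0∞} (hg : ∀ j, Measurable (g j)) {p : ℕ} (hp : 1 ≤ p) {M : ℝ≥0∞}
    {v : κ → ℝ≥0∞} (h : ∀ j, ∫⁻ ω, g j ω ^ p ∂μ ≤ M * v j ^ p) :
    ∫⁻ ω, (∑ j ∈ s, g j ω) ^ p ∂μ ≤ M * (∑ j ∈ s, v j) ^ p := by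
  have hp0 : (0 : ℝ) < p := by exact_mod_cast hp
  have hpow : ∀ x : ℝ≥0∞, (x ^ p) ^ (1 / (p : ℝ)) = x := fun x => by
    rw [← ENNReal.rpow_natCast, ← ENNReal.rpow_mul, mul_one_div_cancel hp0.ne', ENNReal.rpow_one]
  have hpow' : ∀ x : ℝ≥0∞, (x ^ (1 / (p : ℝ))) ^ p = x := fun x => by
    rw [← ENNReal.rpow_natCast, ← ENNReal.rpow_mul, one_div_mul_cancel hp0.ne', ENNReal.rpow_one]
  have h1 := eLpNorm'_sum_le (μ := μ) (s := s) (f := g) (q := (p : ℝ))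
    (fun j _ => (hg j).aestronglyMeasurable) (by exact_mod_cast hp)
  simp only [eLpNorm'_eq_lintegral_enorm, enorm_eq_self, ENNReal.rpow_natCast,
    Finset.sum_apply] at h1
  have h2 : (∫⁻ ω, (∑ j ∈ s, g j ω) ^ p ∂μ) ^ (1 / (p : ℝ)) ≤
      M ^ (1 / (p : ℝ)) * ∑ j ∈ s, v j := by
    refine h1.trans ?_
    rw [Finset.mul_sum]
    refine Finset.sum_le_sum fun j _ => ?_
    refine (ENNReal.rpow_le_rpow (h j) (by positivity)).trans ?_
    rw [ENNReal.mul_rpow_of_nonneg _ _ (by positivity), hpow]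
  have h3 := pow_le_pow_left' h2 p
  rwa [hpow', mul_pow, hpow'] at h3

/-- The moment `E g^{2p}` of a standard real Gaussian variable. -/
def gaussMoment (p : ℕ) : ℝ≥0∞ := ∫⁻ x, ‖x‖ₑ ^ (2 * p) ∂(gaussianReal 0 1)

theorem gaussMoment_lt_top (p : ℕ) : gaussMoment p < ∞ := by
  rcases Nat.eq_zero_or_pos p with rfl | hp
  · simp [gaussMoment]
  have h := (memLp_id_gaussianReal (μ := 0) (v := 1) (2 * p : ℕ)).2
  have h0 : ((2 * p : ℕ) : ℝ≥0∞) ≠ 0 := by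
    exact_mod_cast (by omega : 2 * p ≠ 0)
  have h' := (eLpNorm_lt_top_iff_lintegral_rpow_enorm_lt_top (μ := gaussianReal 0 1)
    (f := (id : ℝ → ℝ)) h0 (ENNReal.natCast_ne_top _)).1 (by simpa using h)
  simpa [gaussMoment, ← ENNReal.rpow_natCast] using h'

theorem lintegral_gaussianReal_pow (v : ℝ≥0) (p : ℕ) :
    ∫⁻ x, ‖x‖ₑ ^ (2 * p) ∂(gaussianReal 0 v) = gaussMoment p * (v : ℝ≥0∞) ^ p := by
  have hmap : gaussianReal 0 v = (gaussianReal 0 1).map (fun x : ℝ => (NNReal.sqrt v : ℝ) * x) := by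
    rw [gaussianReal_map_const_mul]
    congr 1
    · simp
    · ext
      simp
  rw [hmap, lintegral_map (by fun_prop) (by fun_prop), gaussMoment,
    ← lintegral_mul_const _ (by fun_prop)]
  refine lintegral_congr fun x => ?_
  rw [enorm_mul, mul_pow, mul_comm, pow_mul ‖(NNReal.sqrt v : ℝ)‖ₑ]
  congr 2
  rw [Real.enorm_eq_ofReal (by positivity), ← ENNReal.ofReal_pow (by positivity), ← NNReal.coe_pow,
    NNReal.sq_sqrt, ENNReal.ofReal_coe_nnreal]

section

variable {E : Type*} [NormedAddCommGroup E] [NormedSpace ℝ E] [MeasurableSpace E] [BorelSpace E]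
  {P : Measure E} [IsGaussian P]

/-- A continuous functional of a centred Gaussian is a real Gaussian, so its moments are those of
the standard one scaled by the variance. -/
theorem lintegral_dual_pow (hP : ∀ L : StrongDual ℝ E, P[L] = 0) (L : StrongDual ℝ E) (p : ℕ) :
    ∫⁻ φ, ‖L φ‖ₑ ^ (2 * p) ∂P = gaussMoment p * (∫⁻ φ, ‖L φ‖ₑ ^ 2 ∂P) ^ p := by
  have key : ∀ p : ℕ, ∫⁻ φ, ‖L φ‖ₑ ^ (2 * p) ∂P =
      gaussMoment p * ((Var[L; P].toNNReal : ℝ≥0) : ℝ≥0∞) ^ p := fun p => by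
    rw [← lintegral_gaussianReal_pow, ← hP L, ← IsGaussian.map_eq_gaussianReal L,
      lintegral_map (by fun_prop) (by fun_prop)]
  have hvar : ∫⁻ φ, ‖L φ‖ₑ ^ 2 ∂P = ((Var[L; P].toNNReal : ℝ≥0) : ℝ≥0∞) := by
    have h := ofReal_variance (IsGaussian.memLp_dual P L 2 (by simp))
    rw [evariance_eq_lintegral_ofReal] at h
    change _ = ENNReal.ofReal _
    rw [h]
    refine lintegral_congr fun φ => ?_
    rw [hP L, sub_zero, Real.enorm_eq_ofReal_abs, ← ENNReal.ofReal_pow (abs_nonneg _), sq_abs]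
  rw [key, hvar]

/-- A finite-dimensional centred Gaussian vector has `2p`-th moments bounded by the second one. -/
theorem lintegral_sum_dual_pow (hP : ∀ L : StrongDual ℝ E, P[L] = 0) {κ : Type*} [Fintype κ]
    (L : κ → StrongDual ℝ E) {p : ℕ} (hp : 1 ≤ p) :
    ∫⁻ φ, (∑ j, ‖L j φ‖ₑ ^ 2) ^ p ∂P ≤
      gaussMoment p * (∫⁻ φ, ∑ j, ‖L j φ‖ₑ ^ 2 ∂P) ^ p := by
  rw [lintegral_finsetSum _ (fun j _ => by fun_prop)]
  refine lintegral_sum_pow_le _ (fun j => by fun_prop) hp fun j => ?_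
  simp_rw [← pow_mul]
  exact (lintegral_dual_pow hP (L j) p).le

/-- Real and imaginary parts are real functionals, so the real bound applies to a family twice as
large. -/
theorem lintegral_sum_clm_pow (hP : ∀ L : StrongDual ℝ E, P[L] = 0) {κ : Type*} [Fintype κ]
    (L : κ → E →L[ℝ] ℂ) {p : ℕ} (hp : 1 ≤ p) :
    ∫⁻ φ, (∑ j, ‖L j φ‖ₑ ^ 2) ^ p ∂P ≤
      gaussMoment p * (∫⁻ φ, ∑ j, ‖L j φ‖ₑ ^ 2 ∂P) ^ p := by
  have hsplit : ∀ z : ℂ, ‖z‖ₑ ^ 2 = ‖z.re‖ₑ ^ 2 + ‖z.im‖ₑ ^ 2 := fun z => by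
    rw [← ofReal_norm z, Real.enorm_eq_ofReal_abs, Real.enorm_eq_ofReal_abs,
      ← ENNReal.ofReal_pow (norm_nonneg _), ← ENNReal.ofReal_pow (abs_nonneg _),
      ← ENNReal.ofReal_pow (abs_nonneg _), ← ENNReal.ofReal_add (sq_nonneg _) (sq_nonneg _),
      sq_abs, sq_abs, Complex.sq_norm, Complex.normSq_apply, ← sq, ← sq]
  have h := lintegral_sum_dual_pow hP (κ := κ ⊕ κ)
    (Sum.elim (fun j => Complex.reCLM.comp (L j)) (fun j => Complex.imCLM.comp (L j))) hp
  simpa [Fintype.sum_sum_type, hsplit, Finset.sum_add_distrib] using h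

/-- Decoupling: if `f` is obtained from `G(x, y)` by averaging over the rotated independent copy,
then the moments of `f` are bounded by those of `G`. -/
theorem lintegral_pow_le_of_average [SecondCountableTopology E] [CompleteSpace E]
    (hP : ∀ L : StrongDual ℝ E, P[L] = 0)
    {H : Type*} [NormedAddCommGroup H] [NormedSpace ℝ H] {f : E → H} {G : E → E → H}
    (hG : Measurable fun x : E × E => ‖G x.1 x.2‖ₑ) (κ : ℝ)
    (hf : ∀ φ, f φ = κ • ∫ ψ, G ((√2)⁻¹ • (φ + ψ)) ((√2)⁻¹ • (φ - ψ)) ∂P)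
    {q : ℕ} (hq : 1 ≤ q) :
    ∫⁻ φ, ‖f φ‖ₑ ^ q ∂P ≤ ‖κ‖ₑ ^ q * ∫⁻ x, ∫⁻ y, ‖G x y‖ₑ ^ q ∂P ∂P := by
  -- Rotation by `π/4` preserves `P ⊗ P` because `P` is centred Gaussian. In the formula `hr`, `φ`
  -- is the second coordinate and `ψ` the first, which is why the symmetric form of Tonelli is used
  -- at the end.
  have hrot := IsGaussian.map_rotation_eq_self_of_forall_strongDual_eq_zero hP (Real.pi / 4)
  have hr : ∀ x : E × E, ContinuousLinearMap.rotation (Real.pi / 4) x =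
      ((√2)⁻¹ • (x.2 + x.1), (√2)⁻¹ • (x.2 - x.1)) := fun x => by
    rw [ContinuousLinearMap.rotation_apply, Real.cos_pi_div_four, Real.sin_pi_div_four]
    have h2 : √2 / 2 = (√2)⁻¹ := by
      rw [Real.sqrt_div_self', one_div]
    rw [h2]
    ext
    · simp only
      module
    · simp only
      module
  have hm : Measurable fun x : E × E => ‖G x.1 x.2‖ₑ ^ q := hG.pow_const q
  have hm' : Measurable fun x : E × E => ‖G ((√2)⁻¹ • (x.2 + x.1)) ((√2)⁻¹ • (x.2 - x.1))‖ₑ := by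
    exact hG.comp (g := fun x : E × E => ‖G x.1 x.2‖ₑ)
      (f := fun x : E × E => ((√2)⁻¹ • (x.2 + x.1), (√2)⁻¹ • (x.2 - x.1))) (by fun_prop)
  have hjensen : ∀ g : E → ℝ≥0∞, Measurable g → (∫⁻ ψ, g ψ ∂P) ^ q ≤ ∫⁻ ψ, g ψ ^ q ∂P := by
    intro g hg
    have h := eLpNorm'_le_eLpNorm'_of_exponent_le (μ := P) (f := g) zero_lt_one
      (by exact_mod_cast hq : (1 : ℝ) ≤ q) hg.aestronglyMeasurable
    simp only [eLpNorm'_eq_lintegral_enorm, enorm_eq_self, ENNReal.rpow_natCast, div_one,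
      ENNReal.rpow_one] at h
    have h' := pow_le_pow_left' h q
    have hq0 : (q : ℝ) ≠ 0 := by
      have : (1 : ℝ) ≤ q := by exact_mod_cast hq
      positivity
    rwa [← ENNReal.rpow_natCast (_ ^ (1 / (q : ℝ))) q, ← ENNReal.rpow_mul,
      one_div_mul_cancel hq0, ENNReal.rpow_one] at h'
  calc ∫⁻ φ, ‖f φ‖ₑ ^ q ∂P
      ≤ ∫⁻ φ, ‖κ‖ₑ ^ q * ∫⁻ ψ, ‖G ((√2)⁻¹ • (φ + ψ)) ((√2)⁻¹ • (φ - ψ))‖ₑ ^ q ∂P ∂P := by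
        refine lintegral_mono fun φ => ?_
        rw [hf φ, enorm_smul, mul_pow]
        gcongr
        refine (pow_le_pow_left' (enorm_integral_le_lintegral_enorm _) q).trans (hjensen _ ?_)
        exact hm'.comp (measurable_id.prodMk measurable_const)
    _ = ‖κ‖ₑ ^ q * ∫⁻ φ, ∫⁻ ψ, ‖G ((√2)⁻¹ • (φ + ψ)) ((√2)⁻¹ • (φ - ψ))‖ₑ ^ q ∂P ∂P := by
        rw [lintegral_const_mul' _ _ (by simp)]
    _ = ‖κ‖ₑ ^ q * ∫⁻ x, ‖G x.1 x.2‖ₑ ^ q ∂(P.prod P) := by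
        congr 1
        conv_rhs => rw [← hrot, lintegral_map hm (by fun_prop)]
        simp only [hr]
        rw [lintegral_prod_symm' _ (hm'.pow_const q)]
    _ = _ := by rw [lintegral_prod _ hm.aemeasurable]

end

/-! ### Products of circular Gaussian laws -/

/-- A centred Gaussian law on `ℂ` which is invariant under rotations and has `E|z|² = c`. -/
structure IsCircularGaussian (γ : Measure ℂ) (c : ℝ≥0) : Prop where
  isGaussian : IsGaussian γ
  map_mul : ∀ u : ℂ, ‖u‖ = 1 → γ.map (fun z => u * z) = γ
  integral_sq : ∫ z, ‖z‖ ^ 2 ∂γ = c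

namespace IsCircularGaussian

variable {ι : Type*} [Fintype ι] {γ : ι → Measure ℂ} [∀ i, IsProbabilityMeasure (γ i)] {c : ι → ℝ≥0}

theorem isGaussian_pi (hγ : ∀ i, IsCircularGaussian (γ i) (c i)) : IsGaussian (Measure.pi γ) := by
  have h := iIndepFun.hasGaussianLaw (P := Measure.pi γ) (X := fun (i : ι) (ω : ι → ℂ) => ω i)
    (fun i => ⟨by
      rw [(measurePreserving_eval γ i).map_eq]
      exact (hγ i).isGaussian⟩)
    (iIndepFun_pi (X := fun _ z => z) fun i => aemeasurable_id)
  have h' := h.isGaussian_map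
  rwa [show (fun (ω : ι → ℂ) x => ω x) = id from rfl, Measure.map_id] at h'

theorem map_mul_pi (hγ : ∀ i, IsCircularGaussian (γ i) (c i)) {u : ι → ℂ} (hu : ∀ i, ‖u i‖ = 1) :
    (Measure.pi γ).map (fun φ i => u i * φ i) = Measure.pi γ := by
  have h := fun i => (hγ i).map_mul (u i) (hu i)
  have : ∀ i, SigmaFinite ((γ i).map fun z => u i * z) := fun i => by
    rw [h i]
    infer_instance
  rw [Measure.pi_map_pi (fun i => by fun_prop)]
  simp_rw [h]

/-- Independent phases on the modes preserve the product law. The mixed moments that vanish below do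
so because a suitable choice of phases changes their sign. -/
theorem integral_comp_mul (hγ : ∀ i, IsCircularGaussian (γ i) (c i)) {u : ι → ℂ}
    (hu : ∀ i, ‖u i‖ = 1) {F : Type*} [NormedAddCommGroup F] [NormedSpace ℝ F]
    [SecondCountableTopology F]
    {f : (ι → ℂ) → F} (hf : Continuous f) :
    ∫ φ, f (fun i => u i * φ i) ∂Measure.pi γ = ∫ φ, f φ ∂Measure.pi γ := by
  conv_rhs => rw [← map_mul_pi hγ hu]
  rw [integral_map (measurable_pi_lambda _ fun i => by fun_prop).aemeasurable
    hf.aestronglyMeasurable]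

theorem integral_dual_eq_zero (hγ : ∀ i, IsCircularGaussian (γ i) (c i))
    (L : StrongDual ℝ (ι → ℂ)) : ∫ φ, L φ ∂Measure.pi γ = 0 := by
  have h := integral_comp_mul hγ (u := fun _ => -1) (by simp) L.continuous
  have h' : ∀ φ : ι → ℂ, L (fun i => -1 * φ i) = - L φ := fun φ => by
    rw [← map_neg]
    congr 1
    ext i
    simp
  simp_rw [h', integral_neg] at h
  linarith

/-! ### Integrability and mixed moments of the modes. -/

theorem integrable_of_norm_le (hγ : ∀ i, IsCircularGaussian (γ i) (c i)) {f : (ι → ℂ) → ℂ}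
    (hf : Continuous f) (n : ℕ) (h : ∀ φ, ‖f φ‖ ≤ ‖φ‖ ^ n) : Integrable f (Measure.pi γ) := by
  have := isGaussian_pi hγ
  have h1 : MemLp id (n : ℝ≥0∞) (Measure.pi γ) :=
    IsGaussian.memLp_id (Measure.pi γ) n (ENNReal.natCast_ne_top n)
  have h2 : Integrable (fun φ : ι → ℂ => ‖φ‖ ^ n) (Measure.pi γ) := h1.integrable_norm_pow'
  refine h2.mono' hf.aestronglyMeasurable (ae_of_all _ h)

theorem integrable_eval (hγ : ∀ i, IsCircularGaussian (γ i) (c i)) (a : ι) :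
    Integrable (fun φ : ι → ℂ => φ a) (Measure.pi γ) :=
  integrable_of_norm_le hγ (by fun_prop) 1 fun φ => by simpa using norm_le_pi_norm φ a

theorem integrable_mul (hγ : ∀ i, IsCircularGaussian (γ i) (c i)) (a b : ι) :
    Integrable (fun φ : ι → ℂ => φ a * φ b) (Measure.pi γ) :=
  integrable_of_norm_le hγ (by fun_prop) 2 fun φ => by
    rw [norm_mul, sq]
    gcongr <;> exact norm_le_pi_norm φ _

theorem integrable_mul_conj (hγ : ∀ i, IsCircularGaussian (γ i) (c i)) (a b : ι) :
    Integrable (fun φ : ι → ℂ => φ a * conj (φ b)) (Measure.pi γ) :=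
  integrable_of_norm_le hγ (by fun_prop) 2 fun φ => by
    rw [norm_mul, sq, RCLike.norm_conj]
    gcongr <;> exact norm_le_pi_norm φ _

theorem integrable_mul_mul_conj (hγ : ∀ i, IsCircularGaussian (γ i) (c i)) (a b l : ι) :
    Integrable (fun φ : ι → ℂ => φ a * φ b * conj (φ l)) (Measure.pi γ) :=
  integrable_of_norm_le hγ (by fun_prop) 3 fun φ => by
    rw [norm_mul, norm_mul, pow_succ, sq, RCLike.norm_conj]
    gcongr <;> exact norm_le_pi_norm φ _

theorem integral_eval (hγ : ∀ i, IsCircularGaussian (γ i) (c i)) (a : ι) :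
    ∫ φ, φ a ∂Measure.pi γ = 0 := by
  have h := integral_comp_mul hγ (u := fun _ => -1) (by simp) (f := fun φ => φ a) (by fun_prop)
  simp only [neg_mul, one_mul, integral_neg] at h
  linear_combination -h / 2

theorem integral_mul (hγ : ∀ i, IsCircularGaussian (γ i) (c i)) (a b : ι) :
    ∫ φ, φ a * φ b ∂Measure.pi γ = 0 := by
  -- The phase `-1` would leave the product unchanged. The phase `i` turns it into its negative, as
  -- neither factor is conjugated.
  have h := integral_comp_mul hγ (u := fun _ => Complex.I) (by simp) (f := fun φ => φ a * φ b)
    (by fun_prop)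
  have h' : ∀ φ : ι → ℂ, Complex.I * φ a * (Complex.I * φ b) = - (φ a * φ b) := fun φ => by
    linear_combination φ a * φ b * Complex.I_mul_I
  simp only [h', integral_neg] at h
  linear_combination -h / 2

theorem integral_mul_mul_conj (hγ : ∀ i, IsCircularGaussian (γ i) (c i)) (a b l : ι) :
    ∫ φ, φ a * φ b * conj (φ l) ∂Measure.pi γ = 0 := by
  have h := integral_comp_mul hγ (u := fun _ => -1) (by simp)
    (f := fun φ => φ a * φ b * conj (φ l)) (by fun_prop)
  have h' : ∀ φ : ι → ℂ, -1 * φ a * (-1 * φ b) * conj (-1 * φ l) = - (φ a * φ b * conj (φ l)) :=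
    fun φ => by
      simp only [_root_.map_mul, map_neg, map_one]
      ring
  simp only [h', integral_neg] at h
  linear_combination -h / 2

/-- The linear functional `φ ↦ ∑_a φ_a y_a` as a real-linear map. -/
def linearForm (y : ι → ℂ) : (ι → ℂ) →L[ℝ] ℂ :=
  ∑ a, y a • (ContinuousLinearMap.proj (R := ℝ) (φ := fun _ : ι => ℂ) a)

theorem linearForm_apply (y φ : ι → ℂ) : linearForm y φ = ∑ a, φ a * y a := by
  simp [linearForm, mul_comm]

theorem integral_mul_conj [DecidableEq ι] (hγ : ∀ i, IsCircularGaussian (γ i) (c i)) (a b : ι) :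
    ∫ φ, φ a * conj (φ b) ∂Measure.pi γ = if a = b then ((c a : ℝ) : ℂ) else 0 := by
  split_ifs with hab
  · subst hab
    rw [← (hγ a).integral_sq, ← (measurePreserving_eval γ a).map_eq,
      integral_map (measurable_pi_apply a).aemeasurable (by fun_prop), ← integral_complex_ofReal]
    refine integral_congr_ae (ae_of_all _ fun φ => ?_)
    simp [Complex.mul_conj, Complex.normSq_eq_norm_sq]
  -- For distinct modes, changing the sign of mode `a` alone reverses the sign of the product.
  · have h := integral_comp_mul hγ (u := Function.update 1 a (-1)) (by
        intro i
        by_cases hi : i = a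
        · subst hi; simp
        · simp [hi]) (f := fun φ => φ a * conj (φ b)) (by fun_prop)
    have hb : b ≠ a := fun h => hab h.symm
    simp only [Function.update_self, neg_mul, one_mul, Function.update_of_ne hb, Pi.one_apply,
      integral_neg] at h
    linear_combination -h / 2

/-- The modes are orthogonal in `L²`, so only the diagonal of the expanded square survives. -/
theorem lintegral_linear_sq (hγ : ∀ i, IsCircularGaussian (γ i) (c i)) (y : ι → ℂ) :
    ∫⁻ φ, ‖∑ a, φ a * y a‖ₑ ^ 2 ∂Measure.pi γ = ∑ a, (c a : ℝ≥0∞) * ‖y a‖ₑ ^ 2 := by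
  classical
  have hexp : ∀ φ : ι → ℂ, ((‖∑ a, φ a * y a‖ ^ 2 : ℝ) : ℂ) =
      ∑ a, ∑ b, φ a * conj (φ b) * (y a * conj (y b)) := fun φ => by
    rw [Complex.sq_norm, ← Complex.mul_conj, map_sum, Finset.sum_mul_sum]
    refine Finset.sum_congr rfl fun a _ => Finset.sum_congr rfl fun b _ => ?_
    rw [_root_.map_mul]
    ring
  have hI : Integrable (fun φ : ι → ℂ => ∑ a, ∑ b, φ a * conj (φ b) * (y a * conj (y b)))
      (Measure.pi γ) :=
    integrable_finsetSum _ fun a _ => integrable_finsetSum _ fun b _ =>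
      (integrable_mul_conj hγ a b).mul_const _
  have hI' : Integrable (fun φ : ι → ℂ => ‖∑ a, φ a * y a‖ ^ 2) (Measure.pi γ) := by
    have := hI.re
    refine this.congr (ae_of_all _ fun φ => ?_)
    simp only [← hexp]
    exact Complex.ofReal_re _
  have hval : ∫ φ, ‖∑ a, φ a * y a‖ ^ 2 ∂Measure.pi γ = ∑ a, c a * ‖y a‖ ^ 2 := by
    apply Complex.ofReal_injective
    rw [← integral_complex_ofReal]
    simp_rw [hexp]
    rw [integral_finsetSum _ fun a _ => integrable_finsetSum _ fun b _ =>
      (integrable_mul_conj hγ a b).mul_const _]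
    push_cast
    refine Finset.sum_congr rfl fun a _ => ?_
    rw [integral_finsetSum _ fun b _ => (integrable_mul_conj hγ a b).mul_const _]
    simp_rw [integral_mul_const, integral_mul_conj hγ]
    simp [Complex.mul_conj, Complex.normSq_eq_norm_sq]
  have hen : ∀ z : ℂ, ‖z‖ₑ ^ 2 = ENNReal.ofReal (‖z‖ ^ 2) := fun z => by
    rw [← ofReal_norm, ENNReal.ofReal_pow (norm_nonneg _)]
  simp_rw [hen]
  rw [← ofReal_integral_eq_lintegral_ofReal hI' (ae_of_all _ fun φ => by positivity), hval,
    ENNReal.ofReal_sum_of_nonneg fun a _ => mul_nonneg (c a).coe_nonneg (sq_nonneg _)]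
  refine Finset.sum_congr rfl fun a _ => ?_
  rw [ENNReal.ofReal_mul (c a).coe_nonneg, ENNReal.ofReal_coe_nnreal]

theorem coe_mul_enorm_sq (w : ℝ≥0) (z : ℂ) :
    (w : ℝ≥0∞) * ‖z‖ₑ ^ 2 = ‖((NNReal.sqrt w : ℝ) : ℂ) * z‖ₑ ^ 2 := by
  rw [enorm_mul, mul_pow]
  congr 1
  rw [← ofReal_norm, Complex.norm_real, Real.norm_of_nonneg (by positivity),
    ← ENNReal.ofReal_pow (by positivity), ← NNReal.coe_pow, NNReal.sq_sqrt,
    ENNReal.ofReal_coe_nnreal]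

/-! ### Moments of linear forms, decoupled forms and Wick polynomials. -/

/-- Moments of vector-valued linear forms. -/
theorem lintegral_linear_pow (hγ : ∀ i, IsCircularGaussian (γ i) (c i)) {κ : Type*} [Fintype κ]
    (w : κ → ℝ≥0) (y : κ → ι → ℂ) {p : ℕ} (hp : 1 ≤ p) :
    ∫⁻ φ, (∑ j, w j * ‖∑ a, φ a * y j a‖ₑ ^ 2) ^ p ∂Measure.pi γ ≤
      gaussMoment p * (∑ j, ∑ a, w j * c a * ‖y j a‖ₑ ^ 2) ^ p := by
  have := isGaussian_pi hγ
  have h := lintegral_sum_clm_pow (integral_dual_eq_zero hγ)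
    (fun j => linearForm (fun a => ((NNReal.sqrt (w j) : ℝ) : ℂ) * y j a)) hp
  simp_rw [linearForm_apply] at h
  rw [lintegral_finsetSum _ (fun j _ => by fun_prop),
    Finset.sum_congr rfl fun j _ => lintegral_linear_sq hγ _] at h
  simp_rw [mul_left_comm _ ((NNReal.sqrt _ : ℝ) : ℂ), ← Finset.mul_sum, ← coe_mul_enorm_sq] at h
  simpa only [mul_left_comm, mul_assoc, mul_comm] using h

/-- The functions `z ↦ z` and `z ↦ z̄`. -/
def IdOrConj (τ : ℂ → ℂ) : Prop := τ = id ∨ τ = conj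

theorem IdOrConj.continuous {τ : ℂ → ℂ} (hτ : IdOrConj τ) : Continuous τ := by
  rcases hτ with rfl | rfl
  · exact continuous_id
  · exact Complex.continuous_conj

theorem lintegral_semilinear_pow (hγ : ∀ i, IsCircularGaussian (γ i) (c i)) {τ : ℂ → ℂ}
    (hτ : IdOrConj τ) {κ : Type*} [Fintype κ] (w : κ → ℝ≥0) (y : κ → ι → ℂ) {p : ℕ} (hp : 1 ≤ p) :
    ∫⁻ φ, (∑ j, w j * ‖∑ a, τ (φ a) * y j a‖ₑ ^ 2) ^ p ∂Measure.pi γ ≤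
      gaussMoment p * (∑ j, ∑ a, w j * c a * ‖y j a‖ₑ ^ 2) ^ p := by
  rcases hτ with rfl | rfl
  · exact lintegral_linear_pow hγ w y hp
  have hcj : ∀ z : ℂ, ‖conj z‖ₑ = ‖z‖ₑ := fun z => by
    rw [← ofReal_norm, RCLike.norm_conj, ofReal_norm]
  have h := lintegral_linear_pow hγ w (fun j a => conj (y j a)) hp
  simp_rw [hcj] at h
  refine le_trans (le_of_eq (lintegral_congr fun φ => ?_)) h
  congr 1
  refine Finset.sum_congr rfl fun j _ => ?_
  rw [← hcj, map_sum]
  simp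

/-- Moments of decoupled quadratic forms. -/
theorem lintegral_bilinear_pow (hγ : ∀ i, IsCircularGaussian (γ i) (c i)) {τ : ℂ → ℂ}
    (hτ : IdOrConj τ) {κ : Type*} [Fintype κ] (w : κ → ℝ≥0) (y : κ → ι → ι → ℂ) {p : ℕ}
    (hp : 1 ≤ p) :
    ∫⁻ x, ∫⁻ φ, (∑ j, w j * ‖∑ a, ∑ b, x a * τ (φ b) * y j a b‖ₑ ^ 2) ^ p
        ∂Measure.pi γ ∂Measure.pi γ ≤
      gaussMoment p ^ 2 * (∑ j, ∑ a, ∑ b, w j * c a * c b * ‖y j a b‖ₑ ^ 2) ^ p := by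
  -- For frozen `x` the form is linear in `φ`; integrating it leaves a family of linear forms in `x`
  -- indexed by `(j, b)` with weights `w_j c_b`. Each integration costs one factor `gaussMoment p`.
  have h1 : ∀ x : ι → ℂ, ∫⁻ φ, (∑ j, w j * ‖∑ a, ∑ b, x a * τ (φ b) * y j a b‖ₑ ^ 2) ^ p
      ∂Measure.pi γ ≤ gaussMoment p *
        (∑ jb : κ × ι, (w jb.1 * c jb.2 : ℝ≥0) * ‖∑ a, x a * y jb.1 a jb.2‖ₑ ^ 2) ^ p := fun x => by
    refine le_trans (le_of_eq (lintegral_congr fun φ => ?_))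
      ((lintegral_semilinear_pow hγ hτ w (fun j b => ∑ a, x a * y j a b) hp).trans_eq ?_)
    · congr 1
      refine Finset.sum_congr rfl fun j _ => ?_
      congr 3
      rw [Finset.sum_comm]
      refine Finset.sum_congr rfl fun b _ => ?_
      rw [Finset.mul_sum]
      exact Finset.sum_congr rfl fun a _ => by ring
    · rw [Fintype.sum_prod_type]
      push_cast
      rfl
  refine (lintegral_mono h1).trans ?_
  rw [lintegral_const_mul' _ _ (gaussMoment_lt_top p).ne, sq, mul_assoc]
  gcongr
  refine (lintegral_linear_pow hγ (fun jb : κ × ι => w jb.1 * c jb.2)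
    (fun jb a => y jb.1 a jb.2) hp).trans_eq ?_
  rw [Fintype.sum_prod_type]
  congr 2
  refine Finset.sum_congr rfl fun j _ => ?_
  rw [Finset.sum_comm]
  refine Finset.sum_congr rfl fun a _ => Finset.sum_congr rfl fun b _ => ?_
  push_cast
  ring

/-- The finite family is viewed as one vector in a Euclidean space, with the square roots of the
weights absorbed into its coordinates, so that the averaging lemma applies to its norm. -/
theorem lintegral_pow_le_decoupled (hγ : ∀ i, IsCircularGaussian (γ i) (c i)) {κ : Type*}
    [Fintype κ] (w : κ → ℝ≥0) {f : κ → (ι → ℂ) → ℂ} {G : κ → (ι → ℂ) → (ι → ℂ) → ℂ}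
    (hG : ∀ j, Continuous fun x : (ι → ℂ) × (ι → ℂ) => G j x.1 x.2)
    (hI : ∀ j φ, Integrable (fun ψ => G j ((√2)⁻¹ • (φ + ψ)) ((√2)⁻¹ • (φ - ψ))) (Measure.pi γ))
    (r : ℝ)
    (hf : ∀ j φ, f j φ = r • ∫ ψ, G j ((√2)⁻¹ • (φ + ψ)) ((√2)⁻¹ • (φ - ψ)) ∂Measure.pi γ)
    {p : ℕ} (hp : 1 ≤ p) :
    ∫⁻ φ, (∑ j, w j * ‖f j φ‖ₑ ^ 2) ^ p ∂Measure.pi γ ≤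
      ‖r‖ₑ ^ (2 * p) *
        ∫⁻ x, ∫⁻ y, (∑ j, w j * ‖G j x y‖ₑ ^ 2) ^ p ∂Measure.pi γ ∂Measure.pi γ := by
  have := isGaussian_pi hγ
  let v : (κ → ℂ) → EuclideanSpace ℂ κ := fun z =>
    WithLp.toLp 2 fun j => ((NNReal.sqrt (w j) : ℝ) : ℂ) * z j
  have hv : ∀ z, ‖v z‖ₑ ^ (2 * p) = (∑ j, w j * ‖z j‖ₑ ^ 2) ^ p := fun z => by
    rw [pow_mul]
    congr 1
    rw [← ofReal_norm, ← ENNReal.ofReal_pow (norm_nonneg _), EuclideanSpace.norm_sq_eq,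
      ENNReal.ofReal_sum_of_nonneg fun j _ => sq_nonneg _]
    refine Finset.sum_congr rfl fun j _ => ?_
    rw [coe_mul_enorm_sq, ← ofReal_norm, ENNReal.ofReal_pow (norm_nonneg _)]
  have hvm : Continuous v := by fun_prop
  have h := lintegral_pow_le_of_average (P := Measure.pi γ) (integral_dual_eq_zero hγ)
    (f := fun φ => v fun j => f j φ) (G := fun x y => v fun j => G j x y)
    (by
      refine Continuous.measurable (Continuous.enorm (hvm.comp ?_))
      exact continuous_pi fun j => hG j) r (fun φ => ?_) (q := 2 * p) (by omega)
  · simpa only [hv] using h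
  · ext j
    change _ = r • ((∫ ψ, v fun j => G j ((√2)⁻¹ • (φ + ψ)) ((√2)⁻¹ • (φ - ψ)) ∂Measure.pi γ) j)
    rw [eval_integral_piLp (fun i => (hI i φ).const_mul _)]
    simp only [v, hf, integral_const_mul, Complex.real_smul]
    ring

/-- `f` is integrable with integral `v`. -/
def HasMean {Ω : Type*} [MeasurableSpace Ω] (μ : Measure Ω) (f : Ω → ℂ) (v : ℂ) : Prop :=
  Integrable f μ ∧ ∫ ω, f ω ∂μ = v

theorem HasMean.add {Ω : Type*} [MeasurableSpace Ω] {μ : Measure Ω} {f g : Ω → ℂ} {u v : ℂ}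
    (hf : HasMean μ f u) (hg : HasMean μ g v) : HasMean μ (fun ω => f ω + g ω) (u + v) :=
  ⟨hf.1.add hg.1, by rw [integral_add hf.1 hg.1, hf.2, hg.2]⟩

theorem HasMean.mul_const {Ω : Type*} [MeasurableSpace Ω] {μ : Measure Ω} {f : Ω → ℂ} {u : ℂ}
    (hf : HasMean μ f u) (z : ℂ) : HasMean μ (fun ω => f ω * z) (u * z) :=
  ⟨hf.1.mul_const z, by rw [integral_mul_const, hf.2]⟩

theorem HasMean.sum {Ω κ : Type*} [MeasurableSpace Ω] {μ : Measure Ω} (s : Finset κ)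
    {f : κ → Ω → ℂ} {u : κ → ℂ} (hf : ∀ i, HasMean μ (f i) (u i)) :
    HasMean μ (fun ω => ∑ i ∈ s, f i ω) (∑ i ∈ s, u i) :=
  ⟨integrable_finsetSum _ fun i _ => (hf i).1, by
    rw [integral_finsetSum _ fun i _ => (hf i).1]
    exact Finset.sum_congr rfl fun i _ => (hf i).2⟩

theorem HasMean.const {Ω : Type*} [MeasurableSpace Ω] {μ : Measure Ω} [IsProbabilityMeasure μ]
    (z : ℂ) : HasMean μ (fun _ => z) z := ⟨integrable_const z, by simp⟩

theorem HasMean.congr {Ω : Type*} [MeasurableSpace Ω] {μ : Measure Ω} {f g : Ω → ℂ} {u v : ℂ}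
    (hf : HasMean μ f u) (hfg : ∀ ω, g ω = f ω) (huv : v = u) : HasMean μ g v := by
  obtain rfl : g = f := funext hfg
  exact huv ▸ hf

theorem hasMean_eval (hγ : ∀ i, IsCircularGaussian (γ i) (c i)) (a : ι) :
    HasMean (Measure.pi γ) (fun φ => φ a) 0 := ⟨integrable_eval hγ a, integral_eval hγ a⟩

theorem hasMean_conj_eval (hγ : ∀ i, IsCircularGaussian (γ i) (c i)) (a : ι) :
    HasMean (Measure.pi γ) (fun φ => conj (φ a)) 0 :=
  ⟨(integrable_of_norm_le hγ (by fun_prop) 1 fun φ => by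
      simpa using norm_le_pi_norm φ a), by
    rw [integral_conj, integral_eval hγ, map_zero]⟩

/-- The Wick product of two modes, `φ_a τ(φ_b) - E[φ_a τ(φ_b)]`, where `τ` is the identity or the
conjugation. -/
def wickTwo (γ : ι → Measure ℂ) (τ : ℂ → ℂ) (φ : ι → ℂ) (a b : ι) : ℂ :=
  φ a * τ (φ b) - ∫ ψ, ψ a * τ (ψ b) ∂Measure.pi γ

/-- Moments of Wick-ordered quadratic forms. -/
theorem lintegral_wickTwo_pow (hγ : ∀ i, IsCircularGaussian (γ i) (c i)) {τ : ℂ → ℂ}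
    (hτ : IdOrConj τ) {κ : Type*} [Fintype κ] (w : κ → ℝ≥0) (y : κ → ι → ι → ℂ) {p : ℕ}
    (hp : 1 ≤ p) :
    ∫⁻ φ, (∑ j, w j * ‖∑ a, ∑ b, wickTwo γ τ φ a b * y j a b‖ₑ ^ 2) ^ p ∂Measure.pi γ ≤
      2 ^ (2 * p) * gaussMoment p ^ 2 *
        (∑ j, ∑ a, ∑ b, w j * c a * c b * ‖y j a b‖ₑ ^ 2) ^ p := by
  have hτc := hτ.continuous
  have hsq : ((√2)⁻¹ : ℝ) * (√2)⁻¹ = 2⁻¹ := by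
    rw [← mul_inv, Real.mul_self_sqrt zero_le_two]
  have hsq' : (((√2)⁻¹ : ℝ) : ℂ) * (((√2)⁻¹ : ℝ) : ℂ) = 2⁻¹ := by
    rw [← Complex.ofReal_mul, hsq]
    norm_num
  have hm : ∀ a b, HasMean (Measure.pi γ) (fun φ => φ a * τ (φ b))
      (∫ ψ, ψ a * τ (ψ b) ∂Measure.pi γ) := fun a b => by
    refine ⟨?_, rfl⟩
    rcases hτ with rfl | rfl
    · exact integrable_mul hγ a b
    · exact integrable_mul_conj hγ a b
  have hm' : ∀ b, HasMean (Measure.pi γ) (fun φ => τ (φ b)) 0 := fun b => by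
    rcases hτ with rfl | rfl
    · exact hasMean_eval hγ b
    · exact hasMean_conj_eval hγ b
  have hτ' : ∀ u v : ℂ, τ (((√2)⁻¹ : ℝ) * (u - v)) = ((√2)⁻¹ : ℝ) * (τ u - τ v) := fun u v => by
    rcases hτ with rfl | rfl
    · rfl
    · rw [_root_.map_mul, map_sub, Complex.conj_ofReal]
  -- Averaging `(φ_a + ψ_a) τ(φ_b - ψ_b) / 2` over `ψ` kills the terms linear in `ψ` and leaves half
  -- the Wick product. This is the origin of the factor `2` and of the constant `2 ^ (2 * p)`.
  have hmean : ∀ j φ, HasMean (Measure.pi γ) (fun ψ => ∑ a, ∑ b,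
      ((√2)⁻¹ • (φ + ψ)) a * τ (((√2)⁻¹ • (φ - ψ)) b) * y j a b)
      (∑ a, ∑ b, 2⁻¹ * wickTwo γ τ φ a b * y j a b) := fun j φ =>
    HasMean.sum _ fun a => HasMean.sum _ fun b => by
      have h := (((HasMean.const (μ := Measure.pi γ) (φ a * τ (φ b))).add
        ((hasMean_eval hγ a).mul_const (τ (φ b)))).add
        (((hm' b).mul_const (- φ a)).add ((hm a b).mul_const (-1)))).mul_const (2⁻¹ * y j a b)
      refine h.congr (fun ψ => ?_) ?_
      · simp only [Pi.smul_apply, Pi.add_apply, Pi.sub_apply, Complex.real_smul, hτ']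
        linear_combination (φ a + ψ a) * (τ (φ b) - τ (ψ b)) * y j a b * hsq'
      · rw [wickTwo]
        ring
  refine (lintegral_pow_le_decoupled hγ w
    (G := fun j x z => ∑ a, ∑ b, x a * τ (z b) * y j a b) (fun j => by fun_prop)
    (fun j φ => (hmean j φ).1) 2 (fun j φ => ?_) hp).trans ?_
  · rw [(hmean j φ).2, Complex.real_smul, Finset.mul_sum]
    refine Finset.sum_congr rfl fun a _ => ?_
    rw [Finset.mul_sum]
    refine Finset.sum_congr rfl fun b _ => ?_
    push_cast
    ring
  · rw [mul_assoc]
    gcongr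
    · rw [Real.enorm_eq_ofReal zero_le_two]
      simp
    · exact lintegral_bilinear_pow hγ hτ w y hp

/-- The Wick product `:φ_a φ_b φ̄_l:` of three modes with variances `c`. -/
def wickThree [DecidableEq ι] (c : ι → ℝ≥0) (φ : ι → ℂ) (a b l : ι) : ℂ :=
  φ a * φ b * conj (φ l) - (if a = l then ((c a : ℝ) : ℂ) else 0) * φ b
    - (if b = l then ((c b : ℝ) : ℂ) else 0) * φ a

/-- Moments of Wick-ordered cubic forms. -/
theorem lintegral_wickThree_pow [DecidableEq ι] (hγ : ∀ i, IsCircularGaussian (γ i) (c i))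
    {κ : Type*} [Fintype κ] (w : κ → ℝ≥0) (y : κ → ι → ι → ι → ℂ) {p : ℕ} (hp : 1 ≤ p) :
    ∫⁻ φ, (∑ j, w j * ‖∑ a, ∑ b, ∑ l, wickThree c φ a b l * y j a b l‖ₑ ^ 2) ^ p
        ∂Measure.pi γ ≤
      8 ^ p * 2 ^ (2 * p) * gaussMoment p ^ 3 *
        (∑ j, ∑ a, ∑ b, ∑ l, w j * c a * c b * c l * ‖y j a b l‖ₑ ^ 2) ^ p := by
  have hs2 : √2 * √2 = 2 := Real.mul_self_sqrt zero_le_two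
  have hs0 : √2 ≠ 0 := by positivity
  have hsq' : (((√2)⁻¹ : ℝ) : ℂ) * (((√2)⁻¹ : ℝ) : ℂ) = 2⁻¹ := by
    rw [← Complex.ofReal_mul, ← mul_inv, hs2]
    norm_num
  -- With `x = (φ + ψ)/√2` and `z = (φ - ψ)/√2`, the mean over `ψ` of `:x_a conj(x_l): z_b` is `:φ_a
  -- φ_b conj(φ_l): / (2√2)`. The contraction of `a` with `l` comes from the quadratic Wick product,
  -- that of `b` with `l` from the minus sign in `z`. The factor `2√2` produces `8 ^ p`.
  have hmean : ∀ j φ, HasMean (Measure.pi γ) (fun ψ => ∑ a, ∑ b, ∑ l,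
      wickTwo γ conj ((√2)⁻¹ • (φ + ψ)) a l * ((√2)⁻¹ • (φ - ψ)) b * y j a b l)
      (∑ a, ∑ b, ∑ l, (2⁻¹ * ((√2)⁻¹ : ℝ)) * wickThree c φ a b l * y j a b l) := fun j φ =>
    HasMean.sum _ fun a => HasMean.sum _ fun b => HasMean.sum _ fun l => by
      set δ : ι → ι → ℂ := fun a l => if a = l then ((c a : ℝ) : ℂ) else 0 with hδ
      have hm : ∀ a l, HasMean (Measure.pi γ) (fun φ => φ a * conj (φ l)) (δ a l) := fun a l =>
        ⟨integrable_mul_conj hγ a l, integral_mul_conj hγ a l⟩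
      have h2 : HasMean (Measure.pi γ) (fun φ => φ a * φ b) 0 :=
        ⟨integrable_mul hγ a b, integral_mul hγ a b⟩
      have h3 : HasMean (Measure.pi γ) (fun φ => φ a * φ b * conj (φ l)) 0 :=
        ⟨integrable_mul_mul_conj hγ a b l, integral_mul_mul_conj hγ a b l⟩
      have h := ((((HasMean.const (μ := Measure.pi γ)
          ((φ a * conj (φ l) - 2 * δ a l) * φ b)).add
        ((hasMean_eval hγ a).mul_const (conj (φ l) * φ b))).add
        (((hasMean_conj_eval hγ l).mul_const (φ a * φ b)).add
        ((hasMean_eval hγ b).mul_const (-(φ a * conj (φ l) - 2 * δ a l))))).add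
        ((((hm a l).mul_const (φ b)).add (h2.mul_const (-conj (φ l)))).add
        (((hm b l).mul_const (-φ a)).add (h3.mul_const (-1))))).mul_const
        (2⁻¹ * ((√2)⁻¹ : ℝ) * y j a b l)
      refine h.congr (fun ψ => ?_) ?_
      · simp only [wickTwo, integral_mul_conj hγ, Pi.smul_apply, Pi.add_apply, Pi.sub_apply,
          Complex.real_smul, _root_.map_mul, map_add, Complex.conj_ofReal]
        change ((((√2)⁻¹ : ℝ) : ℂ) * (φ a + ψ a) * ((((√2)⁻¹ : ℝ) : ℂ) *
          (conj (φ l) + conj (ψ l))) - δ a l) * ((((√2)⁻¹ : ℝ) : ℂ) * (φ b - ψ b)) * y j a b l = _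
        linear_combination (φ a + ψ a) * (conj (φ l) + conj (ψ l)) * (((√2)⁻¹ : ℝ) : ℂ) *
          (φ b - ψ b) * y j a b l * hsq'
      · rw [wickThree]
        change _ * (_ - δ a l * _ - δ b l * _) * _ = _
        ring
  refine (lintegral_pow_le_decoupled hγ w
    (G := fun j x z => ∑ a, ∑ b, ∑ l, wickTwo γ conj x a l * z b * y j a b l)
    (fun j => by
      simp only [wickTwo]
      fun_prop)
    (fun j φ => (hmean j φ).1) (2 * √2) (fun j φ => ?_) hp).trans ?_
  · rw [(hmean j φ).2, Complex.real_smul, Finset.mul_sum]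
    refine Finset.sum_congr rfl fun a _ => ?_
    rw [Finset.mul_sum]
    refine Finset.sum_congr rfl fun b _ => ?_
    rw [Finset.mul_sum]
    refine Finset.sum_congr rfl fun l _ => ?_
    have : (((2 * √2 : ℝ) : ℂ)) * (2⁻¹ * (((√2)⁻¹ : ℝ) : ℂ)) = 1 := by
      rw [Complex.ofReal_mul, Complex.ofReal_inv]
      have : ((√2 : ℝ) : ℂ) ≠ 0 := by exact_mod_cast hs0
      push_cast
      field_simp
    linear_combination -(wickThree c φ a b l * y j a b l) * this
  · have h8 : ‖(2 * √2 : ℝ)‖ₑ ^ (2 * p) = 8 ^ p := by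
      rw [pow_mul, Real.enorm_eq_ofReal (by positivity), ← ENNReal.ofReal_pow (by positivity)]
      have : (2 * √2) ^ 2 = 8 := by
        linear_combination 4 * hs2
      rw [this]
      simp
    rw [h8, mul_assoc, mul_assoc]
    gcongr
    -- For frozen `x` the form is linear in `z`; what remains are quadratic Wick forms in `x`
    -- indexed by `(j, b)`, to which the previous theorem applies.
    have h1 : ∀ x : ι → ℂ, ∫⁻ z, (∑ j, w j * ‖∑ a, ∑ b, ∑ l,
        wickTwo γ conj x a l * z b * y j a b l‖ₑ ^ 2) ^ p ∂Measure.pi γ ≤ gaussMoment p *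
        (∑ jb : κ × ι, (w jb.1 * c jb.2 : ℝ≥0) *
          ‖∑ a, ∑ l, wickTwo γ conj x a l * y jb.1 a jb.2 l‖ₑ ^ 2) ^ p := fun x => by
      refine le_trans (le_of_eq (lintegral_congr fun z => ?_))
        ((lintegral_linear_pow hγ w (fun j b => ∑ a, ∑ l,
          wickTwo γ conj x a l * y j a b l) hp).trans_eq ?_)
      · congr 1
        refine Finset.sum_congr rfl fun j _ => ?_
        congr 3
        rw [Finset.sum_comm]
        refine Finset.sum_congr rfl fun b _ => ?_
        rw [Finset.mul_sum]
        refine Finset.sum_congr rfl fun a _ => ?_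
        rw [Finset.mul_sum]
        exact Finset.sum_congr rfl fun l _ => by ring
      · rw [Fintype.sum_prod_type]
        push_cast
        rfl
    refine (lintegral_mono h1).trans ?_
    rw [lintegral_const_mul' _ _ (gaussMoment_lt_top p).ne, pow_succ' _ 2, mul_left_comm,
      mul_assoc]
    gcongr
    refine (lintegral_wickTwo_pow hγ (Or.inr rfl) (fun jb : κ × ι => w jb.1 * c jb.2)
      (fun jb a l => y jb.1 a jb.2 l) hp).trans_eq ?_
    have hsum : (∑ jb : κ × ι, ∑ a, ∑ l, ((w jb.1 * c jb.2 : ℝ≥0) : ℝ≥0∞) * c a * c l *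
        ‖y jb.1 a jb.2 l‖ₑ ^ 2) =
        ∑ j, ∑ a, ∑ b, ∑ l, (w j : ℝ≥0∞) * c a * c b * c l * ‖y j a b l‖ₑ ^ 2 := by
      rw [Fintype.sum_prod_type]
      refine Finset.sum_congr rfl fun j _ => ?_
      rw [Finset.sum_comm]
      refine Finset.sum_congr rfl fun a _ => Finset.sum_congr rfl fun b _ =>
        Finset.sum_congr rfl fun l _ => ?_
      push_cast
      ring
    rw [hsum]
    ring

end IsCircularGaussian

/-! ### The Gaussian measure on Fourier coefficients -/

/-- The variance `E|φ_k|² = 2/|k|²` of a Fourier mode under `μ_2`. -/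
def modeVar (k : Freq d) : ℝ≥0 := 2 / k.abs.toNNReal ^ 2

theorem coe_modeVar (k : Freq d) : (modeVar k : ℝ) = 2 / k.abs ^ 2 := by
  simp [modeVar, Real.coe_toNNReal _ k.abs_pos.le]

/-- Each mode is a pair of independent real Gaussian variables of variance `|k|^{-2}`. -/
theorem gaussMode_eq_map (k : Freq d) :
    gaussMode 2 k = ((gaussianReal 0 (modeVar k / 2)).prod (gaussianReal 0 (modeVar k / 2))).map
      Complex.equivRealProdCLM.symm := by
  have hk := k.abs_pos
  have hv : modeVar k / 2 ≠ 0 := by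
    have : (0 : ℝ) < modeVar k := by
      rw [coe_modeVar]
      positivity
    exact (div_pos (by exact_mod_cast this) two_pos).ne'
  refine Measure.ext_of_lintegral _ fun f hf => ?_
  rw [lintegral_map hf (by fun_prop), gaussianReal_of_var_ne_zero _ hv,
    prod_withDensity_left (by fun_prop), prod_withDensity_right (by fun_prop),
    lintegral_withDensity_eq_lintegral_mul _ (by fun_prop) (by fun_prop),
    lintegral_withDensity_eq_lintegral_mul _ (by fun_prop) (by fun_prop), gaussMode,
    lintegral_withDensity_eq_lintegral_mul _ (by fun_prop) hf]
  rw [← (Complex.volume_preserving_equiv_real_prod.symm).lintegral_comp_emb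
    Complex.measurableEquivRealProd.symm.measurableEmbedding]
  refine lintegral_congr fun x => ?_
  simp only [Pi.mul_apply]
  rw [← mul_assoc]
  congr 1
  rw [gaussianPDF, gaussianPDF, ← ENNReal.ofReal_mul (gaussianPDFReal_nonneg _ _ _)]
  have hvr : ((modeVar k / 2 : ℝ≥0) : ℝ) = (k.abs ^ 2)⁻¹ := by
    rw [NNReal.coe_div, coe_modeVar, NNReal.coe_ofNat]
    field_simp
  have hn : ‖Complex.measurableEquivRealProd.symm x‖ ^ 2 = x.1 ^ 2 + x.2 ^ 2 := by
    rw [Complex.sq_norm, Complex.normSq_apply, ← sq, ← sq]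
    rfl
  rw [gaussianPDFReal, gaussianPDFReal, hvr, hn, mul_mul_mul_comm, ← Real.exp_add, ← mul_inv,
    Real.mul_self_sqrt (by positivity), Real.rpow_ofNat]
  congr 2
  · field_simp
  · congr 1
    simp only [sub_zero]
    field_simp
    ring

/-- Gaussianity and the variance are read off from the two real coordinates; rotation invariance is
seen directly from the density, which depends on `‖z‖` only. -/
theorem isCircularGaussian_gaussMode (k : Freq d) :
    IsCircularGaussian (gaussMode 2 k) (modeVar k) where
  isGaussian := by
    rw [gaussMode_eq_map]
    infer_instance
  map_mul u hu := by
    let R : ℂ ≃ₗᵢ[ℝ] ℂ := rotation ⟨u, by simpa [Submonoid.unitSphere] using hu⟩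
    have hR : ∀ z, R z = u * z := fun z => rfl
    refine Measure.ext_of_lintegral _ fun f hf => ?_
    rw [lintegral_map hf (by fun_prop), gaussMode,
      lintegral_withDensity_eq_lintegral_mul _ (by fun_prop) hf,
      lintegral_withDensity_eq_lintegral_mul _ (by fun_prop) (by fun_prop)]
    conv_rhs =>
      rw [← R.measurePreserving.lintegral_comp_emb R.toHomeomorph.measurableEmbedding]
    refine lintegral_congr fun z => ?_
    simp [hR, hu]
  integral_sq := by
    have hn : ∀ x : ℝ × ℝ, ‖Complex.equivRealProdCLM.symm x‖ ^ 2 = x.1 ^ 2 + x.2 ^ 2 := fun x => by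
      rw [Complex.sq_norm, Complex.normSq_apply, ← sq, ← sq]
      rfl
    set g := gaussianReal 0 (modeVar k / 2) with hg
    have hsq : Integrable (fun x : ℝ => x ^ 2) g :=
      (memLp_id_gaussianReal (μ := 0) (v := modeVar k / 2) 2).integrable_sq
    have hval : ∫ x, x ^ 2 ∂g = modeVar k / 2 := by
      have h := variance_of_integral_eq_zero (μ := g) (X := fun x : ℝ => x) aemeasurable_id
        integral_id_gaussianReal
      rw [← h, variance_fun_id_gaussianReal]
      simp
    rw [gaussMode_eq_map, integral_map (by fun_prop) (by fun_prop)]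
    simp_rw [hn]
    rw [integral_add (hsq.comp_fst g) (hsq.comp_snd g), integral_fun_fst (fun x => x ^ 2),
      integral_fun_snd (fun x => x ^ 2), hval]
    simp

theorem lintegral_gaussMode_sq (k : Freq d) :
    ∫⁻ z, ‖z‖ₑ ^ 2 ∂gaussMode 2 k = modeVar k := by
  have hk := isCircularGaussian_gaussMode k
  have := hk.isGaussian
  have hI : Integrable (fun z : ℂ => ‖z‖ ^ 2) (gaussMode 2 k) :=
    (IsGaussian.memLp_id (gaussMode 2 k) 2 (by simp)).norm.integrable_sq
  rw [← ENNReal.ofReal_coe_nnreal, ← hk.integral_sq,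
    ofReal_integral_eq_lintegral_ofReal hI (ae_of_all _ fun z => by positivity)]
  refine lintegral_congr fun z => ?_
  rw [← ofReal_norm, ENNReal.ofReal_pow (norm_nonneg _)]

theorem lintegral_gaussSeq_sq (k : Freq d) :
    ∫⁻ φ, ‖φ k‖ₑ ^ 2 ∂gaussSeq d 2 = modeVar k := by
  rw [← lintegral_gaussMode_sq k, gaussSeq,
    ← (measurePreserving_eval_infinitePi (gaussMode 2) k).map_eq,
    lintegral_map (by fun_prop) (measurable_pi_apply k)]

instance : IsProbabilityMeasure (gaussSeq d 2) := by
  rw [gaussSeq]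
  infer_instance

/-! ### Frequency weights, Sobolev norms and the measure on `H^β`. -/

/-- The weight `|k|^s` as a nonnegative real. -/
def wt (s : ℝ) (k : Freq d) : ℝ≥0 := k.abs.toNNReal ^ s

theorem coe_wt (s : ℝ) (k : Freq d) : (wt s k : ℝ) = k.abs ^ s := by
  simp [wt, Real.coe_toNNReal _ k.abs_pos.le]

theorem wt_pos (s : ℝ) (k : Freq d) : 0 < wt s k := by
  have : (0 : ℝ) < wt s k := by
    rw [coe_wt]
    exact Real.rpow_pos_of_pos k.abs_pos s
  exact_mod_cast this

theorem wt_mul_wt (s t : ℝ) (k : Freq d) : wt s k * wt t k = wt (s + t) k := by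
  apply NNReal.coe_injective
  rw [NNReal.coe_mul, coe_wt, coe_wt, coe_wt, Real.rpow_add k.abs_pos]

theorem wt_mono {s t : ℝ} (h : s ≤ t) (k : Freq d) : wt s k ≤ wt t k := by
  rw [← NNReal.coe_le_coe, coe_wt, coe_wt]
  exact Real.rpow_le_rpow_of_exponent_le k.one_le_abs h

theorem wt_zero (k : Freq d) : wt 0 k = 1 := by
  apply NNReal.coe_injective
  simp [coe_wt]

theorem modeVar_eq (k : Freq d) : modeVar k = 2 * wt (-2) k := by
  apply NNReal.coe_injective
  rw [NNReal.coe_mul, coe_modeVar, coe_wt, NNReal.coe_ofNat, Real.rpow_neg k.abs_pos.le,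
    Real.rpow_ofNat, div_eq_mul_inv]

/-- The square of the `H^s` norm, possibly infinite. -/
def sobSq (s : ℝ) (φ : Freq d → ℂ) : ℝ≥0∞ := ∑' k, wt (2 * s) k * ‖φ k‖ₑ ^ 2

theorem ofReal_weight_sq (s : ℝ) (k : Freq d) (z : ℂ) :
    ENNReal.ofReal (k.abs ^ (2 * s) * ‖z‖ ^ 2) = wt (2 * s) k * ‖z‖ₑ ^ 2 := by
  rw [← coe_wt, ENNReal.ofReal_mul (wt _ k).coe_nonneg, ENNReal.ofReal_coe_nnreal,
    ENNReal.ofReal_pow (norm_nonneg _), ofReal_norm]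

theorem memSob_iff_sobSq (s : ℝ) (φ : Freq d → ℂ) : MemSob s φ ↔ sobSq s φ < ∞ := by
  have h0 : ∀ k : Freq d, 0 ≤ k.abs ^ (2 * s) * ‖φ k‖ ^ 2 := fun k =>
    mul_nonneg (Real.rpow_nonneg k.abs_pos.le _) (sq_nonneg _)
  have h : sobSq s φ = ∑' k, ENNReal.ofReal (k.abs ^ (2 * s) * ‖φ k‖ ^ 2) :=
    tsum_congr fun k => (ofReal_weight_sq s k _).symm
  rw [h]
  refine ⟨fun hs => ?_, fun hs => ?_⟩
  · rw [← ENNReal.ofReal_tsum_of_nonneg h0 hs]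
    exact ENNReal.ofReal_lt_top
  · have := ENNReal.summable_toReal hs.ne
    simp only [ENNReal.toReal_ofReal (h0 _)] at this
    exact this

theorem enorm_sq_eq_sobSq {s : ℝ} (φ : Sob d s) : ‖φ‖ₑ ^ 2 = sobSq s φ.coeff := by
  have h0 : ∀ k : Freq d, 0 ≤ k.abs ^ (2 * s) * ‖φ.coeff k‖ ^ 2 := fun k =>
    mul_nonneg (Real.rpow_nonneg k.abs_pos.le _) (sq_nonneg _)
  rw [← ofReal_norm, ← ENNReal.ofReal_pow (norm_nonneg _), Sob.norm_sq,
    ENNReal.ofReal_tsum_of_nonneg h0 φ.memSob]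
  exact tsum_congr fun k => ofReal_weight_sq s k _

theorem measurable_sobSq (s : ℝ) : Measurable (sobSq (d := d) s) :=
  Measurable.tsum fun k => by fun_prop

theorem measurable_coeff {s : ℝ} : Measurable (Sob.coeff : Sob d s → Freq d → ℂ) :=
  measurable_subtype_coe

/-- `H^s` is cut out by finiteness of a measurable function, hence is a measurable subset of the
space of all families; this makes the `comap` defining `gauss` well behaved. -/
theorem measurableEmbedding_coeff {s : ℝ} :
    MeasurableEmbedding (Sob.coeff : Sob d s → Freq d → ℂ) := by
  refine MeasurableEmbedding.subtype_coe ?_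
  have : (↑(sobSubmodule d s) : Set (Freq d → ℂ)) = {φ | sobSq s φ < ∞} := by
    ext φ
    exact memSob_iff_sobSq s φ
  change MeasurableSet (↑(sobSubmodule d s) : Set (Freq d → ℂ))
  rw [this]
  exact measurableSet_lt (measurable_sobSq s) measurable_const

theorem lintegral_sobSq (s : ℝ) :
    ∫⁻ φ, sobSq s φ ∂gaussSeq d 2 = 2 * ∑' k : Freq d, (wt (2 * s - 2) k : ℝ≥0∞) := by
  unfold sobSq
  rw [lintegral_tsum fun k => Measurable.aemeasurable (by fun_prop), ← ENNReal.tsum_mul_left]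
  refine tsum_congr fun k => ?_
  rw [lintegral_const_mul _ (by fun_prop), lintegral_gaussSeq_sq, modeVar_eq, sub_eq_add_neg,
    ← wt_mul_wt]
  push_cast
  ring

theorem ae_sobSq_lt_top {s : ℝ} (h : ∑' k : Freq d, (wt (2 * s - 2) k : ℝ≥0∞) < ∞) :
    ∀ᵐ φ ∂gaussSeq d 2, sobSq s φ < ∞ := by
  refine ae_lt_top (measurable_sobSq s) ?_
  rw [lintegral_sobSq]
  exact (ENNReal.mul_lt_top (by simp) h).ne

/-- The expected squared `H^β` norm is finite, so the product measure is carried by `H^β`. All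
integrals over `H^β` are then computed on the product space. -/
theorem measurePreserving_coeff {β : ℝ}
    (h : ∑' k : Freq d, (wt (2 * β - 2) k : ℝ≥0∞) < ∞) :
    MeasurePreserving (Sob.coeff : Sob d β → Freq d → ℂ) (gauss d 2 β) (gaussSeq d 2) := by
  refine ⟨measurable_coeff, ?_⟩
  rw [gauss, measurableEmbedding_coeff.map_comap, Measure.restrict_eq_self_of_ae_mem]
  filter_upwards [ae_sobSq_lt_top h] with φ hφ
  exact ⟨Sob.mk φ ((memSob_iff_sobSq β φ).2 hφ), rfl⟩

/-! ### Summability of powers of frequencies -/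

theorem tsum_wt_lt_top_of_dim_one {s : ℝ} (hs : s < -1) :
    ∑' k : Freq 1, (wt s k : ℝ≥0∞) < ∞ := by
  have hinj : Function.Injective fun k : Freq 1 => k.1 0 := fun k l h => by
    ext i
    fin_cases i
    exact h
  have h := (Real.summable_abs_int_rpow (b := -s) (by linarith)).comp_injective hinj
  rw [lt_top_iff_ne_top, ENNReal.tsum_coe_ne_top_iff_summable, ← NNReal.summable_coe]
  refine h.congr fun k => ?_
  rw [coe_wt]
  simp [Freq.abs, Real.sqrt_sq_eq_abs]

theorem tsum_wt_lt_top_of_dim_two {s : ℝ} (hs : s < -2) :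
    ∑' k : Freq 2, (wt s k : ℝ≥0∞) < ∞ := by
  have h := (EisensteinSeries.summable_one_div_norm_rpow (k := -s) (by linarith)).subtype
    (fun k : Fin 2 → ℤ => k ≠ 0)
  rw [lt_top_iff_ne_top, ENNReal.tsum_coe_ne_top_iff_summable, ← NNReal.summable_coe]
  refine Summable.of_nonneg_of_le (fun k => (wt s k).coe_nonneg) (fun k : Freq 2 => ?_) h
  rw [coe_wt]
  simp only [Function.comp, neg_neg]
  -- The series from `EisensteinSeries` uses the sup norm, which is at most the Euclidean length;
  -- the exponent is negative.
  refine Real.rpow_le_rpow_of_nonpos (norm_pos_iff.2 k.2) ?_ (by linarith)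
  refine (pi_norm_le_iff_of_nonneg k.abs_pos.le).2 fun i => ?_
  rw [Int.norm_eq_abs]
  exact Real.abs_le_sqrt (Finset.single_le_sum (f := fun j => ((k.1 j : ℤ) : ℝ) ^ 2)
    (fun j _ => sq_nonneg _) (Finset.mem_univ i))

/-! ### The trilinear form behind the cubic nonlinearity -/

/-- The term `u_{k-m} v_{l+m} conj(w_l)` for the pair `x = (l, m)`. -/
def triTerm (u v w : Freq d → ℂ) (k : Freq d) (x : (Fin d → ℤ) × (Fin d → ℤ)) : ℂ :=
  ext0 u (k.1 - x.2) * ext0 v (x.1 + x.2) * conj (ext0 w x.1)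

/-- The trilinear form with `cubic φ = tri φ φ φ`. -/
def tri (u v w : Freq d → ℂ) (k : Freq d) : ℂ := ∑' x, triTerm u v w k x

/-- The sum of the absolute values of the terms of `tri`. -/
def triAbs (u v w : Freq d → ℂ) (k : Freq d) : ℝ≥0∞ := ∑' x, ‖triTerm u v w k x‖ₑ

theorem cubic_eq (φ : Freq d → ℂ) : cubic φ = tri φ φ φ := rfl

/-- The resonance relation `a + b - l = k`. -/
def Res (a b l k : Freq d) : Prop := a.1 + b.1 - l.1 = k.1

instance (a b l k : Freq d) : Decidable (Res a b l k) :=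
  inferInstanceAs (Decidable (a.1 + b.1 - l.1 = k.1))

theorem Res.swap {a b l k : Freq d} : Res a b l k ↔ Res b a l k := by
  rw [Res, Res, add_comm]

theorem Res.first_eq {a a' b l k : Freq d} (h : Res a b l k) (h' : Res a' b l k) : a = a' := by
  apply Subtype.ext
  have : a.1 + b.1 - l.1 = a'.1 + b.1 - l.1 := h.trans h'.symm
  simpa using this

theorem Res.third_eq {a b l l' k : Freq d} (h : Res a b l k) (h' : Res a b l' k) : l = l' := by
  apply Subtype.ext
  have : a.1 + b.1 - l.1 = a.1 + b.1 - l'.1 := h.trans h'.symm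
  simpa using this

theorem ext0_coe (φ : Freq d → ℂ) (k : Freq d) : ext0 φ k.1 = φ k := dif_pos k.2

theorem ext0_zero (φ : Freq d → ℂ) : ext0 φ 0 = 0 := dif_neg (by simp)

/-- Sums over pairs `(l, m)` as sums over the triples `(a, b, l)` with `a + b - l = k`. -/
theorem tsum_pairs_eq {M : Type*} [AddCommMonoid M] [TopologicalSpace M] [T2Space M] (k : Freq d)
    (f : (Fin d → ℤ) × (Fin d → ℤ) → M)
    (hf : ∀ x, k.1 - x.2 = 0 ∨ x.1 + x.2 = 0 ∨ x.1 = 0 → f x = 0) :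
    ∑' x, f x = ∑' y : Freq d × Freq d × Freq d,
      if Res y.1 y.2.1 y.2.2 k then f (y.2.2.1, y.2.1.1 - y.2.2.1) else 0 := by
  -- The inverse of the substitution `a = k - m`, `b = l + m`. The pairs it misses have a zero mode
  -- among their entries, where `f` vanishes.
  let g : {y : Freq d × Freq d × Freq d // Res y.1 y.2.1 y.2.2 k} →
      (Fin d → ℤ) × (Fin d → ℤ) := fun y => (y.1.2.2.1, y.1.2.1.1 - y.1.2.2.1)
  have hg : Function.Injective g := by
    rintro ⟨⟨a, b, l⟩, h⟩ ⟨⟨a', b', l'⟩, h'⟩ hgg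
    simp only [g, Prod.mk.injEq] at hgg
    obtain ⟨h1, h2⟩ := hgg
    obtain rfl : l = l' := Subtype.ext h1
    obtain rfl : b = b' := Subtype.ext (by simpa using h2)
    obtain rfl : a = a' := h.first_eq h'
    rfl
  have hs : Function.support f ⊆ Set.range g := by
    intro x hx
    have hx' : ¬ (k.1 - x.2 = 0 ∨ x.1 + x.2 = 0 ∨ x.1 = 0) := fun h => hx (hf x h)
    push Not at hx'
    refine ⟨⟨(⟨_, hx'.1⟩, ⟨_, hx'.2.1⟩, ⟨_, hx'.2.2⟩), ?_⟩, ?_⟩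
    · change k.1 - x.2 + (x.1 + x.2) - x.1 = k.1
      abel
    · ext <;> simp [g]
  rw [← hg.tsum_eq hs]
  refine (tsum_subtype {y : Freq d × Freq d × Freq d | Res y.1 y.2.1 y.2.2 k}
    fun y => f (y.2.2.1, y.2.1.1 - y.2.2.1)).trans (tsum_congr fun y => ?_)
  simp [Set.indicator_apply]

theorem triTerm_eq_zero (u v w : Freq d → ℂ) (k : Freq d) (x : (Fin d → ℤ) × (Fin d → ℤ))
    (h : k.1 - x.2 = 0 ∨ x.1 + x.2 = 0 ∨ x.1 = 0) : triTerm u v w k x = 0 := by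
  rcases h with h | h | h <;> simp [triTerm, h, ext0_zero]

theorem triTerm_of_res (u v w : Freq d → ℂ) {a b l k : Freq d} (h : Res a b l k) :
    triTerm u v w k (l.1, b.1 - l.1) = u a * v b * conj (w l) := by
  have h1 : k.1 - (b.1 - l.1) = a.1 := by
    rw [← h]
    abel
  simp only [triTerm, h1, add_sub_cancel, ext0_coe]

theorem tri_eq_tsum (u v w : Freq d → ℂ) (k : Freq d) :
    tri u v w k = ∑' y : Freq d × Freq d × Freq d,
      if Res y.1 y.2.1 y.2.2 k then u y.1 * v y.2.1 * conj (w y.2.2) else 0 := by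
  rw [tri, tsum_pairs_eq k _ (triTerm_eq_zero u v w k)]
  refine tsum_congr fun y => ?_
  split_ifs with h
  · exact triTerm_of_res u v w h
  · rfl

theorem enorm_conj (z : ℂ) : ‖conj z‖ₑ = ‖z‖ₑ := by
  rw [← ofReal_norm, RCLike.norm_conj, ofReal_norm]

theorem triAbs_eq_tsum (u v w : Freq d → ℂ) (k : Freq d) :
    triAbs u v w k = ∑' (a : Freq d) (b : Freq d) (l : Freq d),
      if Res a b l k then ‖u a‖ₑ * ‖v b‖ₑ * ‖w l‖ₑ else 0 := by
  rw [triAbs, tsum_pairs_eq k _ fun x hx => by rw [triTerm_eq_zero u v w k x hx, enorm_zero],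
    ENNReal.tsum_prod']
  refine tsum_congr fun a => ?_
  rw [ENNReal.tsum_prod']
  refine tsum_congr fun b => tsum_congr fun l => ?_
  simp only
  split_ifs with h
  · rw [triTerm_of_res u v w h, enorm_mul, enorm_mul, enorm_conj]
  · rfl

theorem triAbs_swap (u v w : Freq d → ℂ) (k : Freq d) : triAbs u v w k = triAbs v u w k := by
  rw [triAbs_eq_tsum, triAbs_eq_tsum, ENNReal.tsum_comm]
  refine tsum_congr fun b => tsum_congr fun a => tsum_congr fun l => ?_
  simp only [Res.swap (a := a), mul_comm ‖u a‖ₑ]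

/-- The form `tri` converges absolutely at `(u, v, w)`, even after taking absolute values, with
values in `H^β`. -/
def TriOK (β : ℝ) (u v w : Freq d → ℂ) : Prop :=
  ∑' k, (wt (2 * β) k : ℝ≥0∞) * triAbs u v w k ^ 2 < ∞

theorem TriOK.swap {β : ℝ} {u v w : Freq d → ℂ} (h : TriOK β u v w) : TriOK β v u w := by
  simpa only [TriOK, triAbs_swap v u w] using h

theorem TriOK.triAbs_lt_top {β : ℝ} {u v w : Freq d → ℂ} (h : TriOK β u v w) (k : Freq d) :
    triAbs u v w k < ∞ := by
  have h1 := (ENNReal.le_tsum k).trans_lt h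
  by_contra hc
  have h2 : triAbs u v w k = ∞ := by simpa using hc
  rw [h2] at h1
  simp [ENNReal.mul_top, (wt_pos (2 * β) k).ne'] at h1

theorem summable_triTerm_of_lt_top {u v w : Freq d → ℂ} {k : Freq d} (h : triAbs u v w k < ∞) :
    Summable (triTerm u v w k) := by
  refine Summable.of_norm ?_
  have := ENNReal.summable_toReal h.ne
  simpa using this

theorem TriOK.summable {β : ℝ} {u v w : Freq d → ℂ} (h : TriOK β u v w) (k : Freq d) :
    Summable (triTerm u v w k) := summable_triTerm_of_lt_top (h.triAbs_lt_top k)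

theorem enorm_tri_le (u v w : Freq d → ℂ) (k : Freq d) : ‖tri u v w k‖ₑ ≤ triAbs u v w k :=
  enorm_tsum_le_tsum_enorm

theorem sobSq_tri_le (β : ℝ) (u v w : Freq d → ℂ) :
    sobSq β (tri u v w) ≤ ∑' k, (wt (2 * β) k : ℝ≥0∞) * triAbs u v w k ^ 2 :=
  ENNReal.tsum_le_tsum fun k => by
    gcongr
    exact enorm_tri_le u v w k

theorem TriOK.memSob {β : ℝ} {u v w : Freq d → ℂ} (h : TriOK β u v w) : MemSob β (tri u v w) :=
  (memSob_iff_sobSq β _).2 ((sobSq_tri_le β u v w).trans_lt h)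

theorem TriOK.cubicDefined {β : ℝ} {φ : Freq d → ℂ} (h : TriOK β φ φ φ) : CubicDefined β φ :=
  ⟨h.summable, h.memSob⟩

theorem ext0_add (u v : Freq d → ℂ) (n : Fin d → ℤ) : ext0 (u + v) n = ext0 u n + ext0 v n := by
  by_cases h : n = 0 <;> simp [ext0, h]

theorem ext0_smul (c : ℝ) (u : Freq d → ℂ) (n : Fin d → ℤ) : ext0 (c • u) n = c * ext0 u n := by
  by_cases h : n = 0 <;> simp [ext0, h]

/-- All eight entries of `tri` built from `φ` and `v` converge absolutely. -/
def TriSummable (φ v : Freq d → ℂ) : Prop :=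
  ∀ k, Summable (triTerm φ φ φ k) ∧ Summable (triTerm v φ φ k) ∧ Summable (triTerm φ v φ k) ∧
    Summable (triTerm φ φ v k) ∧ Summable (triTerm φ v v k) ∧ Summable (triTerm v φ v k) ∧
    Summable (triTerm v v φ k) ∧ Summable (triTerm v v v k)

/-- The derivative of the cubic nonlinearity. -/
def triOne (φ v : Freq d → ℂ) : Freq d → ℂ := tri v φ φ + tri φ v φ + tri φ φ v

/-- The second-order part of the cubic nonlinearity. -/
def triTwo (φ v : Freq d → ℂ) : Freq d → ℂ := tri φ v v + tri v φ v + tri v v φ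

/-- The conjugated entry makes the form only real-linear in that slot, so `ε` is real. Summability
of the eight series allows the expansion to be summed term by term. -/
theorem tri_expand {φ v : Freq d → ℂ} (h : TriSummable φ v) (ε : ℝ) :
    tri (φ + ε • v) (φ + ε • v) (φ + ε • v) =
      tri φ φ φ + ε • triOne φ v + ε ^ 2 • triTwo φ v + ε ^ 3 • tri v v v := by
  ext k
  obtain ⟨h0, h1, h2, h3, h4, h5, h6, h7⟩ := h k
  have hterm : ∀ x, triTerm (φ + ε • v) (φ + ε • v) (φ + ε • v) k x = triTerm φ φ φ k x +
      ε * (triTerm v φ φ k x + triTerm φ v φ k x + triTerm φ φ v k x) +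
      ε ^ 2 * (triTerm φ v v k x + triTerm v φ v k x + triTerm v v φ k x) +
      ε ^ 3 * triTerm v v v k x := fun x => by
    simp only [triTerm, ext0_add, ext0_smul, map_add, map_mul, Complex.conj_ofReal]
    ring
  have hs := ((h0.hasSum.add (((h1.hasSum.add h2.hasSum).add h3.hasSum).mul_left (ε : ℂ))).add
    (((h4.hasSum.add h5.hasSum).add h6.hasSum).mul_left ((ε : ℂ) ^ 2))).add
    (h7.hasSum.mul_left ((ε : ℂ) ^ 3))
  rw [tri, tsum_congr hterm, hs.tsum_eq]
  simp [tri, triOne, triTwo]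
  ring

theorem triOne_add {φ v w : Freq d → ℂ} (h : TriSummable φ v) (h' : TriSummable φ w) :
    triOne φ (v + w) = triOne φ v + triOne φ w := by
  ext k
  obtain ⟨-, h1, h2, h3, -⟩ := h k
  obtain ⟨-, h1', h2', h3', -⟩ := h' k
  have e1 : tri (v + w) φ φ k = tri v φ φ k + tri w φ φ k := by
    rw [tri, tri, tri, ← h1.tsum_add h1']
    refine tsum_congr fun x => ?_
    simp only [triTerm, ext0_add]
    ring
  have e2 : tri φ (v + w) φ k = tri φ v φ k + tri φ w φ k := by
    rw [tri, tri, tri, ← h2.tsum_add h2']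
    refine tsum_congr fun x => ?_
    simp only [triTerm, ext0_add]
    ring
  have e3 : tri φ φ (v + w) k = tri φ φ v k + tri φ φ w k := by
    rw [tri, tri, tri, ← h3.tsum_add h3']
    refine tsum_congr fun x => ?_
    simp only [triTerm, ext0_add, map_add]
    ring
  simp only [triOne, Pi.add_apply, e1, e2, e3]
  ring

theorem triOne_smul (φ v : Freq d → ℂ) (c : ℝ) : triOne φ (c • v) = c • triOne φ v := by
  ext k
  have e1 : tri (c • v) φ φ k = c * tri v φ φ k := by
    rw [tri, tri, ← tsum_mul_left]
    refine tsum_congr fun x => ?_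
    simp only [triTerm, ext0_smul]
    ring
  have e2 : tri φ (c • v) φ k = c * tri φ v φ k := by
    rw [tri, tri, ← tsum_mul_left]
    refine tsum_congr fun x => ?_
    simp only [triTerm, ext0_smul]
    ring
  have e3 : tri φ φ (c • v) k = c * tri φ φ v k := by
    rw [tri, tri, ← tsum_mul_left]
    refine tsum_congr fun x => ?_
    simp only [triTerm, ext0_smul, map_mul, Complex.conj_ofReal]
    ring
  simp only [triOne, Pi.add_apply, Pi.smul_apply, e1, e2, e3, Complex.real_smul]
  ring

/-- A map with a cubic Taylor expansion along every direction of `H^1` has a gradient. -/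
theorem isGradientAt_of_expansion {β : ℝ} (h : β ≤ 1) {F : Sob d β → Sob d β} {φ : Sob d β}
    {T : Sob d 1 →L[ℝ] Sob d β}
    (hF : ∀ v : Sob d 1, ∃ X Y : Sob d β, ∀ ε : ℝ, F (φ + ε • Sob.incl h v) =
      F φ + ε • T v + ε ^ 2 • X + ε ^ 3 • Y) : IsGradientAt h F φ T := by
  intro v
  obtain ⟨X, Y, hXY⟩ := hF v
  have h1 : Tendsto (fun ε : ℝ => T v + ε • X + ε ^ 2 • Y) (𝓝[≠] 0) (𝓝 (T v)) := by
    have : Continuous fun ε : ℝ => T v + ε • X + ε ^ 2 • Y := by fun_prop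
    have h2 := (this.tendsto 0).mono_left (nhdsWithin_le_nhds (s := {0}ᶜ))
    simpa using h2
  refine h1.congr' ?_
  filter_upwards [self_mem_nhdsWithin] with ε hε
  have hne : ε ≠ 0 := hε
  rw [hXY ε]
  have : F φ + ε • T v + ε ^ 2 • X + ε ^ 3 • Y - F φ = ε • (T v + ε • X + ε ^ 2 • Y) := by
    module
  rw [this, inv_smul_smul₀ hne]

/-! ### Bounds for the trilinear form -/

/-- The Cauchy–Schwarz inequality for sums of nonnegative terms. -/
theorem tsum_sq_le {α : Type*} {f g h : α → ℝ≥0∞} (hf : ∀ x, f x ^ 2 ≤ g x * h x) :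
    (∑' x, f x) ^ 2 ≤ (∑' x, g x) * ∑' x, h x := by
  let _ : MeasurableSpace α := ⊤
  have hsq : ∀ x : ℝ≥0∞, (x ^ (1 / 2 : ℝ)) ^ 2 = x := fun x => by
    rw [← ENNReal.rpow_natCast, ← ENNReal.rpow_mul]
    norm_num
  have hsq' : ∀ x : ℝ≥0∞, (x ^ (1 / 2 : ℝ)) ^ (2 : ℝ) = x := fun x => by
    rw [← ENNReal.rpow_mul]
    norm_num
  have h1 := ENNReal.lintegral_mul_le_Lp_mul_Lq (Measure.count : Measure α)
    (f := fun x => g x ^ (1 / 2 : ℝ)) (g := fun x => h x ^ (1 / 2 : ℝ))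
    Real.HolderConjugate.two_two (measurable_from_top).aemeasurable
    (measurable_from_top).aemeasurable
  simp only [Pi.mul_apply, lintegral_count, hsq'] at h1
  have h2 : ∑' x, f x ≤ ∑' x, g x ^ (1 / 2 : ℝ) * h x ^ (1 / 2 : ℝ) := by
    refine ENNReal.tsum_le_tsum fun x => ?_
    rw [← ENNReal.mul_rpow_of_nonneg _ _ (by norm_num)]
    have h3 := ENNReal.rpow_le_rpow (hf x) (by norm_num : (0 : ℝ) ≤ 1 / 2)
    rwa [← ENNReal.rpow_natCast, ← ENNReal.rpow_mul, Nat.cast_ofNat, mul_one_div_cancel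
      two_ne_zero, ENNReal.rpow_one] at h3
  have h4 := pow_le_pow_left' (h2.trans h1) 2
  rwa [mul_pow, hsq, hsq] at h4

theorem tsum_sq_le_triple {α : Type*} {f g h : α → α → α → ℝ≥0∞}
    (hf : ∀ a b l, f a b l ^ 2 ≤ g a b l * h a b l) :
    (∑' (a) (b) (l), f a b l) ^ 2 ≤ (∑' (a) (b) (l), g a b l) * ∑' (a) (b) (l), h a b l := by
  have hp : ∀ F : α → α → α → ℝ≥0∞, ∑' (a) (b) (l), F a b l =
      ∑' y : α × α × α, F y.1 y.2.1 y.2.2 := fun F => by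
    rw [ENNReal.tsum_prod']
    refine tsum_congr fun a => ?_
    rw [ENNReal.tsum_prod']
  rw [hp, hp, hp]
  exact tsum_sq_le fun y => hf _ _ _

theorem tsum_ite_le_of_unique {α : Type*} {p : α → Prop} [DecidablePred p]
    (h : ∀ x y, p x → p y → x = y) (X : ℝ≥0∞) : (∑' x, if p x then X else 0) ≤ X := by
  by_cases hp : ∃ x, p x
  · obtain ⟨x, hx⟩ := hp
    rw [tsum_eq_single x fun y hy => if_neg fun hy' => hy (h y x hy' hx), if_pos hx]
  · push Not at hp
    simp [hp]

/-- The sum of `e(k) f(a) g(b) h(l)` over all `a + b - l = k`. -/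
def qsum (e f g h : Freq d → ℝ≥0∞) : ℝ≥0∞ :=
  ∑' (k) (a) (b) (l), if Res a b l k then e k * f a * g b * h l else 0

theorem qsum_mono {e f g h e' f' g' h' : Freq d → ℝ≥0∞} (he : ∀ k, e k ≤ e' k)
    (hf : ∀ k, f k ≤ f' k) (hg : ∀ k, g k ≤ g' k) (hh : ∀ k, h k ≤ h' k) :
    qsum e f g h ≤ qsum e' f' g' h' := by
  refine ENNReal.tsum_le_tsum fun k => ENNReal.tsum_le_tsum fun a => ENNReal.tsum_le_tsum fun b =>
    ENNReal.tsum_le_tsum fun l => ?_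
  split_ifs
  · gcongr
    exacts [he k, hf a, hg b, hh l]
  · exact le_rfl

/-- Once `k` and two of the three frequencies are fixed, the resonance leaves at most one value for
the third, so the sum over it costs nothing. The three companions below free the other positions in
the same way. -/
theorem tsum_res_first_le (k : Freq d) (X : Freq d → Freq d → ℝ≥0∞) :
    (∑' (a : Freq d) (b) (l), if Res a b l k then X b l else 0) ≤ ∑' (b) (l), X b l := by
  rw [ENNReal.tsum_comm]
  refine ENNReal.tsum_le_tsum fun b => ?_
  rw [ENNReal.tsum_comm]
  exact ENNReal.tsum_le_tsum fun l =>
    tsum_ite_le_of_unique (fun _ _ h h' => Res.first_eq h h') _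

theorem tsum_res_second_le (k : Freq d) (X : Freq d → Freq d → ℝ≥0∞) :
    (∑' (a) (b : Freq d) (l), if Res a b l k then X a l else 0) ≤ ∑' (a) (l), X a l := by
  refine ENNReal.tsum_le_tsum fun a => ?_
  rw [ENNReal.tsum_comm]
  exact ENNReal.tsum_le_tsum fun l => tsum_ite_le_of_unique
    (fun _ _ h h' => Res.first_eq (Res.swap.1 h) (Res.swap.1 h')) _

theorem tsum_res_third_le (k : Freq d) (X : Freq d → Freq d → ℝ≥0∞) :
    (∑' (a) (b) (l : Freq d), if Res a b l k then X a b else 0) ≤ ∑' (a) (b), X a b :=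
  ENNReal.tsum_le_tsum fun _ => ENNReal.tsum_le_tsum fun _ => tsum_ite_le_of_unique
    (fun _ _ h h' => Res.third_eq h h') _

theorem tsum_res_output_le (X : Freq d → Freq d → Freq d → ℝ≥0∞) :
    (∑' (k : Freq d) (a) (b) (l), if Res a b l k then X a b l else 0) ≤
      ∑' (a) (b) (l), X a b l := by
  rw [ENNReal.tsum_comm]
  refine ENNReal.tsum_le_tsum fun a => ?_
  rw [ENNReal.tsum_comm]
  refine ENNReal.tsum_le_tsum fun b => ?_
  rw [ENNReal.tsum_comm]
  exact ENNReal.tsum_le_tsum fun l => tsum_ite_le_of_unique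
    (fun _ _ h h' => Subtype.ext (h.symm.trans h')) _

theorem tsum_tsum_mul (f g : Freq d → ℝ≥0∞) :
    ∑' (a) (b), f a * g b = (∑' a, f a) * ∑' b, g b := by
  simp_rw [ENNReal.tsum_mul_left, ENNReal.tsum_mul_right]

theorem tsum_tsum_tsum_mul (f g h : Freq d → ℝ≥0∞) :
    ∑' (a) (b) (l), f a * g b * h l = (∑' a, f a) * (∑' b, g b) * ∑' l, h l := by
  simp_rw [ENNReal.tsum_mul_left, ENNReal.tsum_mul_right, ENNReal.tsum_mul_left,
    ENNReal.tsum_mul_right]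

theorem wt_rpow (s t : ℝ) (k : Freq d) : wt s k ^ t = wt (s * t) k := by
  rw [wt, wt, ← NNReal.rpow_mul]

theorem coe_wt_mul (s t : ℝ) (k : Freq d) :
    (wt s k : ℝ≥0∞) * wt t k = wt (s + t) k := by
  rw [← ENNReal.coe_mul, wt_mul_wt]

theorem wt_mul_enorm_sq_cancel (s : ℝ) (k : Freq d) (z : ℂ) :
    ‖z‖ₑ ^ 2 = wt (-(2 * s)) k * (wt (2 * s) k * ‖z‖ₑ ^ 2) := by
  rw [← mul_assoc, coe_wt_mul, neg_add_cancel, wt_zero, ENNReal.coe_one, one_mul]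

/-- If one entry is controlled by `qsum` and the two others lie in `H^1`, `tri` converges. -/
theorem triOK_of_first {β : ℝ} {φ v w : Freq d → ℂ}
    (hφ : qsum (fun k => wt (2 * β) k) (fun a => ‖φ a‖ₑ ^ 2) (fun b => wt (-2) b)
      (fun l => wt (-2) l) < ∞) (hv : sobSq 1 v < ∞) (hw : sobSq 1 w < ∞) : TriOK β φ v w := by
  -- Cauchy–Schwarz over the resonances: the weights `|b|²|l|²` go to `v` and `w`, where the sum
  -- over `a` is free, and their inverses stay with `φ`.
  have hk : ∀ k, triAbs φ v w k ^ 2 ≤ (∑' (a) (b) (l), if Res a b l k then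
      ‖φ a‖ₑ ^ 2 * wt (-2) b * wt (-2) l else 0) * (sobSq 1 v * sobSq 1 w) := fun k => by
    rw [triAbs_eq_tsum]
    refine (tsum_sq_le_triple (h := fun a b l => if Res a b l k then
      (wt (2 * 1) b * ‖v b‖ₑ ^ 2) * (wt (2 * 1) l * ‖w l‖ₑ ^ 2) else 0)
      (fun a b l => ?_)).trans (mul_le_mul_right ((tsum_res_first_le k _).trans_eq
        (tsum_tsum_mul _ _)) _)
    · split_ifs
      · rw [mul_pow, mul_pow]
        conv_lhs => rw [wt_mul_enorm_sq_cancel 1 b (v b), wt_mul_enorm_sq_cancel 1 l (w l)]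
        norm_num
        apply le_of_eq
        ring
      · simp
  refine lt_of_le_of_lt (ENNReal.tsum_le_tsum fun k => mul_le_mul_right (hk k) _) ?_
  simp_rw [← mul_assoc]
  rw [ENNReal.tsum_mul_right, ENNReal.tsum_mul_right]
  refine ENNReal.mul_lt_top (ENNReal.mul_lt_top ?_ hv) hw
  refine lt_of_le_of_lt (le_of_eq (tsum_congr fun k => ?_)) hφ
  simp_rw [← ENNReal.tsum_mul_left]
  refine tsum_congr fun a => tsum_congr fun b => tsum_congr fun l => ?_
  split_ifs
  · ring
  · simp

/-- The same Cauchy–Schwarz argument with the rough entry in the conjugated slot, which is not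
exchangeable with the other two. -/
theorem triOK_of_third {β : ℝ} {φ v w : Freq d → ℂ}
    (hφ : qsum (fun k => wt (2 * β) k) (fun a => wt (-2) a) (fun b => wt (-2) b)
      (fun l => ‖φ l‖ₑ ^ 2) < ∞) (hv : sobSq 1 v < ∞) (hw : sobSq 1 w < ∞) : TriOK β v w φ := by
  have hk : ∀ k, triAbs v w φ k ^ 2 ≤ (∑' (a) (b) (l), if Res a b l k then
      wt (-2) a * wt (-2) b * ‖φ l‖ₑ ^ 2 else 0) * (sobSq 1 v * sobSq 1 w) := fun k => by
    rw [triAbs_eq_tsum]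
    refine (tsum_sq_le_triple (h := fun a b l => if Res a b l k then
      (wt (2 * 1) a * ‖v a‖ₑ ^ 2) * (wt (2 * 1) b * ‖w b‖ₑ ^ 2) else 0)
      (fun a b l => ?_)).trans (mul_le_mul_right ((tsum_res_third_le k _).trans_eq
        (tsum_tsum_mul _ _)) _)
    · split_ifs
      · rw [mul_pow, mul_pow]
        conv_lhs => rw [wt_mul_enorm_sq_cancel 1 a (v a), wt_mul_enorm_sq_cancel 1 b (w b)]
        norm_num
        apply le_of_eq
        ring
      · simp
  refine lt_of_le_of_lt (ENNReal.tsum_le_tsum fun k => mul_le_mul_right (hk k) _) ?_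
  simp_rw [← mul_assoc]
  rw [ENNReal.tsum_mul_right, ENNReal.tsum_mul_right]
  refine ENNReal.mul_lt_top (ENNReal.mul_lt_top ?_ hv) hw
  refine lt_of_le_of_lt (le_of_eq (tsum_congr fun k => ?_)) hφ
  simp_rw [← ENNReal.tsum_mul_left]
  refine tsum_congr fun a => tsum_congr fun b => tsum_congr fun l => ?_
  split_ifs
  · ring
  · simp

/-! ### The trilinear bound in dimension one and the resonance sum in dimension two. -/

/-- In dimension one `tri` is bounded from `(H^{2/5})³` to `L²`. -/
def triConst : ℝ≥0∞ := 3 * (∑' k : Freq 1, (wt (-(6 / 5)) k : ℝ≥0∞)) ^ 2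

theorem triConst_lt_top : triConst < ∞ :=
  ENNReal.mul_lt_top (by simp) (ENNReal.pow_lt_top (tsum_wt_lt_top_of_dim_one (by norm_num)))

/-- With `f = |·|^{-6/5}`, the product `|a b l|^{-4/5}` is the geometric mean of `f b * f l`, `f a *
f l` and `f a * f b`. Each of these involves only two frequencies, which determine the third, and
`f` is summable over the nonzero integers. -/
theorem tsum_wt_triple_le (k : Freq 1) :
    (∑' (a) (b) (l), if Res a b l k then
      (wt (-(4 / 5)) a : ℝ≥0∞) * wt (-(4 / 5)) b * wt (-(4 / 5)) l else 0) ≤ triConst := by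
  set f : Freq 1 → ℝ≥0∞ := fun k => wt (-(6 / 5)) k with hf
  have hle : ∀ a b l : Freq 1, (wt (-(4 / 5)) a : ℝ≥0∞) * wt (-(4 / 5)) b * wt (-(4 / 5)) l ≤
      f b * f l + f a * f l + f a * f b := fun a b l => by
    have h := NNReal.geom_mean_le_arith_mean3_weighted (1 / 3) (1 / 3) (1 / 3)
      (wt (-(6 / 5)) b * wt (-(6 / 5)) l) (wt (-(6 / 5)) a * wt (-(6 / 5)) l)
      (wt (-(6 / 5)) a * wt (-(6 / 5)) b) (by norm_num [← NNReal.coe_inj])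
    simp only [NNReal.mul_rpow, wt_rpow] at h
    have h1 : ∀ x : Freq 1, wt (-(6 / 5) * ((1 / 3 : ℝ≥0) : ℝ)) x * wt (-(6 / 5) *
        ((1 / 3 : ℝ≥0) : ℝ)) x = wt (-(4 / 5)) x := fun x => by
      rw [wt_mul_wt]
      congr 1
      push_cast
      norm_num
    have h2 : ∀ x : ℝ≥0, 1 / 3 * x ≤ x := fun x => by
      refine mul_le_of_le_one_left' ?_
      rw [← NNReal.coe_le_coe]
      norm_num
    have h3 : wt (-(4 / 5)) a * wt (-(4 / 5)) b * wt (-(4 / 5)) l ≤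
        wt (-(6 / 5)) b * wt (-(6 / 5)) l + wt (-(6 / 5)) a * wt (-(6 / 5)) l +
          wt (-(6 / 5)) a * wt (-(6 / 5)) b := by
      refine le_trans (le_of_eq ?_) (h.trans (add_le_add (add_le_add (h2 _) (h2 _)) (h2 _)))
      rw [← h1 a, ← h1 b, ← h1 l]
      ring
    simp only [hf]
    exact_mod_cast h3
  calc _ ≤ ∑' (a) (b) (l), ((if Res a b l k then f b * f l else 0) +
        (if Res a b l k then f a * f l else 0) + (if Res a b l k then f a * f b else 0)) :=
        ENNReal.tsum_le_tsum fun a => ENNReal.tsum_le_tsum fun b => ENNReal.tsum_le_tsum fun l => by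
          split_ifs
          · exact hle a b l
          · simp
    _ = (∑' (a : Freq 1) (b) (l), if Res a b l k then f b * f l else 0) +
        (∑' (a) (b : Freq 1) (l), if Res a b l k then f a * f l else 0) +
        (∑' (a) (b) (l : Freq 1), if Res a b l k then f a * f b else 0) := by
        simp_rw [ENNReal.tsum_add]
    _ ≤ (∑' k, f k) * (∑' k, f k) + (∑' k, f k) * (∑' k, f k) + (∑' k, f k) * (∑' k, f k) :=
        add_le_add (add_le_add ((tsum_res_first_le k _).trans_eq (tsum_tsum_mul f f))
          ((tsum_res_second_le k _).trans_eq (tsum_tsum_mul f f)))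
          ((tsum_res_third_le k _).trans_eq (tsum_tsum_mul f f))
    _ = triConst := by
        rw [triConst]
        ring

/-- Cauchy–Schwarz with weights `|·|^{4/5}` on each entry. The inverse weights sum to at most
`triConst` uniformly in `k`, and since `k` is determined by `(a, b, l)` the remaining sum
factorises. -/
theorem tsum_triAbs_sq_le {β : ℝ} (hβ : β ≤ 0) (u v w : Freq 1 → ℂ) :
    ∑' k, (wt (2 * β) k : ℝ≥0∞) * triAbs u v w k ^ 2 ≤
      triConst * (sobSq (2 / 5) u * sobSq (2 / 5) v * sobSq (2 / 5) w) := by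
  have hk : ∀ k, (wt (2 * β) k : ℝ≥0∞) * triAbs u v w k ^ 2 ≤ triConst *
      ∑' (a) (b) (l), if Res a b l k then (wt (2 * (2 / 5)) a * ‖u a‖ₑ ^ 2) *
        (wt (2 * (2 / 5)) b * ‖v b‖ₑ ^ 2) * (wt (2 * (2 / 5)) l * ‖w l‖ₑ ^ 2) else 0 := fun k => by
    have h1 : (wt (2 * β) k : ℝ≥0∞) ≤ 1 := by
      rw [← ENNReal.coe_one, ENNReal.coe_le_coe, ← wt_zero k]
      exact wt_mono (by linarith) k
    refine (mul_le_of_le_one_left' h1).trans ?_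
    rw [triAbs_eq_tsum]
    refine (tsum_sq_le_triple (g := fun a b l => if Res a b l k then
      (wt (-(4 / 5)) a : ℝ≥0∞) * wt (-(4 / 5)) b * wt (-(4 / 5)) l else 0)
      (fun a b l => ?_)).trans (mul_le_mul_left (tsum_wt_triple_le k) _)
    split_ifs
    · rw [mul_pow, mul_pow]
      conv_lhs => rw [wt_mul_enorm_sq_cancel (2 / 5) a (u a),
        wt_mul_enorm_sq_cancel (2 / 5) b (v b), wt_mul_enorm_sq_cancel (2 / 5) l (w l)]
      norm_num
      apply le_of_eq
      ring
    · simp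
  refine (ENNReal.tsum_le_tsum hk).trans ?_
  rw [ENNReal.tsum_mul_left]
  gcongr
  exact (tsum_res_output_le _).trans_eq (tsum_tsum_tsum_mul _ _ _)

theorem triOK_of_dim_one {β : ℝ} (hβ : β ≤ 0) {u v w : Freq 1 → ℂ} (hu : sobSq (2 / 5) u < ∞)
    (hv : sobSq (2 / 5) v < ∞) (hw : sobSq (2 / 5) w < ∞) : TriOK β u v w :=
  (tsum_triAbs_sq_le hβ u v w).trans_lt
    (ENNReal.mul_lt_top triConst_lt_top (ENNReal.mul_lt_top (ENNReal.mul_lt_top hu hv) hw))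

/-- In dimension two, `∑_{a+b-l=k} |k|^{2β} |a|^{-2} |b|^{-2} |l|^{-2} < ∞`. -/
theorem qsum_wt_lt_top {β : ℝ} (hβ : β < 0) :
    qsum (d := 2) (fun k => wt (2 * β) k) (fun a => wt (-2) a) (fun b => wt (-2) b)
      (fun l => wt (-2) l) < ∞ := by
  -- The sum increases with `β`, so `β` may be raised to `-1`; this keeps the interpolation weight
  -- `1 - 3θ` nonnegative.
  wlog hβ1 : -1 ≤ β generalizing β
  · refine (qsum_mono (fun k => ?_) (fun _ => le_rfl) (fun _ => le_rfl)
      (fun _ => le_rfl)).trans_lt (this (β := -1) (by norm_num) le_rfl)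
    exact ENNReal.coe_le_coe.2 (wt_mono (by linarith) k)
  -- The summand is the geometric mean of the four triple products of `|·|^{-s}`, with weight `1 -
  -- 3θ` on the one omitting `k` and `θ` on the others. Matching exponents requires `3sθ = -2β` at
  -- `k` and `s(1 - θ) = 2` at `a`, `b`, `l`, which determines `s` and `θ`. Then `s > 2`, so
  -- `|·|^{-s}` is summable on the plane lattice.
  set s : ℝ := -2 * β / 3 + 2 with hs
  have hs2 : 2 < s := by
    rw [hs]
    linarith
  set θ : ℝ := -2 * β / (3 * s) with hθ
  have hθ0 : 0 ≤ θ := div_nonneg (by linarith) (by linarith)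
  have hθs : 3 * s * θ = -2 * β := by
    rw [hθ]
    field_simp
  have hθ1 : 3 * θ ≤ 1 := by nlinarith
  set f : Freq 2 → ℝ≥0∞ := fun k => wt (-s) k with hf
  have hZ : ∑' k, f k < ∞ := tsum_wt_lt_top_of_dim_two (by linarith)
  have hle : ∀ k a b l : Freq 2, (wt (2 * β) k : ℝ≥0∞) * wt (-2) a * wt (-2) b * wt (-2) l ≤
      f a * f b * f l + f b * f l * f k + f a * f l * f k + f a * f b * f k := fun k a b l => by
    obtain ⟨t, ht⟩ : ∃ t : ℝ≥0, (t : ℝ) = θ := ⟨⟨θ, hθ0⟩, rfl⟩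
    obtain ⟨t', ht'⟩ : ∃ t : ℝ≥0, (t : ℝ) = 1 - 3 * θ := ⟨⟨1 - 3 * θ, by linarith⟩, rfl⟩
    have h := NNReal.geom_mean_le_arith_mean4_weighted t' t t t
      (wt (-s) a * wt (-s) b * wt (-s) l) (wt (-s) b * wt (-s) l * wt (-s) k)
      (wt (-s) a * wt (-s) l * wt (-s) k) (wt (-s) a * wt (-s) b * wt (-s) k) (by
        rw [← NNReal.coe_inj]
        push_cast
        rw [ht, ht']
        ring)
    simp only [NNReal.mul_rpow, wt_rpow, ht, ht'] at h
    have h1 : ∀ x : Freq 2, wt (-s * (1 - 3 * θ)) x * wt (-s * θ) x * wt (-s * θ) x =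
        wt (-2) x := fun x => by
      rw [wt_mul_wt, wt_mul_wt]
      congr 1
      linear_combination (1 / 3) * hθs - hs
    have h1' : wt (-s * θ) k * wt (-s * θ) k * wt (-s * θ) k = wt (2 * β) k := by
      rw [wt_mul_wt, wt_mul_wt]
      congr 1
      linear_combination -hθs
    have h2 : ∀ t : ℝ≥0, t ≤ 1 → ∀ x : ℝ≥0, t * x ≤ x := fun t ht x =>
      mul_le_of_le_one_left' ht
    have ht1 : t' ≤ 1 := by
      rw [← NNReal.coe_le_coe, ht', NNReal.coe_one]
      linarith
    have ht2 : t ≤ 1 := by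
      rw [← NNReal.coe_le_coe, ht, NNReal.coe_one]
      linarith
    have h3 : wt (2 * β) k * wt (-2) a * wt (-2) b * wt (-2) l ≤
        wt (-s) a * wt (-s) b * wt (-s) l + wt (-s) b * wt (-s) l * wt (-s) k +
        wt (-s) a * wt (-s) l * wt (-s) k + wt (-s) a * wt (-s) b * wt (-s) k := by
      refine le_trans (le_of_eq ?_) (h.trans (add_le_add (add_le_add (add_le_add
        (h2 _ ht1 _) (h2 _ ht2 _)) (h2 _ ht2 _)) (h2 _ ht2 _)))
      rw [← h1 a, ← h1 b, ← h1 l, ← h1']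
      ring
    simp only [hf]
    exact_mod_cast h3
  have hsum : qsum (d := 2) (fun k => wt (2 * β) k) (fun a => wt (-2) a) (fun b => wt (-2) b)
      (fun l => wt (-2) l) ≤ 4 * (∑' k, f k) ^ 3 := by
    calc _ ≤ ∑' (k) (a) (b) (l), ((if Res a b l k then f a * f b * f l else 0) +
          (if Res a b l k then f b * f l * f k else 0) +
          (if Res a b l k then f a * f l * f k else 0) +
          (if Res a b l k then f a * f b * f k else 0)) :=
          ENNReal.tsum_le_tsum fun k => ENNReal.tsum_le_tsum fun a =>
            ENNReal.tsum_le_tsum fun b => ENNReal.tsum_le_tsum fun l => by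
              split_ifs
              · exact hle k a b l
              · simp
      _ = (∑' (k : Freq 2) (a) (b) (l), if Res a b l k then f a * f b * f l else 0) +
          (∑' (k) (a : Freq 2) (b) (l), if Res a b l k then f b * f l * f k else 0) +
          (∑' (k) (a) (b : Freq 2) (l), if Res a b l k then f a * f l * f k else 0) +
          (∑' (k) (a) (b) (l : Freq 2), if Res a b l k then f a * f b * f k else 0) := by
          simp_rw [ENNReal.tsum_add]
      _ ≤ (∑' k, f k) * (∑' k, f k) * (∑' k, f k) + (∑' k, f k) * (∑' k, f k) * (∑' k, f k) +
          (∑' k, f k) * (∑' k, f k) * (∑' k, f k) +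
          (∑' k, f k) * (∑' k, f k) * (∑' k, f k) := by
          have hfin : ∑' (k) (a) (b), f a * f b * f k =
              (∑' k, f k) * (∑' k, f k) * (∑' k, f k) := by
            simp_rw [ENNReal.tsum_mul_right, tsum_tsum_mul, ENNReal.tsum_mul_left]
          refine add_le_add (add_le_add (add_le_add ?_ ?_) ?_) ?_
          · exact (tsum_res_output_le _).trans_eq (tsum_tsum_tsum_mul f f f)
          · rw [← hfin]
            exact ENNReal.tsum_le_tsum fun k => tsum_res_first_le k fun b l => f b * f l * f k
          · rw [← hfin]
            exact ENNReal.tsum_le_tsum fun k => tsum_res_second_le k fun a l => f a * f l * f k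
          · rw [← hfin]
            exact ENNReal.tsum_le_tsum fun k => tsum_res_third_le k fun a b => f a * f b * f k
      _ = 4 * (∑' k, f k) ^ 3 := by ring
  exact hsum.trans_lt (ENNReal.mul_lt_top (by simp) (ENNReal.pow_lt_top hZ))

/-! ### Coefficients, truncations and measurability in `H^s` -/

namespace Sob

variable {s : ℝ}

theorem coeff_sub (φ ψ : Sob d s) : (φ - ψ).coeff = φ.coeff - ψ.coeff := rfl

theorem coeff_mk (φ : Freq d → ℂ) (h : MemSob s φ) : (mk φ h).coeff = φ := rfl

theorem coeff_zero : (0 : Sob d s).coeff = 0 := rfl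

theorem coeff_sum {κ : Type*} (t : Finset κ) (f : κ → Sob d s) :
    (∑ i ∈ t, f i).coeff = ∑ i ∈ t, (f i).coeff := by
  classical
  induction t using Finset.induction_on with
  | empty => simp [coeff_zero]
  | insert a t ha ih => rw [Finset.sum_insert ha, Finset.sum_insert ha, coeff_add, ih]

theorem coeff_ofCoeff {φ : Freq d → ℂ} (h : MemSob s φ) : (ofCoeff s φ).coeff = φ := by
  rw [ofCoeff, dif_pos h, coeff_mk]

theorem sobSq_coeff_lt_top (φ : Sob d s) : sobSq s φ.coeff < ∞ :=
  (memSob_iff_sobSq s _).1 φ.memSob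

theorem norm_coeff_le (φ : Sob d s) (k : Freq d) : ‖φ.coeff k‖ ≤ k.abs ^ (-s) * ‖φ‖ := by
  have h1 : ‖toEll2 d s φ k‖ ≤ ‖φ‖ := lp.norm_apply_le_norm (by norm_num) (toEll2 d s φ) k
  have h2 : ‖toEll2 d s φ k‖ = k.abs ^ s * ‖φ.coeff k‖ := by
    change ‖(k.abs ^ s) • φ.coeff k‖ = _
    rw [norm_smul, Real.norm_of_nonneg (Real.rpow_nonneg k.abs_pos.le s)]
  rw [h2] at h1
  calc ‖φ.coeff k‖ = k.abs ^ (-s) * (k.abs ^ s * ‖φ.coeff k‖) := by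
        rw [← mul_assoc, ← Real.rpow_add k.abs_pos, neg_add_cancel, Real.rpow_zero, one_mul]
    _ ≤ _ := mul_le_mul_of_nonneg_left h1 (Real.rpow_nonneg k.abs_pos.le _)

/-- A Fourier coefficient as a continuous linear functional. -/
def coeffL (d : ℕ) (s : ℝ) (k : Freq d) : Sob d s →L[ℝ] ℂ :=
  LinearMap.mkContinuous
    { toFun := fun φ => φ.coeff k
      map_add' := fun _ _ => rfl
      map_smul' := fun _ _ => rfl } (k.abs ^ (-s)) fun φ => norm_coeff_le φ k

open Classical in
/-- The element of `H^s` with a single nonzero coefficient. -/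
def single (k : Freq d) (z : ℂ) : Sob d s :=
  mk (Pi.single k z)
    (memSob_of_finite_support ((Set.finite_singleton k).subset Pi.support_single_subset))

theorem norm_single (k : Freq d) (z : ℂ) : ‖(single k z : Sob d s)‖ = k.abs ^ s * ‖z‖ := by
  classical
  have h : ‖(single k z : Sob d s)‖ ^ 2 = (k.abs ^ s * ‖z‖) ^ 2 := by
    rw [norm_sq, tsum_eq_single k, single, coeff_mk, Pi.single_eq_same, ← weight_sq, norm_smul,
      Real.norm_of_nonneg (Real.rpow_nonneg k.abs_pos.le s)]
    intro j hj
    rw [single, coeff_mk, Pi.single_eq_of_ne hj]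
    simp
  exact (sq_eq_sq₀ (norm_nonneg _)
    (mul_nonneg (Real.rpow_nonneg k.abs_pos.le s) (norm_nonneg _))).1 h

/-- `single` as a continuous linear map. -/
def singleL (d : ℕ) (s : ℝ) (k : Freq d) : ℂ →L[ℝ] Sob d s :=
  LinearMap.mkContinuous
    { toFun := single k
      map_add' := fun x y => by
        classical
        ext j
        exact congrFun (Pi.single_add (f := fun _ : Freq d => ℂ) k x y) j
      map_smul' := fun c x => by
        classical
        ext j
        exact congrFun (Pi.single_smul (f := fun _ : Freq d => ℂ) k c x) j }
    (k.abs ^ s) fun z => (norm_single k z).le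

theorem singleL_apply (k : Freq d) (z : ℂ) : singleL d s k z = single k z := rfl

/-- The projection of a family of coefficients, as an element of `H^s`. -/
def trunc (s : ℝ) (N : ℕ) (φ : Freq d → ℂ) : Sob d s := mk (proj N φ) (memSob_proj s N φ)

theorem trunc_eq_sum (N : ℕ) (φ : Freq d → ℂ) :
    trunc s N φ = ∑ k ∈ Freq.ball d N, singleL d s k (φ k) := by
  classical
  ext j
  rw [coeff_sum, Finset.sum_apply]
  simp only [singleL_apply, single, coeff_mk, trunc, proj]
  rw [Finset.sum_pi_single]

end Sob

theorem mem_ball {N : ℕ} {k : Freq d} : k ∈ Freq.ball d N ↔ k.abs ≤ N := by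
  simp [Freq.ball]

theorem ball_mono {N M : ℕ} (h : N ≤ M) : Freq.ball d N ⊆ Freq.ball d M := fun k hk =>
  mem_ball.2 ((mem_ball.1 hk).trans (by exact_mod_cast h))

theorem eventually_mem_ball (k : Freq d) : ∀ᶠ N in atTop, k ∈ Freq.ball d N := by
  obtain ⟨N, hN⟩ := exists_nat_ge k.abs
  exact eventually_atTop.2 ⟨N, fun M hM => ball_mono hM (mem_ball.2 hN)⟩

theorem proj_apply_of_mem {N : ℕ} {k : Freq d} (h : k ∈ Freq.ball d N) (φ : Freq d → ℂ) :
    proj N φ k = φ k := if_pos h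

theorem proj_apply_of_notMem {N : ℕ} {k : Freq d} (h : k ∉ Freq.ball d N) (φ : Freq d → ℂ) :
    proj N φ k = 0 := if_neg h

/-- Dominated convergence in `H^s`. -/
theorem Sob.tendsto_of_dominated {s : ℝ} {f : ℕ → Sob d s} {φ : Sob d s} {b : Freq d → ℝ}
    (hb : Summable fun k => k.abs ^ (2 * s) * b k ^ 2)
    (hle : ∀ N k, ‖(f N).coeff k - φ.coeff k‖ ≤ b k)
    (hlim : ∀ k, Tendsto (fun N => (f N).coeff k) atTop (𝓝 (φ.coeff k))) :
    Tendsto f atTop (𝓝 φ) := by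
  rw [tendsto_iff_norm_sub_tendsto_zero]
  have h : Tendsto (fun N => ‖f N - φ‖ ^ 2) atTop (𝓝 0) := by
    simp_rw [Sob.norm_sq]
    rw [show (0 : ℝ) = ∑' _ : Freq d, (0 : ℝ) by simp]
    refine tendsto_tsum_of_dominated_convergence hb (fun k => ?_)
      (Eventually.of_forall fun N k => ?_)
    · have h1 := (tendsto_iff_norm_sub_tendsto_zero.1 (hlim k)).pow 2
      have h2 := h1.const_mul (k.abs ^ (2 * s))
      simpa [Sob.coeff_sub] using h2
    · rw [Real.norm_of_nonneg (mul_nonneg (Real.rpow_nonneg k.abs_pos.le _) (sq_nonneg _)),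
        Sob.coeff_sub]
      exact mul_le_mul_of_nonneg_left (pow_le_pow_left₀ (norm_nonneg _) (hle N k) 2)
        (Real.rpow_nonneg k.abs_pos.le _)
  have h' := (Real.continuous_sqrt.tendsto 0).comp h
  simpa [Function.comp_def, Real.sqrt_sq (norm_nonneg _)] using h'

theorem Sob.tendsto_trunc {s : ℝ} (φ : Sob d s) :
    Tendsto (fun N => Sob.trunc s N φ.coeff) atTop (𝓝 φ) := by
  refine Sob.tendsto_of_dominated (b := fun k => ‖φ.coeff k‖) φ.memSob (fun N k => ?_) fun k => ?_
  · by_cases hk : k ∈ Freq.ball d N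
    · simp [Sob.trunc, Sob.coeff_mk, proj_apply_of_mem hk]
    · simp [Sob.trunc, Sob.coeff_mk, proj_apply_of_notMem hk]
  · refine tendsto_const_nhds.congr' ?_
    filter_upwards [eventually_mem_ball k] with N hN
    simp [Sob.trunc, Sob.coeff_mk, proj_apply_of_mem hN]

theorem Sob.stronglyMeasurable_trunc {Ω : Type*} [MeasurableSpace Ω] {s : ℝ} (N : ℕ)
    {f : Ω → Freq d → ℂ} (hf : ∀ k ∈ Freq.ball d N, Measurable fun ω => f ω k) :
    StronglyMeasurable fun ω => Sob.trunc s N (f ω) := by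
  simp_rw [Sob.trunc_eq_sum]
  exact Finset.stronglyMeasurable_fun_sum _ fun k hk =>
    (Sob.singleL d s k).continuous.comp_stronglyMeasurable (hf k hk).stronglyMeasurable

/-- The truncations are finite sums of measurable terms and converge pointwise, so no comparison of
the coefficient σ-algebra on `H^s` with the Borel one is needed. -/
theorem Sob.stronglyMeasurable_of_coeff {Ω : Type*} [MeasurableSpace Ω] {s : ℝ} {f : Ω → Sob d s}
    (hf : ∀ k, Measurable fun ω => (f ω).coeff k) : StronglyMeasurable f :=
  stronglyMeasurable_of_tendsto atTop
    (fun N => Sob.stronglyMeasurable_trunc N (f := fun ω => (f ω).coeff) fun k _ => hf k)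
    (tendsto_pi_nhds.2 fun ω => Sob.tendsto_trunc (f ω))

/-! ### Truncations of the trilinear form -/

/-- The truncated trilinear form `Π_N tri(Π_N u, Π_N v, Π_N w)`. -/
def truncTri (N : ℕ) (β : ℝ) (u v w : Freq d → ℂ) : Sob d β :=
  Sob.trunc β N (tri (proj N u) (proj N v) (proj N w))

/-- A truncation either keeps a term or deletes it, so the untruncated series dominates all its
truncations. -/
theorem triTerm_proj (N : ℕ) (u v w : Freq d → ℂ) (k : Freq d) (x : (Fin d → ℤ) × (Fin d → ℤ)) :
    triTerm (proj N u) (proj N v) (proj N w) k x = triTerm u v w k x ∨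
      triTerm (proj N u) (proj N v) (proj N w) k x = 0 := by
  have h : ∀ (u : Freq d → ℂ) n, ext0 (proj N u) n = ext0 u n ∨ ext0 (proj N u) n = 0 := by
    intro u n
    by_cases hn : n = 0
    · simp [ext0, hn]
    · by_cases hb : (⟨n, hn⟩ : Freq d) ∈ Freq.ball d N <;> simp [ext0, hn, proj, hb]
  simp only [triTerm]
  rcases h u (k.1 - x.2) with h1 | h1 <;> rcases h v (x.1 + x.2) with h2 | h2 <;>
    rcases h w x.1 with h3 | h3 <;> simp [h1, h2, h3]

theorem eventually_triTerm_proj (u v w : Freq d → ℂ) (k : Freq d)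
    (x : (Fin d → ℤ) × (Fin d → ℤ)) :
    ∀ᶠ N in atTop, triTerm (proj N u) (proj N v) (proj N w) k x = triTerm u v w k x := by
  have h : ∀ (u : Freq d → ℂ) n, ∀ᶠ N in atTop, ext0 (proj N u) n = ext0 u n := by
    intro u n
    by_cases hn : n = 0
    · simp [ext0, hn]
    · filter_upwards [eventually_mem_ball (⟨n, hn⟩ : Freq d)] with N hN
      simp [ext0, hn, proj, hN]
  filter_upwards [h u (k.1 - x.2), h v (x.1 + x.2), h w x.1] with N h1 h2 h3
  simp only [triTerm, h1, h2, h3]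

/-- Dominated convergence twice: in the series for each coefficient, then in the sum defining the
`H^β` norm, where `triAbs` is the dominating family. -/
theorem TriOK.tendsto_truncTri {β : ℝ} {u v w : Freq d → ℂ} (h : TriOK β u v w) :
    Tendsto (fun N => truncTri N β u v w) atTop (𝓝 (Sob.ofCoeff β (tri u v w))) := by
  have hle : ∀ N k x, ‖triTerm (proj N u) (proj N v) (proj N w) k x‖ ≤ ‖triTerm u v w k x‖ := by
    intro N k x
    rcases triTerm_proj N u v w k x with h1 | h1 <;> simp [h1]
  have hsum : ∀ k, Summable fun x => ‖triTerm u v w k x‖ := fun k => (h.summable k).norm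
  have habs : ∀ k, (triAbs u v w k).toReal = ∑' x, ‖triTerm u v w k x‖ := fun k => by
    rw [triAbs, ENNReal.tsum_toReal_eq fun x => enorm_ne_top]
    simp
  refine Sob.tendsto_of_dominated (b := fun k => (triAbs u v w k).toReal) ?_ (fun N k => ?_)
    fun k => ?_
  · have h1 := ENNReal.summable_toReal (ne_of_lt h)
    refine h1.congr fun k => ?_
    rw [ENNReal.toReal_mul, ENNReal.toReal_pow, ENNReal.coe_toReal, coe_wt]
  · rw [Sob.coeff_ofCoeff h.memSob, truncTri, Sob.trunc, Sob.coeff_mk, habs]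
    by_cases hk : k ∈ Freq.ball d N
    · rw [proj_apply_of_mem hk, tri, tri,
        ← ((hsum k).of_norm_bounded (hle N k)).tsum_sub (h.summable k)]
      have hle' : ∀ x, ‖triTerm (proj N u) (proj N v) (proj N w) k x - triTerm u v w k x‖ ≤
          ‖triTerm u v w k x‖ := fun x => by
        rcases triTerm_proj N u v w k x with h1 | h1 <;> simp [h1]
      exact tsum_of_norm_bounded (hsum k).hasSum hle'
    · rw [proj_apply_of_notMem hk, zero_sub, norm_neg, tri]
      exact norm_tsum_le_tsum_norm (hsum k)
  · rw [Sob.coeff_ofCoeff h.memSob]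
    have h1 : Tendsto (fun N => tri (proj N u) (proj N v) (proj N w) k) atTop
        (𝓝 (tri u v w k)) :=
      tendsto_tsum_of_dominated_convergence (hsum k)
        (fun x => tendsto_const_nhds.congr'
          ((eventually_triTerm_proj u v w k x).mono fun N hN => hN.symm))
        (Eventually.of_forall fun N x => hle N k x)
    refine h1.congr' ?_
    filter_upwards [eventually_mem_ball k] with N hN
    rw [truncTri, Sob.trunc, Sob.coeff_mk, proj_apply_of_mem hN]

/-! ### Hilbert–Schmidt norms -/

theorem hsNorm_pow {ι E G : Type*} [NormedAddCommGroup E] [InnerProductSpace ℝ E]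
    [NormedAddCommGroup G] [InnerProductSpace ℝ G] (b : HilbertBasis ι ℝ E) (T : E →L[ℝ] G)
    (p : ℕ) : hsNorm b T ^ (2 * p) = (∑' i, ‖T (b i)‖ₑ ^ 2) ^ p := by
  rw [hsNorm, pow_mul, ← ENNReal.rpow_natCast _ 2, ← ENNReal.rpow_mul]
  norm_num

theorem norm_le_of_enorm_sq_le {E F : Type*} [NormedAddCommGroup E] [NormedAddCommGroup F]
    {x : E} {y : F} {K : ℝ≥0∞} (hK : K < ∞) (h : ‖x‖ₑ ^ 2 ≤ K * ‖y‖ₑ ^ 2) :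
    ‖x‖ ≤ √K.toReal * ‖y‖ := by
  have h1 := ENNReal.toReal_mono (ENNReal.mul_lt_top hK (by simp)).ne h
  simp only [ENNReal.toReal_pow, ENNReal.toReal_mul, toReal_enorm] at h1
  rw [← Real.sqrt_sq (norm_nonneg x), ← Real.sqrt_sq (norm_nonneg y),
    ← Real.sqrt_mul ENNReal.toReal_nonneg]
  exact Real.sqrt_le_sqrt h1

theorem basis_apply (s : ℝ) (j : Freq d × Fin 2) : Sob.basis d s j = Sob.basisVec d s j := by
  rw [Sob.basis, HilbertBasis.coe_mkOfOrthogonalEqBot]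

theorem sobSq_basisVec (s t : ℝ) (j : Freq d × Fin 2) :
    sobSq t (Sob.basisVec d s j).coeff = wt (2 * t - 2 * s) j.1 := by
  classical
  have hI : ‖(![1, Complex.I] j.2 : ℂ)‖ = 1 := by
    obtain ⟨j, σ⟩ := j
    fin_cases σ <;> simp
  rw [sobSq, tsum_eq_single j.1]
  · rw [Sob.basisVec, Sob.coeff_mk, Pi.single_eq_same, ← ofReal_norm, norm_smul, hI, mul_one,
      Real.norm_of_nonneg (Real.rpow_nonneg j.1.abs_pos.le _), ← coe_wt,
      ENNReal.ofReal_coe_nnreal, sq, coe_wt_mul, coe_wt_mul]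
    congr 2
    ring
  · intro k hk
    rw [Sob.basisVec, Sob.coeff_mk, Pi.single_eq_of_ne hk]
    simp

/-! ### Moments of the Sobolev norms -/

theorem lintegral_gaussMode_pow (k : Freq d) {p : ℕ} (hp : 1 ≤ p) :
    ∫⁻ z, (‖z‖ₑ ^ 2) ^ p ∂gaussMode 2 k ≤ gaussMoment p * (modeVar k : ℝ≥0∞) ^ p := by
  have hk := isCircularGaussian_gaussMode k
  have := hk.isGaussian
  have hP : ∀ L : StrongDual ℝ ℂ, ∫ z, L z ∂gaussMode 2 k = 0 := fun L => by
    have h : ∫ z, L z ∂gaussMode 2 k = ∫ z, L (-1 * z) ∂gaussMode 2 k := by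
      conv_lhs => rw [← hk.map_mul (-1) (by simp)]
      rw [integral_map (by fun_prop) (by fun_prop)]
    simp only [neg_mul, one_mul, map_neg, integral_neg] at h
    linarith
  have h := lintegral_sum_clm_pow hP (κ := Unit) (fun _ => ContinuousLinearMap.id ℝ ℂ) hp
  simpa [lintegral_gaussMode_sq] using h

/-- Minkowski over the modes in a ball, each controlled by its variance, then Fatou as the ball
grows. -/
theorem lintegral_sobSq_pow (s : ℝ) {p : ℕ} (hp : 1 ≤ p) :
    ∫⁻ φ, sobSq s φ ^ p ∂gaussSeq d 2 ≤
      gaussMoment p * (∑' k : Freq d, (wt (2 * s) k : ℝ≥0∞) * modeVar k) ^ p := by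
  have hmode : ∀ k : Freq d, ∫⁻ φ, ((wt (2 * s) k : ℝ≥0∞) * ‖φ k‖ₑ ^ 2) ^ p ∂gaussSeq d 2 ≤
      gaussMoment p * ((wt (2 * s) k : ℝ≥0∞) * modeVar k) ^ p := fun k => by
    have h := lintegral_gaussMode_pow k hp
    rw [← (measurePreserving_eval_infinitePi (gaussMode 2) k).map_eq,
      lintegral_map (by fun_prop) (measurable_pi_apply k)] at h
    simp_rw [mul_pow (wt (2 * s) k : ℝ≥0∞)]
    rw [lintegral_const_mul _ (by fun_prop), mul_left_comm]
    gcongr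
    exact h
  have hlim : ∀ φ : Freq d → ℂ, Tendsto (fun N => (∑ k ∈ Freq.ball d N,
      (wt (2 * s) k : ℝ≥0∞) * ‖φ k‖ₑ ^ 2) ^ p) atTop (𝓝 (sobSq s φ ^ p)) := fun φ => by
    refine ENNReal.Tendsto.pow ?_
    exact ENNReal.summable.hasSum.comp (tendsto_atTop_finset_of_monotone
      (fun N M h => ball_mono h) fun k => (eventually_mem_ball k).exists)
  calc ∫⁻ φ, sobSq s φ ^ p ∂gaussSeq d 2
      = ∫⁻ φ, liminf (fun N => (∑ k ∈ Freq.ball d N,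
          (wt (2 * s) k : ℝ≥0∞) * ‖φ k‖ₑ ^ 2) ^ p) atTop ∂gaussSeq d 2 :=
        lintegral_congr fun φ => (hlim φ).liminf_eq.symm
    _ ≤ liminf (fun N => ∫⁻ φ, (∑ k ∈ Freq.ball d N,
          (wt (2 * s) k : ℝ≥0∞) * ‖φ k‖ₑ ^ 2) ^ p ∂gaussSeq d 2) atTop :=
        lintegral_liminf_le fun N => by fun_prop
    _ ≤ _ := by
        refine liminf_le_of_le (by isBoundedDefault) fun b hb => ?_
        obtain ⟨N, hN⟩ := hb.exists
        refine hN.trans ((lintegral_sum_pow_le _ (fun k => by fun_prop) hp hmode).trans ?_)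
        gcongr
        exact ENNReal.sum_le_tsum _

/-! ### Dimension one -/

theorem sobSq_mono {s t : ℝ} (h : s ≤ t) (φ : Freq d → ℂ) : sobSq s φ ≤ sobSq t φ :=
  ENNReal.tsum_le_tsum fun k => by
    gcongr
    exact wt_mono (by linarith) k

theorem sobSq_add_lt_top {s : ℝ} {φ ψ : Freq d → ℂ} (hφ : sobSq s φ < ∞) (hψ : sobSq s ψ < ∞) :
    sobSq s (φ + ψ) < ∞ := by
  rw [← memSob_iff_sobSq] at *
  exact (sobSubmodule d s).add_mem hφ hψ

theorem sobSq_add_three_le (s : ℝ) (x y z : Freq d → ℂ) :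
    sobSq s (x + y + z) ≤ 3 * (sobSq s x + sobSq s y + sobSq s z) := by
  simp only [sobSq]
  rw [← ENNReal.tsum_add, ← ENNReal.tsum_add, ← ENNReal.tsum_mul_left]
  refine ENNReal.tsum_le_tsum fun k => ?_
  have h : ‖x k + y k + z k‖ₑ ^ 2 ≤ 3 * (‖x k‖ₑ ^ 2 + ‖y k‖ₑ ^ 2 + ‖z k‖ₑ ^ 2) := by
    have h1 : ‖x k + y k + z k‖ ^ 2 ≤ 3 * (‖x k‖ ^ 2 + ‖y k‖ ^ 2 + ‖z k‖ ^ 2) := by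
      have h2 := norm_add₃_le (a := x k) (b := y k) (c := z k)
      have h3 := pow_le_pow_left₀ (norm_nonneg _) h2 2
      nlinarith [sq_nonneg (‖x k‖ - ‖y k‖), sq_nonneg (‖x k‖ - ‖z k‖), sq_nonneg (‖y k‖ - ‖z k‖)]
    have h4 := ENNReal.ofReal_le_ofReal h1
    rw [ENNReal.ofReal_mul (by norm_num), ENNReal.ofReal_add (by positivity) (by positivity),
      ENNReal.ofReal_add (by positivity) (by positivity)] at h4
    simpa [ENNReal.ofReal_pow, ofReal_norm] using h4
  calc (wt (2 * s) k : ℝ≥0∞) * ‖(x + y + z) k‖ₑ ^ 2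
      ≤ wt (2 * s) k * (3 * (‖x k‖ₑ ^ 2 + ‖y k‖ₑ ^ 2 + ‖z k‖ₑ ^ 2)) := by
        gcongr
        exact h
    _ = _ := by ring

theorem measurable_ext0 {Ω : Type*} [MeasurableSpace Ω] {u : Ω → Freq d → ℂ} (hu : Measurable u)
    (n : Fin d → ℤ) : Measurable fun ω => ext0 (u ω) n := by
  by_cases h : n = 0
  · simp [ext0, h]
  · simp only [ext0, ne_eq, h, not_false_eq_true, dif_pos]
    exact (measurable_pi_apply _).comp hu

theorem measurable_tri {Ω : Type*} [MeasurableSpace Ω] {u v w : Ω → Freq d → ℂ}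
    (hu : Measurable u) (hv : Measurable v) (hw : Measurable w) (k : Freq d) :
    Measurable fun ω => tri (u ω) (v ω) (w ω) k := by
  unfold tri
  refine Measurable.tsum fun x => ?_
  exact ((measurable_ext0 hu _).mul (measurable_ext0 hv _)).mul
    (Complex.continuous_conj.measurable.comp (measurable_ext0 hw _))

section DimOne

variable {β : ℝ}

theorem triSummable_of_dim_one {φ v : Freq 1 → ℂ} (hφ : sobSq (2 / 5) φ < ∞)
    (hv : sobSq (2 / 5) v < ∞) : TriSummable φ v := fun k =>
  ⟨(triOK_of_dim_one le_rfl hφ hφ hφ).summable k, (triOK_of_dim_one le_rfl hv hφ hφ).summable k,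
    (triOK_of_dim_one le_rfl hφ hv hφ).summable k, (triOK_of_dim_one le_rfl hφ hφ hv).summable k,
    (triOK_of_dim_one le_rfl hφ hv hv).summable k, (triOK_of_dim_one le_rfl hv hφ hv).summable k,
    (triOK_of_dim_one le_rfl hv hv hφ).summable k, (triOK_of_dim_one le_rfl hv hv hv).summable k⟩

/-- The factor `9` is `3`, from squaring a sum of three terms, times the three equal trilinear
bounds. -/
theorem sobSq_triOne_le (hβ : β ≤ 0) (φ v : Freq 1 → ℂ) :
    sobSq β (triOne φ v) ≤ 9 * triConst * sobSq (2 / 5) φ ^ 2 * sobSq (2 / 5) v := by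
  refine (sobSq_add_three_le _ _ _ _).trans ?_
  have h := fun u v w : Freq 1 → ℂ => (sobSq_tri_le β u v w).trans (tsum_triAbs_sq_le hβ u v w)
  refine (mul_le_mul_right (add_le_add (add_le_add (h _ _ _) (h _ _ _)) (h _ _ _)) _).trans_eq ?_
  ring

theorem sobSq_coeff_le (v : Sob d 1) : sobSq (2 / 5) v.coeff ≤ ‖v‖ₑ ^ 2 := by
  rw [enorm_sq_eq_sobSq]
  exact sobSq_mono (by norm_num) _

theorem sobSq_coeff_lt (v : Sob d 1) : sobSq (2 / 5) v.coeff < ∞ :=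
  (sobSq_coeff_le v).trans_lt (by simp)

/-- The gradient of `B` in dimension one, at a point of `H^{2/5}`. -/
def gradOne (hβ : β ≤ 0) (φ : Freq 1 → ℂ) (hφ : sobSq (2 / 5) φ < ∞) : Sob 1 1 →L[ℝ] Sob 1 β :=
  have hK : 9 * triConst * sobSq (2 / 5) φ ^ 2 < ∞ :=
    ENNReal.mul_lt_top (ENNReal.mul_lt_top (by simp) triConst_lt_top) (ENNReal.pow_lt_top hφ)
  LinearMap.mkContinuous
    { toFun := fun v => Sob.mk (triOne φ v.coeff) ((memSob_iff_sobSq β _).2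
        ((sobSq_triOne_le hβ φ v.coeff).trans_lt (ENNReal.mul_lt_top hK (sobSq_coeff_lt v))))
      map_add' := fun v w => Sob.ext (triOne_add
        (triSummable_of_dim_one hφ (sobSq_coeff_lt v))
        (triSummable_of_dim_one hφ (sobSq_coeff_lt w)))
      map_smul' := fun c v => Sob.ext (triOne_smul φ v.coeff c) }
    (√(9 * triConst * sobSq (2 / 5) φ ^ 2).toReal) fun v => norm_le_of_enorm_sq_le hK (by
      rw [enorm_sq_eq_sobSq]
      exact (sobSq_triOne_le hβ φ v.coeff).trans (mul_le_mul_right (sobSq_coeff_le v) _))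

theorem coeff_gradOne (hβ : β ≤ 0) {φ : Freq 1 → ℂ} (hφ : sobSq (2 / 5) φ < ∞) (v : Sob 1 1) :
    (gradOne hβ φ hφ v).coeff = triOne φ v.coeff := rfl

theorem isGradientAt_gradOne (hβ : β ≤ 0) (hβ1 : β ≤ 1) {φ : Sob 1 β}
    (hφ : sobSq (2 / 5) φ.coeff < ∞) :
    IsGradientAt hβ1 (B 1 β) φ (gradOne hβ φ.coeff hφ) := by
  refine isGradientAt_of_expansion hβ1 fun v => ?_
  have hv := sobSq_coeff_lt v
  have hok : ∀ {u v w : Freq 1 → ℂ}, sobSq (2 / 5) u < ∞ → sobSq (2 / 5) v < ∞ →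
    sobSq (2 / 5) w < ∞ → MemSob β (tri u v w) := fun hu hv hw =>
      (triOK_of_dim_one hβ hu hv hw).memSob
  refine ⟨Sob.ofCoeff β (triTwo φ.coeff v.coeff), Sob.ofCoeff β (tri v.coeff v.coeff v.coeff),
    fun ε => ?_⟩
  have hεv : sobSq (2 / 5) (ε • v.coeff) < ∞ := sobSq_coeff_lt (ε • v)
  have hsum := sobSq_add_lt_top hφ hεv
  have htwo : MemSob β (triTwo φ.coeff v.coeff) :=
    (sobSubmodule 1 β).add_mem ((sobSubmodule 1 β).add_mem (hok hφ hv hv) (hok hv hφ hv))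
      (hok hv hv hφ)
  apply Sob.ext
  have hc : (φ + ε • Sob.incl hβ1 v).coeff = φ.coeff + ε • v.coeff := rfl
  simp only [B, Sob.coeff_add, Sob.coeff_smul, coeff_gradOne, cubic_eq]
  rw [Sob.coeff_ofCoeff (hok hφ hφ hφ), Sob.coeff_ofCoeff htwo, Sob.coeff_ofCoeff (hok hv hv hv),
    ← tri_expand (triSummable_of_dim_one hφ hv)]
  exact Sob.coeff_ofCoeff (hok hsum hsum hsum)

/-- A normalised `H^1` basis vector at frequency `j` has squared `H^{2/5}` norm `|j|^{-6/5}`, which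
is summable; the factor `2` counts the two real directions per frequency. -/
theorem tsum_gradOne_le (hβ : β ≤ 0) {φ : Freq 1 → ℂ} (hφ : sobSq (2 / 5) φ < ∞) :
    ∑' i, ‖gradOne hβ φ hφ (Sob.basis 1 1 i)‖ₑ ^ 2 ≤
      9 * triConst * (2 * ∑' k : Freq 1, (wt (-(6 / 5)) k : ℝ≥0∞)) * sobSq (2 / 5) φ ^ 2 := by
  have h : ∀ i, ‖gradOne hβ φ hφ (Sob.basis 1 1 i)‖ₑ ^ 2 ≤
      9 * triConst * sobSq (2 / 5) φ ^ 2 * wt (-(6 / 5)) i.1 := fun i => by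
    rw [enorm_sq_eq_sobSq, coeff_gradOne, basis_apply]
    refine (sobSq_triOne_le hβ φ _).trans_eq ?_
    rw [sobSq_basisVec]
    norm_num
  refine (ENNReal.tsum_le_tsum h).trans_eq ?_
  rw [ENNReal.tsum_mul_left, ENNReal.tsum_prod']
  simp only [tsum_fintype, Finset.sum_const, Finset.card_univ, Fintype.card_fin, nsmul_eq_mul]
  rw [ENNReal.tsum_mul_left]
  push_cast
  ring

theorem dimension_one (hβ : β < 0) (hβ1 : β ≤ 1) :
    IsProbabilityMeasure (gauss 1 2 β) ∧
      (∀ᵐ φ ∂gauss 1 2 β, ∀ v : Sob 1 1,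
        CubicDefined β (φ + Sob.incl hβ1 v : Sob 1 β).coeff) ∧
      ∃ DB : Sob 1 β → Sob 1 1 →L[ℝ] Sob 1 β,
        (∀ᵐ φ ∂gauss 1 2 β, IsGradientAt hβ1 (B 1 β) φ (DB φ)) ∧
        ∀ p : ℕ, 1 ≤ p → MemLpHS DB (2 * p) (gauss 1 2 β) := by
  classical
  have hmp := measurePreserving_coeff (d := 1) (β := β)
    (tsum_wt_lt_top_of_dim_one (by linarith))
  have hs : ∑' k : Freq 1, (wt (2 * (2 / 5) - 2) k : ℝ≥0∞) < ∞ :=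
    tsum_wt_lt_top_of_dim_one (by norm_num)
  have hae : ∀ᵐ φ ∂gauss 1 2 β, sobSq (2 / 5) φ.coeff < ∞ :=
    hmp.quasiMeasurePreserving.ae (ae_sobSq_lt_top hs)
  have hmeas : MeasurableSet {φ : Sob 1 β | sobSq (2 / 5) φ.coeff < ∞} :=
    measurableSet_lt ((measurable_sobSq _).comp measurable_coeff) measurable_const
  refine ⟨⟨by rw [← Set.preimage_univ (f := Sob.coeff),
    hmp.measure_preimage MeasurableSet.univ.nullMeasurableSet, measure_univ]⟩, ?_,
    -- Off `H^{2/5}`, a null set, the gradient is given the value `0`.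
    fun φ => if h : sobSq (2 / 5) φ.coeff < ∞ then
    gradOne hβ.le φ.coeff h else 0, ?_, fun p hp => ⟨fun v => ?_, ?_⟩⟩
  · filter_upwards [hae] with φ hφ v
    have h := sobSq_add_lt_top hφ (sobSq_coeff_lt v)
    exact (triOK_of_dim_one hβ.le h h h).cubicDefined
  · filter_upwards [hae] with φ hφ
    rw [dif_pos hφ]
    exact isGradientAt_gradOne hβ.le hβ1 hφ
  · refine (Sob.stronglyMeasurable_of_coeff fun k => ?_).aestronglyMeasurable
    have h1 : Measurable fun φ : Sob 1 β => if sobSq (2 / 5) φ.coeff < ∞ then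
        triOne φ.coeff v.coeff k else 0 := by
      refine Measurable.ite hmeas ?_ measurable_const
      have hφ : Measurable fun φ : Sob 1 β => φ.coeff := measurable_coeff
      exact ((measurable_tri measurable_const hφ hφ k).add
        (measurable_tri hφ measurable_const hφ k)).add (measurable_tri hφ hφ measurable_const k)
    convert h1 using 2 with φ
    beta_reduce
    by_cases h : sobSq (2 / 5) φ.coeff < ∞
    · rw [if_pos h, dif_pos h, coeff_gradOne]
    · rw [if_neg h, dif_neg h]
      rfl
  · have hle : ∀ φ : Sob 1 β, hsNorm (Sob.basis 1 1) (if h : sobSq (2 / 5) φ.coeff < ∞ then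
        gradOne hβ.le φ.coeff h else 0) ^ (2 * p) ≤
        (9 * triConst * (2 * ∑' k : Freq 1, (wt (-(6 / 5)) k : ℝ≥0∞))) ^ p *
          sobSq (2 / 5) φ.coeff ^ (2 * p) := fun φ => by
      rw [hsNorm_pow, pow_mul, ← mul_pow]
      gcongr
      split_ifs with h
      · exact tsum_gradOne_le hβ.le h
      · simp
    refine (lintegral_mono hle).trans_lt ?_
    have hK : (9 * triConst * (2 * ∑' k : Freq 1, (wt (-(6 / 5)) k : ℝ≥0∞))) ^ p < ∞ :=
      ENNReal.pow_lt_top (ENNReal.mul_lt_top (ENNReal.mul_lt_top (by simp) triConst_lt_top)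
        (ENNReal.mul_lt_top (by simp) (tsum_wt_lt_top_of_dim_one (by norm_num))))
    rw [lintegral_const_mul' _ _ hK.ne]
    refine ENNReal.mul_lt_top hK ?_
    rw [hmp.lintegral_comp (f := fun φ => sobSq (2 / 5) φ ^ (2 * p))
      ((measurable_sobSq _).pow_const _)]
    refine (lintegral_sobSq_pow (2 / 5) (by omega)).trans_lt ?_
    refine ENNReal.mul_lt_top (gaussMoment_lt_top _) (ENNReal.pow_lt_top ?_)
    have : ∀ k : Freq 1, (wt (2 * (2 / 5)) k : ℝ≥0∞) * modeVar k =
        2 * wt (2 * (2 / 5) - 2) k := fun k => by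
      rw [modeVar_eq, sub_eq_add_neg, ← wt_mul_wt]
      push_cast
      ring
    simp_rw [this, ENNReal.tsum_mul_left]
    exact ENNReal.mul_lt_top (by simp) hs

end DimOne

/-! ### Moments of Wick polynomials of the Fourier modes -/

section

open IsCircularGaussian

theorem lintegral_gaussSeq_restrict (F : Finset (Freq d)) {f : (F → ℂ) → ℝ≥0∞} (hf : Measurable f) :
    ∫⁻ φ, f (fun i : F => φ i.1) ∂gaussSeq d 2 =
      ∫⁻ φ, f φ ∂Measure.pi (fun i : F => gaussMode 2 i.1) :=
  lintegral_restrict_infinitePi (gaussMode 2) hf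

/-- The Wick product `:φ_a φ̄_l:`. -/
def wickConj (φ : Freq d → ℂ) (a l : Freq d) : ℂ :=
  φ a * conj (φ l) - if a = l then ((modeVar a : ℝ) : ℂ) else 0

/-- The Wick product `:φ_a φ_b φ̄_l:`. -/
def wickCubic (φ : Freq d → ℂ) (a b l : Freq d) : ℂ :=
  φ a * φ b * conj (φ l) - (if a = l then ((modeVar a : ℝ) : ℂ) else 0) * φ b
    - (if b = l then ((modeVar b : ℝ) : ℂ) else 0) * φ a

/-- A common constant for the moment bounds of Wick polynomials. -/
def wickConst (p : ℕ) : ℝ≥0∞ := 8 ^ p * 2 ^ (2 * p) * (1 + gaussMoment p) ^ 3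

theorem wickConst_lt_top (p : ℕ) : wickConst p < ∞ :=
  ENNReal.mul_lt_top (ENNReal.mul_lt_top (ENNReal.pow_lt_top (by simp))
    (ENNReal.pow_lt_top (by simp)))
    (ENNReal.pow_lt_top (ENNReal.add_lt_top.2 ⟨by simp, gaussMoment_lt_top p⟩))

theorem two_le_wickConst (p : ℕ) : 2 ^ (2 * p) * gaussMoment p ^ 2 ≤ wickConst p := by
  have h1 : (1 : ℝ≥0∞) ≤ 8 ^ p := one_le_pow₀ (by norm_num)
  have h2 : gaussMoment p ^ 2 ≤ (1 + gaussMoment p) ^ 3 :=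
    (pow_le_pow_left' le_add_self 2).trans (pow_le_pow_right₀ le_self_add (by norm_num))
  calc 2 ^ (2 * p) * gaussMoment p ^ 2 = 1 * 2 ^ (2 * p) * gaussMoment p ^ 2 := by rw [one_mul]
    _ ≤ _ := by
        unfold wickConst
        gcongr

theorem lintegral_wickCubic_pow (F : Finset (Freq d)) (w : Freq d → ℝ≥0)
    (y : Freq d → Freq d → Freq d → Freq d → ℂ) {p : ℕ} (hp : 1 ≤ p) :
    ∫⁻ φ, (∑ k ∈ F, w k * ‖∑ a ∈ F, ∑ b ∈ F, ∑ l ∈ F, wickCubic φ a b l * y k a b l‖ₑ ^ 2) ^ p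
        ∂gaussSeq d 2 ≤
      wickConst p * (∑ k ∈ F, ∑ a ∈ F, ∑ b ∈ F, ∑ l ∈ F,
        (w k : ℝ≥0∞) * modeVar a * modeVar b * modeVar l * ‖y k a b l‖ₑ ^ 2) ^ p := by
  have h := lintegral_wickThree_pow (ι := F) (γ := fun i : F => gaussMode 2 i.1)
    (c := fun i : F => modeVar i.1) (fun i => isCircularGaussian_gaussMode i.1) (κ := F)
    (fun k => w k.1) (fun k a b l => y k.1 a.1 b.1 l.1) hp
  rw [← lintegral_gaussSeq_restrict F (f := fun φ => (∑ k : F, (w k.1 : ℝ≥0∞) *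
    ‖∑ a : F, ∑ b : F, ∑ l : F, wickThree (fun i : F => modeVar i.1) φ a b l *
      y k.1 a.1 b.1 l.1‖ₑ ^ 2) ^ p) (by
        unfold wickThree
        fun_prop)] at h
  have hw : ∀ (φ : Freq d → ℂ) (a b l : F), wickThree (fun i : F => modeVar i.1)
      (fun i : F => φ i.1) a b l = wickCubic φ a.1 b.1 l.1 := fun φ a b l => by
    simp only [wickThree, wickCubic, Subtype.ext_iff]
  simp only [hw] at h
  simp only [← Finset.sum_coe_sort F]
  refine h.trans ?_
  unfold wickConst
  gcongr
  exact le_add_self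

theorem lintegral_wickPair_pow {τ : ℂ → ℂ} (hτ : IdOrConj τ) (F : Finset (Freq d))
    {q : (Freq d → ℂ) → Freq d → Freq d → ℂ}
    (hq : ∀ (φ : Freq d → ℂ) (a b : F), q φ a.1 b.1 =
      wickTwo (fun i : F => gaussMode 2 i.1) τ (fun i : F => φ i.1) a b)
    (w : Freq d → Freq d → ℝ≥0) (y : Freq d → Freq d → Freq d → Freq d → ℂ) {p : ℕ}
    (hp : 1 ≤ p) :
    ∫⁻ φ, (∑ k ∈ F, ∑ j ∈ F, w k j * ‖∑ a ∈ F, ∑ b ∈ F, q φ a b * y k j a b‖ₑ ^ 2) ^ p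
        ∂gaussSeq d 2 ≤
      wickConst p * (∑ k ∈ F, ∑ j ∈ F, ∑ a ∈ F, ∑ b ∈ F,
        (w k j : ℝ≥0∞) * modeVar a * modeVar b * ‖y k j a b‖ₑ ^ 2) ^ p := by
  have hτc := hτ.continuous
  have h := lintegral_wickTwo_pow (ι := F) (γ := fun i : F => gaussMode 2 i.1)
    (c := fun i : F => modeVar i.1) (fun i => isCircularGaussian_gaussMode i.1) hτ (κ := F × F)
    (fun k => w k.1.1 k.2.1) (fun k a b => y k.1.1 k.2.1 a.1 b.1) hp
  rw [← lintegral_gaussSeq_restrict F (f := fun φ => (∑ k : F × F, (w k.1.1 k.2.1 : ℝ≥0∞) *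
    ‖∑ a : F, ∑ b : F, wickTwo (fun i : F => gaussMode 2 i.1) τ φ a b *
      y k.1.1 k.2.1 a.1 b.1‖ₑ ^ 2) ^ p) (by
        unfold wickTwo
        fun_prop)] at h
  simp only [← hq, Fintype.sum_prod_type] at h
  simp only [← Finset.sum_coe_sort F]
  exact h.trans (mul_le_mul_left (two_le_wickConst p) _)

theorem lintegral_wickConj_pow (F : Finset (Freq d)) (w : Freq d → Freq d → ℝ≥0)
    (y : Freq d → Freq d → Freq d → Freq d → ℂ) {p : ℕ} (hp : 1 ≤ p) :
    ∫⁻ φ, (∑ k ∈ F, ∑ j ∈ F, w k j * ‖∑ a ∈ F, ∑ b ∈ F, wickConj φ a b * y k j a b‖ₑ ^ 2) ^ p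
        ∂gaussSeq d 2 ≤
      wickConst p * (∑ k ∈ F, ∑ j ∈ F, ∑ a ∈ F, ∑ b ∈ F,
        (w k j : ℝ≥0∞) * modeVar a * modeVar b * ‖y k j a b‖ₑ ^ 2) ^ p := by
  refine lintegral_wickPair_pow (Or.inr rfl) F (fun φ a b => ?_) w y hp
  rw [wickTwo, integral_mul_conj (c := fun i : F => modeVar i.1)
    fun i => isCircularGaussian_gaussMode i.1]
  simp only [wickConj, Subtype.ext_iff]

theorem lintegral_mul_pow (F : Finset (Freq d)) (w : Freq d → Freq d → ℝ≥0)
    (y : Freq d → Freq d → Freq d → Freq d → ℂ) {p : ℕ} (hp : 1 ≤ p) :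
    ∫⁻ φ, (∑ k ∈ F, ∑ j ∈ F, w k j * ‖∑ a ∈ F, ∑ b ∈ F, φ a * φ b * y k j a b‖ₑ ^ 2) ^ p
        ∂gaussSeq d 2 ≤
      wickConst p * (∑ k ∈ F, ∑ j ∈ F, ∑ a ∈ F, ∑ b ∈ F,
        (w k j : ℝ≥0∞) * modeVar a * modeVar b * ‖y k j a b‖ₑ ^ 2) ^ p := by
  refine lintegral_wickPair_pow (q := fun φ a b => φ a * φ b) (Or.inl rfl) F
    (fun φ a b => ?_) w y hp
  have h := IsCircularGaussian.integral_mul (γ := fun i : F => gaussMode 2 i.1)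
    (c := fun i : F => modeVar i.1) (fun i => isCircularGaussian_gaussMode i.1) a b
  rw [wickTwo]
  simp only [id, h, sub_zero]

end

/-! ### Tails -/

open Classical in
/-- The part of the sum `qsum` over the resonances which are not contained in the ball of radius
`N`. -/
def tail (d : ℕ) (β : ℝ) (N : ℕ) : ℝ≥0∞ :=
  ∑' (k : Freq d) (a : Freq d) (b : Freq d) (l : Freq d),
    if Res a b l k ∧ ¬ (a ∈ Freq.ball d N ∧ b ∈ Freq.ball d N ∧ l ∈ Freq.ball d N ∧
      k ∈ Freq.ball d N) then (wt (2 * β) k : ℝ≥0∞) * wt (-2) a * wt (-2) b * wt (-2) l else 0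

theorem tail_le (β : ℝ) (N : ℕ) : tail d β N ≤ qsum (d := d)
    (fun k => wt (2 * β) k) (fun a => wt (-2) a) (fun b => wt (-2) b) (fun l => wt (-2) l) := by
  refine ENNReal.tsum_le_tsum fun k => ENNReal.tsum_le_tsum fun a => ENNReal.tsum_le_tsum fun b =>
    ENNReal.tsum_le_tsum fun l => ?_
  split_ifs with h1 h2 h2
  · exact le_rfl
  · exact absurd h1.1 h2
  · exact zero_le
  · exact le_rfl

/-- Every fixed resonance eventually lies inside the ball, so dominated convergence for the counting
measure on quadruples applies. -/
theorem tendsto_tail {β : ℝ} (h : qsum (d := d) (fun k => wt (2 * β) k) (fun a => wt (-2) a)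
    (fun b => wt (-2) b) (fun l => wt (-2) l) < ∞) : Tendsto (tail d β) atTop (𝓝 0) := by
  classical
  let _ : MeasurableSpace (Freq d × Freq d × Freq d × Freq d) := ⊤
  have hp : ∀ G : Freq d → Freq d → Freq d → Freq d → ℝ≥0∞,
      ∑' (k) (a) (b) (l), G k a b l =
        ∫⁻ x : Freq d × Freq d × Freq d × Freq d, G x.1 x.2.1 x.2.2.1 x.2.2.2
          ∂Measure.count := fun G => by
    rw [lintegral_count, ENNReal.tsum_prod']
    refine tsum_congr fun k => ?_
    rw [ENNReal.tsum_prod']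
    refine tsum_congr fun a => ?_
    rw [ENNReal.tsum_prod']
  simp only [qsum] at h
  rw [hp] at h
  have ht : tail d β = fun N => ∫⁻ x : Freq d × Freq d × Freq d × Freq d,
      (if Res x.2.1 x.2.2.1 x.2.2.2 x.1 ∧ ¬ (x.2.1 ∈ Freq.ball d N ∧ x.2.2.1 ∈ Freq.ball d N ∧
        x.2.2.2 ∈ Freq.ball d N ∧ x.1 ∈ Freq.ball d N) then
        (wt (2 * β) x.1 : ℝ≥0∞) * wt (-2) x.2.1 * wt (-2) x.2.2.1 * wt (-2) x.2.2.2 else 0)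
        ∂Measure.count := by
    ext N
    unfold tail
    rw [hp]
  rw [ht]
  have h0 : ∫⁻ _ : Freq d × Freq d × Freq d × Freq d, (0 : ℝ≥0∞) ∂Measure.count = 0 := by simp
  -- Rewrites the limit `0` as the integral of the zero function, as dominated convergence expects.
  refine (congrArg (fun z => Tendsto _ atTop (𝓝 z)) h0).mp ?_
  refine tendsto_lintegral_of_dominated_convergence _ (fun N => measurable_from_top)
    (fun N => ae_of_all _ fun x => ?_) h.ne (ae_of_all _ fun x => ?_)
  · beta_reduce
    split_ifs with h1 h2 h2
    · exact le_rfl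
    · exact absurd h1.1 h2
    · exact zero_le
    · exact le_rfl
  · refine tendsto_const_nhds.congr' ?_
    filter_upwards [eventually_mem_ball x.1, eventually_mem_ball x.2.1,
      eventually_mem_ball x.2.2.1, eventually_mem_ball x.2.2.2] with N h1 h2 h3 h4
    rw [if_neg]
    exact fun h => h.2 ⟨h2, h3, h4, h1⟩

/-! ### The truncated fields as finite sums -/

/-- The indicator of the resonances contained in the ball of radius `N`. -/
def chi (N : ℕ) (a b l k : Freq d) : ℂ :=
  if Res a b l k ∧ a ∈ Freq.ball d N ∧ b ∈ Freq.ball d N ∧ l ∈ Freq.ball d N ∧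
    k ∈ Freq.ball d N then 1 else 0

theorem chi_swap (N : ℕ) (a b l k : Freq d) : chi N a b l k = chi N b a l k := by
  unfold chi
  congr 1
  rw [Res.swap]
  exact propext ⟨fun h => ⟨h.1, h.2.2.1, h.2.1, h.2.2.2⟩, fun h => ⟨h.1, h.2.2.1, h.2.1, h.2.2.2⟩⟩

theorem chi_eq_zero {N : ℕ} {a b l k : Freq d} (h : ¬ (a ∈ Freq.ball d N ∧ b ∈ Freq.ball d N ∧
    l ∈ Freq.ball d N ∧ k ∈ Freq.ball d N)) : chi N a b l k = 0 :=
  if_neg fun h' => h h'.2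

/-- The contraction `a = l` forces `b = k`. Contracted terms are therefore multiples of the input
mode itself, which is why a scalar counterterm suffices. -/
theorem chi_first_eq_third (N : ℕ) (a b k : Freq d) :
    chi N a b a k = if b = k then (if a ∈ Freq.ball d N then 1 else 0) *
      (if k ∈ Freq.ball d N then 1 else 0) else 0 := by
  have hres : Res a b a k ↔ b = k := by
    rw [Res, add_sub_cancel_left, Subtype.ext_iff]
  simp only [chi, hres]
  by_cases hb : b = k
  · subst hb
    by_cases h1 : a ∈ Freq.ball d N <;> by_cases h2 : b ∈ Freq.ball d N <;> simp [h1, h2]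
  · simp [hb]

/-- The index set `F` may exceed the ball, so that two truncations `N ≤ M` can be written as sums
over the same set with different kernels. -/
theorem proj_tri_proj {N : ℕ} {F : Finset (Freq d)} (hF : Freq.ball d N ⊆ F) (u v w : Freq d → ℂ)
    (k : Freq d) : proj N (tri (proj N u) (proj N v) (proj N w)) k =
      ∑ a ∈ F, ∑ b ∈ F, ∑ l ∈ F, u a * v b * conj (w l) * chi N a b l k := by
  by_cases hk : k ∈ Freq.ball d N
  · rw [proj_apply_of_mem hk, tri_eq_tsum, tsum_eq_sum (s := F ×ˢ F ×ˢ F)]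
    · rw [Finset.sum_product]
      refine Finset.sum_congr rfl fun a _ => ?_
      rw [Finset.sum_product]
      refine Finset.sum_congr rfl fun b _ => Finset.sum_congr rfl fun l _ => ?_
      simp only [proj, chi, hk, and_true]
      by_cases h1 : a ∈ Freq.ball d N <;> by_cases h2 : b ∈ Freq.ball d N <;>
        by_cases h3 : l ∈ Freq.ball d N <;> simp [h1, h2, h3]
    · intro y hy
      have h : y.1 ∉ Freq.ball d N ∨ y.2.1 ∉ Freq.ball d N ∨ y.2.2 ∉ Freq.ball d N := by
        by_contra hc
        push Not at hc
        exact hy (by simp [hF hc.1, hF hc.2.1, hF hc.2.2])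
      rcases h with h | h | h <;> simp [proj_apply_of_notMem h]
  · rw [proj_apply_of_notMem hk]
    symm
    refine Finset.sum_eq_zero fun a _ => Finset.sum_eq_zero fun b _ =>
      Finset.sum_eq_zero fun l _ => ?_
    rw [chi_eq_zero fun h => hk h.2.2.2, mul_zero]

theorem coeff_truncTri {N : ℕ} {F : Finset (Freq d)} (hF : Freq.ball d N ⊆ F) (β : ℝ)
    (u v w : Freq d → ℂ) (k : Freq d) : (truncTri N β u v w).coeff k =
      ∑ a ∈ F, ∑ b ∈ F, ∑ l ∈ F, u a * v b * conj (w l) * chi N a b l k :=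
  proj_tri_proj hF u v w k

theorem tsum_enorm_proj_lt_top (N : ℕ) (u : Freq d → ℂ) : ∑' a, ‖proj N u a‖ₑ < ∞ := by
  rw [tsum_eq_sum (s := Freq.ball d N) fun a ha => by rw [proj_apply_of_notMem ha, enorm_zero]]
  exact ENNReal.sum_lt_top.2 fun a _ => enorm_lt_top

theorem summable_triTerm_proj (N : ℕ) (u v w : Freq d → ℂ) (k : Freq d) :
    Summable (triTerm (proj N u) (proj N v) (proj N w) k) := by
  refine summable_triTerm_of_lt_top ?_
  rw [triAbs_eq_tsum]
  refine lt_of_le_of_lt (ENNReal.tsum_le_tsum fun a => ENNReal.tsum_le_tsum fun b =>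
    ENNReal.tsum_le_tsum fun l => ?_) ((tsum_tsum_tsum_mul (fun a => ‖proj N u a‖ₑ)
      (fun b => ‖proj N v b‖ₑ) (fun l => ‖proj N w l‖ₑ)).trans_lt
        (ENNReal.mul_lt_top (ENNReal.mul_lt_top (tsum_enorm_proj_lt_top N u)
          (tsum_enorm_proj_lt_top N v)) (tsum_enorm_proj_lt_top N w)))
  split_ifs
  · exact le_rfl
  · exact zero_le

theorem triSummable_proj (N : ℕ) (φ v : Freq d → ℂ) : TriSummable (proj N φ) (proj N v) :=
  fun k => by refine ⟨?_, ?_, ?_, ?_, ?_, ?_, ?_, ?_⟩ <;> exact summable_triTerm_proj N _ _ _ k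

theorem proj_add (N : ℕ) (u v : Freq d → ℂ) : proj N (u + v) = proj N u + proj N v := by
  ext k
  by_cases h : k ∈ Freq.ball d N <;> simp [proj, h]

theorem proj_smul (N : ℕ) (c : ℝ) (u : Freq d → ℂ) : proj N (c • u) = c • proj N u := by
  ext k
  by_cases h : k ∈ Freq.ball d N <;> simp [proj, h]

theorem Sob.trunc_add (s : ℝ) (N : ℕ) (u v : Freq d → ℂ) :
    Sob.trunc s N (u + v) = Sob.trunc s N u + Sob.trunc s N v :=
  Sob.ext (proj_add N u v)

theorem Sob.trunc_smul (s : ℝ) (N : ℕ) (c : ℝ) (u : Freq d → ℂ) :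
    Sob.trunc s N (c • u) = c • Sob.trunc s N u :=
  Sob.ext (proj_smul N c u)

/-! ### Gradients of the truncated fields -/

theorem wickB_eq (N : ℕ) (β : ℝ) (φ : Sob d β) : wickB d N β φ =
    Sob.trunc β N (tri (proj N φ.coeff) (proj N φ.coeff) (proj N φ.coeff)) -
      renorm d N • Sob.trunc β N φ.coeff := rfl

theorem trunc_triOne (N : ℕ) (β : ℝ) (φ v : Freq d → ℂ) :
    Sob.trunc β N (triOne (proj N φ) (proj N v)) =
      truncTri N β v φ φ + truncTri N β φ v φ + truncTri N β φ φ v := by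
  rw [triOne, Sob.trunc_add, Sob.trunc_add]
  rfl

theorem trunc_triTwo (N : ℕ) (β : ℝ) (φ v : Freq d → ℂ) :
    Sob.trunc β N (triTwo (proj N φ) (proj N v)) =
      truncTri N β φ v v + truncTri N β v φ v + truncTri N β v v φ := by
  rw [triTwo, Sob.trunc_add, Sob.trunc_add]
  rfl

theorem truncTri_eq_sum (N : ℕ) (β : ℝ) (u v w : Freq d → ℂ) : truncTri N β u v w =
    ∑ k ∈ Freq.ball d N, Sob.singleL d β k (∑ a ∈ Freq.ball d N, ∑ b ∈ Freq.ball d N,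
      ∑ l ∈ Freq.ball d N, u a * v b * conj (w l) * chi N a b l k) := by
  rw [truncTri, Sob.trunc_eq_sum]
  refine Finset.sum_congr rfl fun k hk => ?_
  rw [← proj_tri_proj subset_rfl, proj_apply_of_mem hk]

theorem continuous_truncTri {X : Type*} [TopologicalSpace X] (N : ℕ) (β : ℝ)
    {u v w : X → Freq d → ℂ} (hu : ∀ a, Continuous fun x => u x a)
    (hv : ∀ a, Continuous fun x => v x a) (hw : ∀ a, Continuous fun x => w x a) :
    Continuous fun x => truncTri N β (u x) (v x) (w x) := by
  simp_rw [truncTri_eq_sum]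
  fun_prop

theorem continuous_coeff_apply {s : ℝ} (k : Freq d) : Continuous fun v : Sob d s => v.coeff k :=
  (Sob.coeffL d s k).continuous

theorem continuous_trunc {X : Type*} [TopologicalSpace X] (N : ℕ) (β : ℝ)
    {u : X → Freq d → ℂ} (hu : ∀ a, Continuous fun x => u x a) :
    Continuous fun x => Sob.trunc β N (u x) := by
  simp_rw [Sob.trunc_eq_sum]
  fun_prop

/-- The gradient of the truncated renormalised field. -/
def gradTwo (N : ℕ) (β : ℝ) (φ : Freq d → ℂ) : Sob d 1 →L[ℝ] Sob d β where
  toFun v := Sob.trunc β N (triOne (proj N φ) (proj N v.coeff)) -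
    renorm d N • Sob.trunc β N v.coeff
  map_add' v w := by
    rw [Sob.coeff_add, proj_add, triOne_add (triSummable_proj N φ _) (triSummable_proj N φ _),
      Sob.trunc_add, Sob.trunc_add]
    module
  map_smul' c v := by
    rw [Sob.coeff_smul, proj_smul, triOne_smul, Sob.trunc_smul, Sob.trunc_smul, RingHom.id_apply]
    module
  cont := by
    simp_rw [trunc_triOne]
    have h := fun a => continuous_coeff_apply (s := 1) (d := d) a
    have h' := fun a => (continuous_const : Continuous fun _ : Sob d 1 => φ a)
    exact (((continuous_truncTri N β h h' h').add (continuous_truncTri N β h' h h')).add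
      (continuous_truncTri N β h' h' h)).sub ((continuous_trunc N β h).fun_const_smul _)

theorem gradTwo_apply (N : ℕ) (β : ℝ) (φ : Freq d → ℂ) (v : Sob d 1) : gradTwo N β φ v =
    truncTri N β v.coeff φ φ + truncTri N β φ v.coeff φ + truncTri N β φ φ v.coeff -
      renorm d N • Sob.trunc β N v.coeff := by
  rw [← trunc_triOne]
  rfl

/-- The Taylor expansion of the truncated field. -/
theorem wickB_add_smul {β : ℝ} (h : β ≤ 1) (N : ℕ) (φ : Sob d β) (v : Sob d 1) (ε : ℝ) :
    wickB d N β (φ + ε • Sob.incl h v) = wickB d N β φ + ε • gradTwo N β φ.coeff v +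
      ε ^ 2 • (truncTri N β φ.coeff v.coeff v.coeff + truncTri N β v.coeff φ.coeff v.coeff +
        truncTri N β v.coeff v.coeff φ.coeff) +
      ε ^ 3 • truncTri N β v.coeff v.coeff v.coeff := by
  have hc : (φ + ε • Sob.incl h v).coeff = φ.coeff + ε • v.coeff := rfl
  have hg : gradTwo N β φ.coeff v = Sob.trunc β N (triOne (proj N φ.coeff) (proj N v.coeff)) -
    renorm d N • Sob.trunc β N v.coeff := rfl
  rw [wickB_eq, hc, proj_add, proj_smul, tri_expand (triSummable_proj N _ _), Sob.trunc_add,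
    Sob.trunc_add, Sob.trunc_add, Sob.trunc_add, Sob.trunc_smul, Sob.trunc_smul, Sob.trunc_smul,
    Sob.trunc_smul, trunc_triTwo, wickB_eq, hg]
  simp only [truncTri]
  module

theorem isGradientAt_gradTwo {β : ℝ} (h : β ≤ 1) (N : ℕ) (φ : Sob d β) :
    IsGradientAt h (wickB d N β) φ (gradTwo N β φ.coeff) :=
  isGradientAt_of_expansion h fun v => ⟨_, _, fun ε => wickB_add_smul h N φ v ε⟩

/-! ### Wick ordering -/

/-- Since `E|φ_a|² = 2|a|^{-2}`, the constant is two copies of the variance sum, one for each of the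
contractions `a = l` and `b = l`. -/
theorem renorm_eq (N : ℕ) : ((renorm d N : ℝ) : ℂ) =
    2 * ∑ a ∈ Freq.ball d N, ((modeVar a : ℝ) : ℂ) := by
  rw [renorm]
  simp_rw [coe_modeVar]
  push_cast
  rw [Finset.mul_sum, Finset.mul_sum]
  refine Finset.sum_congr rfl fun a _ => ?_
  ring

theorem sum_modeVar_chi {N : ℕ} {F : Finset (Freq d)} (hF : Freq.ball d N ⊆ F) (j k : Freq d) :
    ∑ a ∈ F, ∑ l ∈ F, (if a = l then ((modeVar a : ℝ) : ℂ) else 0) * chi N a j l k =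
      if j = k then (if k ∈ Freq.ball d N then (renorm d N : ℂ) / 2 else 0) else 0 := by
  have h1 : ∀ a ∈ F, ∑ l ∈ F, (if a = l then ((modeVar a : ℝ) : ℂ) else 0) * chi N a j l k =
      if j = k then (if k ∈ Freq.ball d N then
        (if a ∈ Freq.ball d N then ((modeVar a : ℝ) : ℂ) else 0) else 0) else 0 := fun a ha => by
    simp only [ite_mul, zero_mul]
    rw [Finset.sum_ite_eq, if_pos ha, chi_first_eq_third]
    split_ifs <;> simp
  rw [Finset.sum_congr rfl h1]
  split_ifs
  · rw [← Finset.sum_filter, renorm_eq, Finset.filter_mem_eq_inter, Finset.inter_eq_right.2 hF]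
    ring
  · simp
  · simp

theorem coeff_trunc_of_subset {N : ℕ} {F : Finset (Freq d)} (hF : Freq.ball d N ⊆ F) (s : ℝ)
    (v : Freq d → ℂ) (c : ℂ) (k : Freq d) :
    ∑ b ∈ F, v b * (if b = k then (if k ∈ Freq.ball d N then c else 0) else 0) =
      c * (Sob.trunc s N v).coeff k := by
  simp only [mul_ite, mul_zero]
  rw [Finset.sum_ite_eq', Sob.trunc, Sob.coeff_mk]
  by_cases hk : k ∈ Freq.ball d N
  · rw [if_pos (hF hk), if_pos hk, proj_apply_of_mem hk, mul_comm]
  · simp [hk, proj_apply_of_notMem hk]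

/-- The coefficients of the truncated renormalised field are Wick polynomials. -/
theorem coeff_wickB {N : ℕ} {F : Finset (Freq d)} (hF : Freq.ball d N ⊆ F) (β : ℝ) (φ : Sob d β)
    (k : Freq d) : (wickB d N β φ).coeff k =
      ∑ a ∈ F, ∑ b ∈ F, ∑ l ∈ F, wickCubic φ.coeff a b l * chi N a b l k := by
  have hr : (wickB d N β φ).coeff k = (truncTri N β φ.coeff φ.coeff φ.coeff).coeff k -
    renorm d N * (Sob.trunc β N φ.coeff).coeff k := rfl
  have h2 : ∑ a ∈ F, ∑ b ∈ F, ∑ l ∈ F, (if a = l then ((modeVar a : ℝ) : ℂ) else 0) * φ.coeff b *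
      chi N a b l k = (renorm d N : ℂ) / 2 * (Sob.trunc β N φ.coeff).coeff k := by
    rw [← coeff_trunc_of_subset hF, Finset.sum_comm]
    refine Finset.sum_congr rfl fun b _ => ?_
    rw [← sum_modeVar_chi hF b k, Finset.mul_sum]
    refine Finset.sum_congr rfl fun a _ => ?_
    rw [Finset.mul_sum]
    refine Finset.sum_congr rfl fun l _ => ?_
    ring
  have h3 : ∑ a ∈ F, ∑ b ∈ F, ∑ l ∈ F, (if b = l then ((modeVar b : ℝ) : ℂ) else 0) * φ.coeff a *
      chi N a b l k = (renorm d N : ℂ) / 2 * (Sob.trunc β N φ.coeff).coeff k := by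
    rw [← h2, Finset.sum_comm]
    simp_rw [chi_swap N _ _ _ k]
  simp only [wickCubic, sub_mul, Finset.sum_sub_distrib]
  rw [h2, h3, hr, coeff_truncTri hF]
  ring

/-- The two unconjugated slots contribute equally, and each absorbs half of the counterterm to
become a Wick product. The conjugated slot gives `φ_a φ_b`, which needs no correction because `E φ_a
φ_b = 0`. -/
theorem coeff_gradTwo_single {N : ℕ} {F : Finset (Freq d)} (hF : Freq.ball d N ⊆ F) (β : ℝ)
    (φ : Freq d → ℂ) {v : Sob d 1} {j : Freq d} {z : ℂ}
    (hv : ∀ a, v.coeff a = if a = j then z else 0) (k : Freq d) :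
    (gradTwo N β φ v).coeff k = 2 * z * ∑ a ∈ F, ∑ l ∈ F, wickConj φ a l * chi N a j l k +
      conj z * ∑ a ∈ F, ∑ b ∈ F, φ a * φ b * chi N a b j k := by
  have hr : (gradTwo N β φ v).coeff k = (truncTri N β v.coeff φ φ).coeff k +
      (truncTri N β φ v.coeff φ).coeff k + (truncTri N β φ φ v.coeff).coeff k -
      renorm d N * (Sob.trunc β N v.coeff).coeff k := by
    rw [gradTwo_apply]
    rfl
  rw [hr, coeff_truncTri hF, coeff_truncTri hF, coeff_truncTri hF]
  have ht : (renorm d N : ℂ) / 2 * (Sob.trunc β N v.coeff).coeff k =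
      z * ∑ a ∈ F, ∑ l ∈ F, (if a = l then ((modeVar a : ℝ) : ℂ) else 0) * chi N a j l k := by
    rw [sum_modeVar_chi hF, Sob.trunc, Sob.coeff_mk, proj, hv]
    by_cases hjk : j = k
    · subst hjk
      by_cases hk : j ∈ Freq.ball d N <;> simp [hk, mul_comm]
    · simp [hjk, Ne.symm hjk]
  by_cases hj : j ∈ F
  · have e1 : ∑ a ∈ F, ∑ b ∈ F, ∑ l ∈ F, φ a * v.coeff b * conj (φ l) * chi N a b l k =
        z * ∑ a ∈ F, ∑ l ∈ F, φ a * conj (φ l) * chi N a j l k := by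
      rw [Finset.mul_sum]
      refine Finset.sum_congr rfl fun a _ => ?_
      rw [Finset.sum_eq_single j (fun b _ hb => by simp [hv, hb]) (fun h => absurd hj h),
        Finset.mul_sum]
      refine Finset.sum_congr rfl fun l _ => ?_
      rw [hv, if_pos rfl]
      ring
    have e2 : ∑ a ∈ F, ∑ b ∈ F, ∑ l ∈ F, v.coeff a * φ b * conj (φ l) * chi N a b l k =
        ∑ a ∈ F, ∑ b ∈ F, ∑ l ∈ F, φ a * v.coeff b * conj (φ l) * chi N a b l k := by
      rw [Finset.sum_comm]
      refine Finset.sum_congr rfl fun a _ => Finset.sum_congr rfl fun b _ =>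
        Finset.sum_congr rfl fun l _ => ?_
      rw [chi_swap]
      ring
    have e3 : ∑ a ∈ F, ∑ b ∈ F, ∑ l ∈ F, φ a * φ b * conj (v.coeff l) * chi N a b l k =
        conj z * ∑ a ∈ F, ∑ b ∈ F, φ a * φ b * chi N a b j k := by
      rw [Finset.mul_sum]
      refine Finset.sum_congr rfl fun a _ => ?_
      rw [Finset.mul_sum]
      refine Finset.sum_congr rfl fun b _ => ?_
      rw [Finset.sum_eq_single j (fun l _ hl => by simp [hv, hl]) (fun h => absurd hj h), hv,
        if_pos rfl]
      ring
    rw [e2, e1, e3]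
    simp only [wickConj, sub_mul, Finset.sum_sub_distrib]
    linear_combination (-2 : ℂ) * ht
  -- A direction outside `F`, hence outside the ball, is invisible to the truncation, and both sides
  -- vanish.
  · have hjN : j ∉ Freq.ball d N := fun h => hj (hF h)
    have hvF : ∀ a ∈ F, v.coeff a = 0 := fun a ha => by
      rw [hv, if_neg (fun h : a = j => hj (h ▸ ha))]
    have hz : (Sob.trunc β N v.coeff).coeff k = 0 := by
      rw [Sob.trunc, Sob.coeff_mk]
      by_cases hk : k ∈ Freq.ball d N
      · rw [proj_apply_of_mem hk, hvF k (hF hk)]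
      · rw [proj_apply_of_notMem hk]
    have hc1 : ∀ a l, chi N a j l k = 0 := fun a l => chi_eq_zero fun h => hjN h.2.1
    have hc2 : ∀ a b, chi N a b j k = 0 := fun a b => chi_eq_zero fun h => hjN h.2.2.1
    simp only [hz, hc1, hc2, mul_zero, Finset.sum_const_zero, add_zero, sub_zero]
    rw [Finset.sum_eq_zero, Finset.sum_eq_zero, Finset.sum_eq_zero]
    · simp
    · exact fun a _ => Finset.sum_eq_zero fun b _ => Finset.sum_eq_zero fun l hl => by
        simp [hvF l hl]
    · exact fun a _ => Finset.sum_eq_zero fun b hb => Finset.sum_eq_zero fun l _ => by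
        simp [hvF b hb]
    · exact fun a ha => Finset.sum_eq_zero fun b _ => Finset.sum_eq_zero fun l _ => by
        simp [hvF a ha]

/-! ### Moments of the differences of the truncated fields -/

/-- Two truncations agree on resonances inside the smaller ball, so their difference is an indicator
supported on the tail. -/
theorem enorm_chi_sub_sq_le {N M : ℕ} (h : N ≤ M) (a b l k : Freq d) :
    ‖chi N a b l k - chi M a b l k‖ₑ ^ 2 ≤ if Res a b l k ∧ ¬ (a ∈ Freq.ball d N ∧
      b ∈ Freq.ball d N ∧ l ∈ Freq.ball d N ∧ k ∈ Freq.ball d N) then 1 else 0 := by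
  by_cases hr : Res a b l k
  · by_cases hb : a ∈ Freq.ball d N ∧ b ∈ Freq.ball d N ∧ l ∈ Freq.ball d N ∧ k ∈ Freq.ball d N
    · have hM : a ∈ Freq.ball d M ∧ b ∈ Freq.ball d M ∧ l ∈ Freq.ball d M ∧ k ∈ Freq.ball d M :=
        ⟨ball_mono h hb.1, ball_mono h hb.2.1, ball_mono h hb.2.2.1, ball_mono h hb.2.2.2⟩
      simp [chi, hr, hb, hM]
    · rw [if_pos ⟨hr, hb⟩, chi_eq_zero hb, zero_sub, enorm_neg, chi]
      split_ifs <;> simp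
  · simp [chi, hr]

theorem sum_le_tail {β : ℝ} {N : ℕ} (F : Finset (Freq d))
    {f : Freq d → Freq d → Freq d → Freq d → ℝ≥0∞} (c : ℝ≥0∞)
    (hf : ∀ k a b l, f k a b l ≤ c * ((wt (2 * β) k : ℝ≥0∞) * wt (-2) a * wt (-2) b * wt (-2) l *
      if Res a b l k ∧ ¬ (a ∈ Freq.ball d N ∧ b ∈ Freq.ball d N ∧ l ∈ Freq.ball d N ∧
        k ∈ Freq.ball d N) then 1 else 0)) :
    ∑ k ∈ F, ∑ a ∈ F, ∑ b ∈ F, ∑ l ∈ F, f k a b l ≤ c * tail d β N := by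
  unfold tail
  simp only [← ENNReal.tsum_mul_left]
  refine le_trans (Finset.sum_le_sum fun k _ => ?_) (ENNReal.sum_le_tsum F)
  refine le_trans (Finset.sum_le_sum fun a _ => ?_) (ENNReal.sum_le_tsum F)
  refine le_trans (Finset.sum_le_sum fun b _ => ?_) (ENNReal.sum_le_tsum F)
  refine le_trans (Finset.sum_le_sum fun l _ => ?_) (ENNReal.sum_le_tsum F)
  refine (hf k a b l).trans_eq ?_
  congr 1
  split_ifs <;> simp

theorem enorm_sq_eq_sum {s : ℝ} {F : Finset (Freq d)} (φ : Sob d s)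
    (h : ∀ k ∉ F, φ.coeff k = 0) :
    ‖φ‖ₑ ^ 2 = ∑ k ∈ F, (wt (2 * s) k : ℝ≥0∞) * ‖φ.coeff k‖ₑ ^ 2 := by
  rw [enorm_sq_eq_sobSq, sobSq, tsum_eq_sum (s := F)]
  intro k hk
  simp [h k hk]

theorem coeff_wickB_sub {N M : ℕ} (h : N ≤ M) (β : ℝ) (φ : Sob d β) (k : Freq d) :
    (wickB d N β φ - wickB d M β φ).coeff k = ∑ a ∈ Freq.ball d M, ∑ b ∈ Freq.ball d M,
      ∑ l ∈ Freq.ball d M, wickCubic φ.coeff a b l * (chi N a b l k - chi M a b l k) := by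
  rw [Sob.coeff_sub, Pi.sub_apply, coeff_wickB (ball_mono h), coeff_wickB subset_rfl]
  simp only [mul_sub, Finset.sum_sub_distrib]

theorem chi_sub_eq_zero {N M : ℕ} (h : N ≤ M) {a b l k : Freq d} (hM : ¬ (a ∈ Freq.ball d M ∧
    b ∈ Freq.ball d M ∧ l ∈ Freq.ball d M ∧ k ∈ Freq.ball d M)) :
    chi N a b l k - chi M a b l k = 0 := by
  rw [chi_eq_zero hM, chi_eq_zero fun h' => hM ⟨ball_mono h h'.1, ball_mono h h'.2.1,
    ball_mono h h'.2.2.1, ball_mono h h'.2.2.2⟩, sub_zero]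

/-- The difference is a cubic Wick form with kernel `chi N - chi M`. The factor `8` comes from the
three variances `2|·|^{-2}`. -/
theorem lintegral_wickB_sub_pow {β : ℝ} (hβ : ∑' k : Freq d, (wt (2 * β - 2) k : ℝ≥0∞) < ∞)
    {N M : ℕ} (h : N ≤ M) {p : ℕ} (hp : 1 ≤ p) :
    ∫⁻ φ, ‖wickB d N β φ - wickB d M β φ‖ₑ ^ (2 * p) ∂gauss d 2 β ≤
      wickConst p * (8 * tail d β N) ^ p := by
  have heq : ∀ φ : Sob d β, ‖wickB d N β φ - wickB d M β φ‖ₑ ^ (2 * p) =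
      (∑ k ∈ Freq.ball d M, (wt (2 * β) k : ℝ≥0∞) * ‖∑ a ∈ Freq.ball d M, ∑ b ∈ Freq.ball d M,
        ∑ l ∈ Freq.ball d M, wickCubic φ.coeff a b l *
          (chi N a b l k - chi M a b l k)‖ₑ ^ 2) ^ p := fun φ => by
    rw [pow_mul, enorm_sq_eq_sum (F := Freq.ball d M)]
    · simp_rw [coeff_wickB_sub h]
    · intro k hk
      rw [coeff_wickB_sub h]
      refine Finset.sum_eq_zero fun a _ => Finset.sum_eq_zero fun b _ =>
        Finset.sum_eq_zero fun l _ => ?_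
      rw [chi_sub_eq_zero h fun h' => hk h'.2.2.2, mul_zero]
  simp_rw [heq]
  rw [(measurePreserving_coeff hβ).lintegral_comp (f := fun φ : Freq d → ℂ =>
      (∑ k ∈ Freq.ball d M, (wt (2 * β) k : ℝ≥0∞) * ‖∑ a ∈ Freq.ball d M, ∑ b ∈ Freq.ball d M,
        ∑ l ∈ Freq.ball d M, wickCubic φ a b l *
          (chi N a b l k - chi M a b l k)‖ₑ ^ 2) ^ p) (by unfold wickCubic; fun_prop)]
  refine (lintegral_wickCubic_pow (Freq.ball d M) (fun k => wt (2 * β) k)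
    (fun k a b l => chi N a b l k - chi M a b l k) hp).trans ?_
  gcongr
  refine sum_le_tail _ 8 fun k a b l => ?_
  refine (mul_le_mul_right (enorm_chi_sub_sq_le h a b l k) _).trans_eq ?_
  simp only [modeVar_eq, ENNReal.coe_mul, ENNReal.coe_ofNat]
  ring

/-- The Hilbert–Schmidt norm of the difference of two gradients, in terms of Wick-ordered
quadratic forms. -/
theorem sum_enorm_gradTwo_sub_le {N M : ℕ} (h : N ≤ M) (β : ℝ) (φ : Freq d → ℂ) :
    ∑' i, ‖(gradTwo N β φ - gradTwo M β φ) (Sob.basis d 1 i)‖ₑ ^ 2 ≤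
      16 * (∑ k ∈ Freq.ball d M, ∑ j ∈ Freq.ball d M, ((wt (2 * β) k * wt (-2) j : ℝ≥0) : ℝ≥0∞) *
        ‖∑ a ∈ Freq.ball d M, ∑ l ∈ Freq.ball d M, wickConj φ a l *
          (chi N a j l k - chi M a j l k)‖ₑ ^ 2) +
      4 * (∑ k ∈ Freq.ball d M, ∑ j ∈ Freq.ball d M, ((wt (2 * β) k * wt (-2) j : ℝ≥0) : ℝ≥0∞) *
        ‖∑ a ∈ Freq.ball d M, ∑ b ∈ Freq.ball d M, φ a * φ b *
          (chi N a b j k - chi M a b j k)‖ₑ ^ 2) := by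
  set F := Freq.ball d M with hF
  set A : Freq d → Freq d → ℂ := fun k j => ∑ a ∈ F, ∑ l ∈ F, wickConj φ a l *
    (chi N a j l k - chi M a j l k) with hA
  set E : Freq d → Freq d → ℂ := fun k j => ∑ a ∈ F, ∑ b ∈ F, φ a * φ b *
    (chi N a b j k - chi M a b j k) with hE
  have hzero : ∀ k j, ¬ (k ∈ F ∧ j ∈ F) → A k j = 0 ∧ E k j = 0 := fun k j hkj => by
    refine ⟨Finset.sum_eq_zero fun a _ => Finset.sum_eq_zero fun b _ => ?_,
      Finset.sum_eq_zero fun a _ => Finset.sum_eq_zero fun b _ => ?_⟩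
    · rw [chi_sub_eq_zero h fun h' => hkj ⟨h'.2.2.2, h'.2.1⟩, mul_zero]
    · rw [chi_sub_eq_zero h fun h' => hkj ⟨h'.2.2.2, h'.2.2.1⟩, mul_zero]
  have hco : ∀ (i : Freq d × Fin 2) (k : Freq d),
      ((gradTwo N β φ - gradTwo M β φ) (Sob.basis d 1 i)).coeff k =
        2 * ((i.1.abs ^ (-1 : ℝ)) • (![1, Complex.I] i.2 : ℂ)) * A k i.1 +
          conj ((i.1.abs ^ (-1 : ℝ)) • (![1, Complex.I] i.2 : ℂ)) * E k i.1 := fun i k => by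
    have hv : ∀ a, (Sob.basis d 1 i).coeff a =
        if a = i.1 then (i.1.abs ^ (-1 : ℝ)) • (![1, Complex.I] i.2 : ℂ) else 0 := fun a => by
      rw [basis_apply, Sob.basisVec, Sob.coeff_mk, Pi.single_apply]
    rw [sub_apply, Sob.coeff_sub, Pi.sub_apply,
      coeff_gradTwo_single (ball_mono h) β φ hv, coeff_gradTwo_single subset_rfl β φ hv]
    simp only [hA, hE, mul_sub, Finset.sum_sub_distrib]
    ring
  -- From `(2A + E)² ≤ 8A² + 2E²`. Summing over the two real directions at each frequency doubles
  -- this to `16` and `4`.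
  have hle : ∀ (i : Freq d × Fin 2) (k : Freq d),
      ‖((gradTwo N β φ - gradTwo M β φ) (Sob.basis d 1 i)).coeff k‖ₑ ^ 2 ≤
        wt (-2) i.1 * (8 * ‖A k i.1‖ₑ ^ 2 + 2 * ‖E k i.1‖ₑ ^ 2) := fun i k => by
    rw [hco]
    set z : ℂ := (i.1.abs ^ (-1 : ℝ)) • (![1, Complex.I] i.2 : ℂ) with hz
    have hz2 : ‖z‖ ^ 2 = wt (-2) i.1 := by
      have hI : ‖(![1, Complex.I] i.2 : ℂ)‖ = 1 := by
        obtain ⟨j, σ⟩ := i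
        fin_cases σ <;> simp
      rw [hz, weight_sq, hI, coe_wt]
      norm_num
    have h1 : ‖2 * z * A k i.1 + conj z * E k i.1‖ ^ 2 ≤
        ‖z‖ ^ 2 * (8 * ‖A k i.1‖ ^ 2 + 2 * ‖E k i.1‖ ^ 2) := by
      have h2 : ‖2 * z * A k i.1 + conj z * E k i.1‖ ≤
          ‖z‖ * (2 * ‖A k i.1‖ + ‖E k i.1‖) := by
        refine (norm_add_le _ _).trans_eq ?_
        simp only [norm_mul, RCLike.norm_conj, Complex.norm_ofNat]
        ring
      refine (pow_le_pow_left₀ (norm_nonneg _) h2 2).trans ?_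
      rw [mul_pow]
      gcongr
      nlinarith [sq_nonneg (2 * ‖A k i.1‖ - ‖E k i.1‖)]
    have h4 := ENNReal.ofReal_le_ofReal h1
    rw [hz2, ENNReal.ofReal_mul (NNReal.coe_nonneg _), ENNReal.ofReal_add (by positivity)
      (by positivity), ENNReal.ofReal_mul (by norm_num), ENNReal.ofReal_mul (by norm_num),
      ENNReal.ofReal_coe_nnreal, ENNReal.ofReal_pow (norm_nonneg _),
      ENNReal.ofReal_pow (norm_nonneg _), ENNReal.ofReal_pow (norm_nonneg _)] at h4
    simpa only [ofReal_norm, ENNReal.ofReal_ofNat] using h4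
  have hi : ∀ i : Freq d × Fin 2, ‖(gradTwo N β φ - gradTwo M β φ) (Sob.basis d 1 i)‖ₑ ^ 2 ≤
      ∑ k ∈ F, (wt (2 * β) k : ℝ≥0∞) *
        (wt (-2) i.1 * (8 * ‖A k i.1‖ₑ ^ 2 + 2 * ‖E k i.1‖ₑ ^ 2)) := fun i => by
    rw [enorm_sq_eq_sum (F := F)]
    · gcongr with k hk
      exact hle i k
    · intro k hk
      rw [hco, (hzero k i.1 fun h => hk h.1).1, (hzero k i.1 fun h => hk h.1).2]
      simp
  refine (ENNReal.tsum_le_tsum hi).trans_eq ?_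
  rw [ENNReal.tsum_prod']
  simp only [tsum_fintype, Finset.sum_const, Finset.card_univ, Fintype.card_fin, nsmul_eq_mul]
  rw [tsum_eq_sum (s := F)]
  · rw [← Finset.mul_sum, Finset.sum_comm, Finset.mul_sum, Finset.mul_sum, Finset.mul_sum,
      ← Finset.sum_add_distrib]
    refine Finset.sum_congr rfl fun k _ => ?_
    rw [Finset.mul_sum, Finset.mul_sum, Finset.mul_sum, ← Finset.sum_add_distrib]
    refine Finset.sum_congr rfl fun j _ => ?_
    push_cast
    ring
  · intro j hj
    rw [Finset.sum_eq_zero, mul_zero]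
    intro k _
    simp [(hzero k j fun h => hj h.2).1, (hzero k j fun h => hj h.2).2]

/-- The constant in the moment bound for the gradients. -/
def gradConst (p : ℕ) : ℝ≥0∞ := 2 ^ p * (16 ^ p * 4 ^ p + 4 ^ p * 4 ^ p) * wickConst p

theorem gradConst_lt_top (p : ℕ) : gradConst p < ∞ :=
  ENNReal.mul_lt_top (ENNReal.mul_lt_top (ENNReal.pow_lt_top (by simp))
    (ENNReal.add_lt_top.2 ⟨ENNReal.mul_lt_top (ENNReal.pow_lt_top (by simp))
      (ENNReal.pow_lt_top (by simp)), ENNReal.mul_lt_top (ENNReal.pow_lt_top (by simp))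
      (ENNReal.pow_lt_top (by simp))⟩)) (wickConst_lt_top p)

theorem add_pow_le_two_pow (x y : ℝ≥0∞) (p : ℕ) : (x + y) ^ p ≤ 2 ^ p * (x ^ p + y ^ p) := by
  have h : x + y ≤ 2 * max x y := by
    rw [two_mul]
    exact add_le_add (le_max_left _ _) (le_max_right _ _)
  refine (pow_le_pow_left' h p).trans ?_
  rw [mul_pow]
  gcongr
  rcases le_total x y with hxy | hxy
  · rw [max_eq_right hxy]
    exact le_add_self
  · rw [max_eq_left hxy]
    exact le_self_add

/-- The `H^1` basis supplies the weight `|j|^{-2}` for the differentiated mode, just where the field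
estimate has its variance. The quadratic Wick forms are thus bounded by the same `tail`, with `4`
from the two remaining variances. -/
theorem lintegral_gradTwo_sub_pow {β : ℝ} (hβ : ∑' k : Freq d, (wt (2 * β - 2) k : ℝ≥0∞) < ∞)
    {N M : ℕ} (h : N ≤ M) {p : ℕ} (hp : 1 ≤ p) :
    ∫⁻ φ : Sob d β, hsNorm (Sob.basis d 1) (gradTwo N β φ.coeff - gradTwo M β φ.coeff) ^ (2 * p)
      ∂gauss d 2 β ≤ gradConst p * tail d β N ^ p := by
  set F := Freq.ball d M with hF
  set a : (Freq d → ℂ) → ℝ≥0∞ := fun φ => ∑ k ∈ F, ∑ j ∈ F,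
    ((wt (2 * β) k * wt (-2) j : ℝ≥0) : ℝ≥0∞) * ‖∑ a ∈ F, ∑ l ∈ F, wickConj φ a l *
      (chi N a j l k - chi M a j l k)‖ₑ ^ 2 with ha
  set e : (Freq d → ℂ) → ℝ≥0∞ := fun φ => ∑ k ∈ F, ∑ j ∈ F,
    ((wt (2 * β) k * wt (-2) j : ℝ≥0) : ℝ≥0∞) * ‖∑ a ∈ F, ∑ b ∈ F, φ a * φ b *
      (chi N a b j k - chi M a b j k)‖ₑ ^ 2 with he
  have hma : Measurable a := by
    simp only [ha]
    unfold wickConj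
    fun_prop
  have hme : Measurable e := by
    simp only [he]
    fun_prop
  have hle : ∀ φ : Sob d β, hsNorm (Sob.basis d 1)
      (gradTwo N β φ.coeff - gradTwo M β φ.coeff) ^ (2 * p) ≤
      2 ^ p * (16 ^ p * a φ.coeff ^ p + 4 ^ p * e φ.coeff ^ p) := fun φ => by
    rw [hsNorm_pow, ← mul_pow, ← mul_pow]
    refine le_trans ?_ (add_pow_le_two_pow _ _ p)
    gcongr
    exact sum_enorm_gradTwo_sub_le h β φ.coeff
  refine (lintegral_mono hle).trans ?_
  rw [(measurePreserving_coeff hβ).lintegral_comp (f := fun φ : Freq d → ℂ =>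
      2 ^ p * (16 ^ p * a φ ^ p + 4 ^ p * e φ ^ p)) (by fun_prop),
    lintegral_const_mul _ (by fun_prop), lintegral_add_left (by fun_prop),
    lintegral_const_mul _ (by fun_prop), lintegral_const_mul _ (by fun_prop)]
  have h1 : ∫⁻ φ, a φ ^ p ∂gaussSeq d 2 ≤ wickConst p * (4 * tail d β N) ^ p := by
    refine (lintegral_wickConj_pow F (fun k j => wt (2 * β) k * wt (-2) j)
      (fun k j a l => chi N a j l k - chi M a j l k) hp).trans ?_
    gcongr
    refine le_trans (le_of_eq (Finset.sum_congr rfl fun k _ => Finset.sum_comm))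
      (sum_le_tail F 4 fun k a j l => ?_)
    refine (mul_le_mul_right (enorm_chi_sub_sq_le h a j l k) _).trans_eq ?_
    simp only [modeVar_eq, ENNReal.coe_mul, ENNReal.coe_ofNat]
    ring
  have h2 : ∫⁻ φ, e φ ^ p ∂gaussSeq d 2 ≤ wickConst p * (4 * tail d β N) ^ p := by
    refine (lintegral_mul_pow F (fun k j => wt (2 * β) k * wt (-2) j)
      (fun k j a b => chi N a b j k - chi M a b j k) hp).trans ?_
    gcongr
    refine le_trans (le_of_eq (Finset.sum_congr rfl fun k _ => ?_))
      (sum_le_tail F 4 (f := fun k a b j => ((wt (2 * β) k * wt (-2) j : ℝ≥0) : ℝ≥0∞) *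
        modeVar a * modeVar b * ‖chi N a b j k - chi M a b j k‖ₑ ^ 2) fun k a b j => ?_)
    · rw [Finset.sum_comm]
      exact Finset.sum_congr rfl fun a _ => Finset.sum_comm
    · refine (mul_le_mul_right (enorm_chi_sub_sq_le h a b j k) _).trans_eq ?_
      simp only [modeVar_eq, ENNReal.coe_mul, ENNReal.coe_ofNat]
      ring
  refine (mul_le_mul_right
    (add_le_add (mul_le_mul_right h1 _) (mul_le_mul_right h2 _)) _).trans_eq ?_
  rw [gradConst, mul_pow]
  ring

theorem ball_zero : Freq.ball d 0 = ∅ := by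
  ext k
  simp only [mem_ball, Nat.cast_zero, Finset.notMem_empty, iff_false, not_le]
  exact k.abs_pos

theorem trunc_zero (s : ℝ) (u : Freq d → ℂ) : Sob.trunc s 0 u = 0 := by
  rw [Sob.trunc_eq_sum, ball_zero, Finset.sum_empty]

/-- No frequency satisfies `|k| ≤ 0`, so the difference estimates taken against `N = 0` become
bounds uniform in the truncation. -/
theorem wickB_zero (β : ℝ) (φ : Sob d β) : wickB d 0 β φ = 0 := by
  rw [wickB_eq, trunc_zero, trunc_zero, smul_zero, sub_zero]

theorem gradTwo_zero (β : ℝ) (φ : Freq d → ℂ) : gradTwo 0 β φ = 0 := by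
  ext1 v
  rw [gradTwo_apply]
  simp only [truncTri, trunc_zero]
  simp

/-! ### Convergence of random sequences -/

section Convergence

variable {Ω : Type*} [MeasurableSpace Ω] {μ : Measure Ω}

theorem le_add_two_pow_mul_sq (x : ℝ≥0∞) (j : ℕ) : x ≤ 2⁻¹ ^ j + 2 ^ j * x ^ 2 := by
  rcases le_total x (2⁻¹ ^ j) with h | h
  · exact h.trans le_self_add
  · refine le_trans ?_ le_add_self
    have h1 : (1 : ℝ≥0∞) ≤ 2 ^ j * x := by
      calc (1 : ℝ≥0∞) = 2 ^ j * 2⁻¹ ^ j := by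
            rw [← mul_pow, ENNReal.mul_inv_cancel (by simp) (by simp), one_pow]
        _ ≤ _ := by gcongr
    calc x = 1 * x := (one_mul x).symm
      _ ≤ 2 ^ j * x * x := by gcongr
      _ = _ := by ring

/-- The inequality `g ≤ 2^{-j} + 2^j g²` turns second moments of order `4^{-j}` into means of order
`2^{-j}`, which are summable. -/
theorem ae_tsum_lt_top [IsProbabilityMeasure μ] {g : ℕ → Ω → ℝ≥0∞} (hg : ∀ j, AEMeasurable (g j) μ)
    {K : ℝ≥0∞} (hK : K < ∞) (h : ∀ j, ∫⁻ ω, g j ω ^ 2 ∂μ ≤ K * 4⁻¹ ^ j) :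
    ∀ᵐ ω ∂μ, ∑' j, g j ω < ∞ := by
  refine ae_lt_top' (AEMeasurable.tsum hg) ?_
  rw [lintegral_tsum hg]
  have hj : ∀ j, ∫⁻ ω, g j ω ∂μ ≤ (1 + K) * 2⁻¹ ^ j := fun j => by
    have h4 : (2 : ℝ≥0∞) ^ j * 4⁻¹ ^ j = 2⁻¹ ^ j := by
      rw [← mul_pow]
      congr 1
      rw [show (4 : ℝ≥0∞) = 2 * 2 by norm_num, ENNReal.mul_inv (by simp) (by simp), ← mul_assoc,
        ENNReal.mul_inv_cancel (by simp) (by simp), one_mul]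
    calc ∫⁻ ω, g j ω ∂μ ≤ ∫⁻ ω, (2⁻¹ ^ j + 2 ^ j * g j ω ^ 2) ∂μ :=
          lintegral_mono fun ω => le_add_two_pow_mul_sq _ j
      _ = 2⁻¹ ^ j + 2 ^ j * ∫⁻ ω, g j ω ^ 2 ∂μ := by
          rw [lintegral_add_left measurable_const, lintegral_const, measure_univ, mul_one,
            lintegral_const_mul' _ _ (ENNReal.pow_ne_top (by simp))]
      _ ≤ 2⁻¹ ^ j + 2 ^ j * (K * 4⁻¹ ^ j) := by
          gcongr
          exact h j
      _ = 2⁻¹ ^ j + K * (2 ^ j * 4⁻¹ ^ j) := by ring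
      _ = _ := by
          rw [h4]
          ring
  refine ((ENNReal.tsum_le_tsum hj).trans_lt ?_).ne
  rw [ENNReal.tsum_mul_left, ENNReal.tsum_geometric]
  refine ENNReal.mul_lt_top (ENNReal.add_lt_top.2 ⟨by simp, hK⟩) ?_
  simp

/-- Fatou's lemma, in the form used to carry moment bounds over to the limits. -/
theorem lintegral_le_of_tendsto {f : ℕ → Ω → ℝ≥0∞} {g : Ω → ℝ≥0∞} {C : ℝ≥0∞}
    (hf : ∀ n, AEMeasurable (f n) μ) (hlim : ∀ᵐ ω ∂μ, Tendsto (fun n => f n ω) atTop (𝓝 (g ω)))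
    (hC : ∀ᶠ n in atTop, ∫⁻ ω, f n ω ∂μ ≤ C) : ∫⁻ ω, g ω ∂μ ≤ C :=
  calc ∫⁻ ω, g ω ∂μ = ∫⁻ ω, liminf (fun n => f n ω) atTop ∂μ :=
        lintegral_congr_ae (hlim.mono fun ω h => h.liminf_eq.symm)
    _ ≤ liminf (fun n => ∫⁻ ω, f n ω ∂μ) atTop := lintegral_liminf_le' hf
    _ ≤ C := by
        refine liminf_le_of_le (by isBoundedDefault) fun b hb => ?_
        obtain ⟨n, h1, h2⟩ := (hb.and hC).exists
        exact h1.trans h2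

theorem exists_tendsto_of_tsum_lt_top {E : Type*} [NormedAddCommGroup E] [CompleteSpace E]
    {x : ℕ → E} (h : ∑' j, ‖x j - x (j + 1)‖ₑ < ∞) : ∃ y, Tendsto x atTop (𝓝 y) := by
  refine cauchySeq_tendsto_of_complete
    (cauchySeq_of_edist_le_of_tsum_ne_top (fun j => ‖x j - x (j + 1)‖ₑ) (fun j => ?_) h.ne)
  rw [Nat.succ_eq_add_one, edist_eq_enorm_sub]

theorem eLpNorm_eq_lintegral_pow {E : Type*} [NormedAddCommGroup E] (f : Ω → E) {q : ℕ}
    (hq : 1 ≤ q) : eLpNorm f (q : ℝ≥0∞) μ = (∫⁻ ω, ‖f ω‖ₑ ^ q ∂μ) ^ (1 / (q : ℝ)) := by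
  rw [eLpNorm_eq_lintegral_rpow_enorm_toReal (by positivity) (by simp)]
  simp

theorem memLp_of_lintegral_pow_lt_top {E : Type*} [NormedAddCommGroup E] {f : Ω → E} {q : ℕ}
    (hq : 1 ≤ q) (hf : AEStronglyMeasurable f μ) (h : ∫⁻ ω, ‖f ω‖ₑ ^ q ∂μ < ∞) :
    MemLp f (q : ℝ≥0∞) μ := by
  refine ⟨hf, ?_⟩
  rw [eLpNorm_eq_lintegral_pow f hq]
  exact ENNReal.rpow_lt_top_of_nonneg (by positivity) h.ne

end Convergence

/-- The operator norm is bounded by the Hilbert–Schmidt norm. -/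
theorem enorm_le_hsNorm {ι E G : Type*} [NormedAddCommGroup E] [InnerProductSpace ℝ E]
    [NormedAddCommGroup G] [InnerProductSpace ℝ G] (b : HilbertBasis ι ℝ E) (T : E →L[ℝ] G) :
    ‖T‖ₑ ≤ hsNorm b T := by
  have hsq : hsNorm b T ^ 2 = ∑' i, ‖T (b i)‖ₑ ^ 2 := by simpa using hsNorm_pow b T 1
  by_cases htop : hsNorm b T = ∞
  · rw [htop]
    exact le_top
  have hx : ∀ x, ‖T x‖ₑ ^ 2 ≤ hsNorm b T ^ 2 * ‖x‖ₑ ^ 2 := fun x => by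
    have h1 := (b.hasSum_repr x).mapL T
    have h2 : ‖T x‖ₑ ≤ ∑' i, ‖b.repr x i‖ₑ * ‖T (b i)‖ₑ := by
      rw [← h1.tsum_eq]
      refine enorm_tsum_le_tsum_enorm.trans_eq (tsum_congr fun i => ?_)
      rw [map_smul, enorm_smul]
    have h3 : ∑' i, ‖b.repr x i‖ₑ ^ 2 ≤ ‖x‖ₑ ^ 2 := by
      have h4 := b.orthonormal.tsum_inner_products_le (𝕜 := ℝ) x
      have h5 := b.orthonormal.inner_products_summable (𝕜 := ℝ) x
      have h6 := ENNReal.ofReal_le_ofReal h4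
      rw [ENNReal.ofReal_tsum_of_nonneg (fun i => by positivity) h5] at h6
      simpa only [ENNReal.ofReal_pow (norm_nonneg _), ofReal_norm, ← b.repr_apply_apply] using h6
    calc ‖T x‖ₑ ^ 2 ≤ (∑' i, ‖b.repr x i‖ₑ * ‖T (b i)‖ₑ) ^ 2 := by gcongr
      _ ≤ (∑' i, ‖b.repr x i‖ₑ ^ 2) * ∑' i, ‖T (b i)‖ₑ ^ 2 :=
          tsum_sq_le fun i => (mul_pow _ _ _).le
      _ ≤ ‖x‖ₑ ^ 2 * ∑' i, ‖T (b i)‖ₑ ^ 2 := by gcongr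
      _ = _ := by rw [hsq, mul_comm]
  have hT : ‖T‖ ≤ (hsNorm b T).toReal := by
    refine T.opNorm_le_bound ENNReal.toReal_nonneg fun x => ?_
    have h := norm_le_of_enorm_sq_le (ENNReal.pow_lt_top (lt_top_iff_ne_top.2 htop)) (hx x)
    rwa [ENNReal.toReal_pow, Real.sqrt_sq ENNReal.toReal_nonneg] at h
  rw [← ofReal_norm]
  exact ENNReal.ofReal_le_of_le_toReal hT

/-! ### Measurability -/

theorem stronglyMeasurable_truncTri (N : ℕ) (β : ℝ) {u v w : (Freq d → ℂ) → Freq d → ℂ}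
    (hu : ∀ a, Continuous fun x => u x a) (hv : ∀ a, Continuous fun x => v x a)
    (hw : ∀ a, Continuous fun x => w x a) :
    StronglyMeasurable fun φ : Sob d β => truncTri N β (u φ.coeff) (v φ.coeff) (w φ.coeff) :=
  (continuous_truncTri N β hu hv hw).stronglyMeasurable.comp_measurable measurable_coeff

theorem stronglyMeasurable_wickB (N : ℕ) (β : ℝ) : StronglyMeasurable (wickB d N β) := by
  have h1 := stronglyMeasurable_truncTri (d := d) N β (u := id) (v := id) (w := id)
    (fun a => continuous_apply a) (fun a => continuous_apply a) (fun a => continuous_apply a)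
  have h2 : StronglyMeasurable fun φ : Sob d β => Sob.trunc β N φ.coeff :=
    Sob.stronglyMeasurable_trunc N fun k _ => (measurable_pi_apply k).comp measurable_coeff
  exact h1.sub (h2.const_smul (renorm d N))

theorem stronglyMeasurable_gradTwo (N : ℕ) (β : ℝ) (v : Sob d 1) :
    StronglyMeasurable fun φ : Sob d β => gradTwo N β φ.coeff v := by
  simp_rw [gradTwo_apply]
  have h := fun a => continuous_apply (A := fun _ : Freq d => ℂ) a
  have h' := fun a => (continuous_const : Continuous fun _ : Freq d → ℂ => v.coeff a)
  exact (((stronglyMeasurable_truncTri N β (u := fun _ => v.coeff) h' h h).add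
    (stronglyMeasurable_truncTri N β (v := fun _ => v.coeff) h h' h)).add
    (stronglyMeasurable_truncTri N β (w := fun _ => v.coeff) h h h')).sub stronglyMeasurable_const

theorem measurable_hsNorm {Ω : Type*} [MeasurableSpace Ω] {β : ℝ}
    {T : Ω → Sob d 1 →L[ℝ] Sob d β} (hT : ∀ v, StronglyMeasurable fun ω => T ω v) :
    Measurable fun ω => hsNorm (Sob.basis d 1) (T ω) := by
  unfold hsNorm
  refine Measurable.pow_const (Measurable.tsum fun i => ?_) _
  exact (hT _).enorm.pow_const 2

/-! ### Resonance sums of the Gaussian field -/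

theorem lintegral_tsum_res {Ω : Type*} [MeasurableSpace Ω] {μ : Measure Ω}
    {G : Freq d → Freq d → Freq d → Freq d → Ω → ℝ≥0∞} (hG : ∀ k a b l, Measurable (G k a b l)) :
    ∫⁻ ω, ∑' (k) (a) (b) (l), (if Res a b l k then G k a b l ω else 0) ∂μ =
      ∑' (k) (a) (b) (l), if Res a b l k then ∫⁻ ω, G k a b l ω ∂μ else 0 := by
  have h4 : ∀ k a b l, Measurable fun ω => if Res a b l k then G k a b l ω else 0 :=
    fun k a b l => by
      split_ifs
      exacts [hG k a b l, measurable_const]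
  have h3 : ∀ k a b, Measurable fun ω => ∑' l, if Res a b l k then G k a b l ω else 0 :=
    fun k a b => Measurable.tsum (h4 k a b)
  have h2 : ∀ k a, Measurable fun ω => ∑' (b) (l), if Res a b l k then G k a b l ω else 0 :=
    fun k a => Measurable.tsum (h3 k a)
  have h1 : ∀ k, Measurable fun ω => ∑' (a) (b) (l), if Res a b l k then G k a b l ω else 0 :=
    fun k => Measurable.tsum (h2 k)
  rw [lintegral_tsum fun k => (h1 k).aemeasurable]
  refine tsum_congr fun k => ?_
  rw [lintegral_tsum fun a => (h2 k a).aemeasurable]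
  refine tsum_congr fun a => ?_
  rw [lintegral_tsum fun b => (h3 k a b).aemeasurable]
  refine tsum_congr fun b => ?_
  rw [lintegral_tsum fun l => (h4 k a b l).aemeasurable]
  refine tsum_congr fun l => ?_
  split_ifs <;> simp

theorem measurable_tsum_res {Ω : Type*} [MeasurableSpace Ω]
    {G : Freq d → Freq d → Freq d → Freq d → Ω → ℝ≥0∞} (hG : ∀ k a b l, Measurable (G k a b l)) :
    Measurable fun ω => ∑' (k) (a) (b) (l), (if Res a b l k then G k a b l ω else 0) := by
  refine Measurable.tsum fun k => Measurable.tsum fun a => Measurable.tsum fun b =>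
    Measurable.tsum fun l => ?_
  split_ifs
  exacts [hG k a b l, measurable_const]

theorem tsum_res_const_mul_lt_top {β : ℝ} (h : qsum (d := d) (fun k => wt (2 * β) k)
    (fun a => wt (-2) a) (fun b => wt (-2) b) (fun l => wt (-2) l) < ∞) (c : ℝ≥0∞) (hc : c < ∞) :
    ∑' (k : Freq d) (a : Freq d) (b : Freq d) (l : Freq d), (if Res a b l k then
      c * ((wt (2 * β) k : ℝ≥0∞) * wt (-2) a * wt (-2) b * wt (-2) l) else 0) < ∞ := by
  have h1 := ENNReal.mul_lt_top hc h
  simp only [qsum, ← ENNReal.tsum_mul_left] at h1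
  simpa only [mul_ite, mul_zero] using h1

/-- In expectation `|φ_a|²` becomes `2|a|^{-2}`, so the random sum has finite mean by the
deterministic one. The exceptional set does not depend on any direction `v`. -/
theorem ae_qsum_first_lt_top {β : ℝ} (h : qsum (d := d) (fun k => wt (2 * β) k)
    (fun a => wt (-2) a) (fun b => wt (-2) b) (fun l => wt (-2) l) < ∞) :
    ∀ᵐ φ ∂gaussSeq d 2, qsum (fun k => wt (2 * β) k) (fun a => ‖φ a‖ₑ ^ 2) (fun b => wt (-2) b)
      (fun l => wt (-2) l) < ∞ := by
  have hG : ∀ k a b l : Freq d, Measurable fun φ : Freq d → ℂ =>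
      (wt (2 * β) k : ℝ≥0∞) * ‖φ a‖ₑ ^ 2 * wt (-2) b * wt (-2) l := fun k a b l => by fun_prop
  refine ae_lt_top (measurable_tsum_res hG) (ne_of_lt ?_)
  refine lt_of_eq_of_lt (lintegral_tsum_res hG) ?_
  refine lt_of_eq_of_lt ?_ (tsum_res_const_mul_lt_top h 2 (by simp))
  refine tsum_congr fun k => tsum_congr fun a => tsum_congr fun b => tsum_congr fun l => ?_
  congr 1
  rw [lintegral_mul_const _ (by fun_prop), lintegral_mul_const _ (by fun_prop),
    lintegral_const_mul _ (by fun_prop), lintegral_gaussSeq_sq, modeVar_eq]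
  push_cast
  ring

theorem ae_qsum_third_lt_top {β : ℝ} (h : qsum (d := d) (fun k => wt (2 * β) k)
    (fun a => wt (-2) a) (fun b => wt (-2) b) (fun l => wt (-2) l) < ∞) :
    ∀ᵐ φ ∂gaussSeq d 2, qsum (fun k => wt (2 * β) k) (fun a => wt (-2) a) (fun b => wt (-2) b)
      (fun l => ‖φ l‖ₑ ^ 2) < ∞ := by
  have hG : ∀ k a b l : Freq d, Measurable fun φ : Freq d → ℂ =>
      (wt (2 * β) k : ℝ≥0∞) * wt (-2) a * wt (-2) b * ‖φ l‖ₑ ^ 2 := fun k a b l => by fun_prop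
  refine ae_lt_top (measurable_tsum_res hG) (ne_of_lt ?_)
  refine lt_of_eq_of_lt (lintegral_tsum_res hG) ?_
  refine lt_of_eq_of_lt ?_ (tsum_res_const_mul_lt_top h 2 (by simp))
  refine tsum_congr fun k => tsum_congr fun a => tsum_congr fun b => tsum_congr fun l => ?_
  congr 1
  rw [lintegral_const_mul _ (by fun_prop), lintegral_gaussSeq_sq, modeVar_eq]
  push_cast
  ring

/-- For `v` in `H^1` one has `|v_a|² ≤ |a|^{-2} ‖v‖²`, so the same sum controls a smooth entry; this
handles the term cubic in `v`. -/
theorem qsum_first_lt_top_of_sobSq {β : ℝ} (h : qsum (d := d) (fun k => wt (2 * β) k)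
    (fun a => wt (-2) a) (fun b => wt (-2) b) (fun l => wt (-2) l) < ∞) {v : Freq d → ℂ}
    (hv : sobSq 1 v < ∞) : qsum (fun k => wt (2 * β) k) (fun a => ‖v a‖ₑ ^ 2)
      (fun b => wt (-2) b) (fun l => wt (-2) l) < ∞ := by
  refine lt_of_le_of_lt (ENNReal.tsum_le_tsum fun k => ENNReal.tsum_le_tsum fun a =>
    ENNReal.tsum_le_tsum fun b => ENNReal.tsum_le_tsum fun l => ?_)
    (tsum_res_const_mul_lt_top h (sobSq 1 v) hv)
  split_ifs
  · have h1 : ‖v a‖ₑ ^ 2 ≤ wt (-2) a * sobSq 1 v := by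
      rw [wt_mul_enorm_sq_cancel 1 a (v a), mul_one]
      gcongr
      refine le_trans (le_of_eq ?_) (ENNReal.le_tsum a)
      rw [mul_one]
    calc (wt (2 * β) k : ℝ≥0∞) * ‖v a‖ₑ ^ 2 * wt (-2) b * wt (-2) l
        ≤ wt (2 * β) k * (wt (-2) a * sobSq 1 v) * wt (-2) b * wt (-2) l := by gcongr
      _ = _ := by ring
  · exact le_rfl

/-! ### Dimension two -/

section DimTwo

variable {β : ℝ}

theorem exists_subseq_tail (hβ : β < 0) :
    ∃ n : ℕ → ℕ, StrictMono n ∧ ∀ j, tail 2 β (n j) ≤ 4⁻¹ ^ j := by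
  refine extraction_forall_of_eventually' (P := fun j N => tail 2 β N ≤ 4⁻¹ ^ j) fun j => ?_
  have h := (tendsto_tail (qsum_wt_lt_top hβ)).eventually_le_const
    (u := (4⁻¹ : ℝ≥0∞) ^ j) (ENNReal.pow_pos (by simp) j)
  exact eventually_atTop.1 h

theorem tail_lt_top (hβ : β < 0) (N : ℕ) : tail 2 β N < ∞ :=
  (tail_le β N).trans_lt (qsum_wt_lt_top hβ)

theorem tsum_weight_lt_top (hβ : β < 0) : ∑' k : Freq 2, (wt (2 * β - 2) k : ℝ≥0∞) < ∞ :=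
  tsum_wt_lt_top_of_dim_two (by linarith)

theorem isProbabilityMeasure_gauss (h : ∑' k : Freq d, (wt (2 * β - 2) k : ℝ≥0∞) < ∞) :
    IsProbabilityMeasure (gauss d 2 β) :=
  ⟨by rw [← Set.preimage_univ (f := Sob.coeff), (measurePreserving_coeff h).measure_preimage
    MeasurableSet.univ.nullMeasurableSet, measure_univ]⟩

theorem lintegral_gradTwo_pow_le (hβ : β < 0) (N : ℕ) {p : ℕ} (hp : 1 ≤ p) :
    ∫⁻ φ : Sob 2 β, hsNorm (Sob.basis 2 1) (gradTwo N β φ.coeff) ^ (2 * p) ∂gauss 2 2 β ≤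
      gradConst p * tail 2 β 0 ^ p := by
  refine le_trans (le_of_eq (lintegral_congr fun φ => ?_))
    (lintegral_gradTwo_sub_pow (tsum_weight_lt_top hβ) N.zero_le hp)
  rw [gradTwo_zero, zero_sub, hsNorm_pow, hsNorm_pow]
  simp only [neg_apply, enorm_neg]

theorem gradConst_mul_lt_top (hβ : β < 0) (p : ℕ) : gradConst p * tail 2 β 0 ^ p < ∞ :=
  ENNReal.mul_lt_top (gradConst_lt_top p) (ENNReal.pow_lt_top (tail_lt_top hβ 0))

/-! ### Almost sure limits along a subsequence and the gradient of the limit. -/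

theorem ae_exists_tendsto_wickB (hβ : β < 0) {n : ℕ → ℕ} (hn : StrictMono n)
    (htail : ∀ j, tail 2 β (n j) ≤ 4⁻¹ ^ j) :
    ∀ᵐ φ ∂gauss 2 2 β, ∃ y, Tendsto (fun j => wickB 2 (n j) β φ) atTop (𝓝 y) := by
  have := isProbabilityMeasure_gauss (tsum_weight_lt_top hβ)
  have h := ae_tsum_lt_top (μ := gauss 2 2 β)
    (g := fun j φ => ‖wickB 2 (n j) β φ - wickB 2 (n (j + 1)) β φ‖ₑ)
    (fun j => ((stronglyMeasurable_wickB _ β).sub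
      (stronglyMeasurable_wickB _ β)).enorm.aemeasurable)
    (ENNReal.mul_lt_top (wickConst_lt_top 1) (by simp : (8 : ℝ≥0∞) < ∞)) (fun j => by
      refine (lintegral_wickB_sub_pow (tsum_weight_lt_top hβ) (hn.monotone j.le_succ)
        le_rfl).trans ?_
      rw [pow_one, mul_assoc]
      gcongr
      exact htail j)
  filter_upwards [h] with φ hφ
  exact exists_tendsto_of_tsum_lt_top hφ

/-- The Hilbert–Schmidt norms of successive differences are almost surely summable and dominate the
operator norms, so the gradients converge in the complete space of bounded operators. -/
theorem ae_exists_tendsto_gradTwo (hβ : β < 0) {n : ℕ → ℕ} (hn : StrictMono n)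
    (htail : ∀ j, tail 2 β (n j) ≤ 4⁻¹ ^ j) :
    ∀ᵐ φ : Sob 2 β ∂gauss 2 2 β,
      ∃ T, Tendsto (fun j => gradTwo (n j) β φ.coeff) atTop (𝓝 T) := by
  have := isProbabilityMeasure_gauss (tsum_weight_lt_top hβ)
  have h := ae_tsum_lt_top (μ := gauss 2 2 β)
    (g := fun j φ => hsNorm (Sob.basis 2 1) (gradTwo (n j) β φ.coeff -
      gradTwo (n (j + 1)) β φ.coeff))
    (fun j => (measurable_hsNorm fun v => (stronglyMeasurable_gradTwo _ β v).sub
      (stronglyMeasurable_gradTwo _ β v)).aemeasurable)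
    (gradConst_lt_top 1) (fun j => by
      refine (lintegral_gradTwo_sub_pow (tsum_weight_lt_top hβ) (hn.monotone j.le_succ)
        le_rfl).trans ?_
      rw [pow_one]
      gcongr
      exact htail j)
  filter_upwards [h] with φ hφ
  exact exists_tendsto_of_tsum_lt_top
    ((ENNReal.tsum_le_tsum fun j => enorm_le_hsNorm (Sob.basis 2 1) _).trans_lt hφ)

/-- The Taylor terms with at least two entries from `H^1` converge absolutely without
renormalisation. The null set serves all `v` simultaneously, as the definition of the gradient
demands. -/
theorem ae_triOK (hβ : β < 0) : ∀ᵐ φ : Sob 2 β ∂gauss 2 2 β, ∀ v : Sob 2 1,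
    TriOK β φ.coeff v.coeff v.coeff ∧ TriOK β v.coeff φ.coeff v.coeff ∧
      TriOK β v.coeff v.coeff φ.coeff ∧ TriOK β v.coeff v.coeff v.coeff := by
  have hmp := (measurePreserving_coeff (tsum_weight_lt_top hβ)).quasiMeasurePreserving
  have hS := qsum_wt_lt_top hβ
  filter_upwards [hmp.ae (ae_qsum_first_lt_top hS), hmp.ae (ae_qsum_third_lt_top hS)]
    with φ h1 h3 v
  have hv := v.sobSq_coeff_lt_top
  exact ⟨triOK_of_first h1 hv hv, (triOK_of_first h1 hv hv).swap, triOK_of_third h3 hv hv,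
    triOK_of_first (qsum_first_lt_top_of_sobSq hS hv) hv hv⟩

/-- The renormalised field along a subsequence of truncations. -/
def wickLim (β : ℝ) (n : ℕ → ℕ) (φ : Sob 2 β) : Sob 2 β :=
  limUnder atTop fun j => wickB 2 (n j) β φ

/-- The gradient of the renormalised field along a subsequence of truncations. -/
def gradLim (β : ℝ) (n : ℕ → ℕ) (φ : Sob 2 β) : Sob 2 1 →L[ℝ] Sob 2 β :=
  limUnder atTop fun j => gradTwo (n j) β φ.coeff

/-- Convergence at the shifted points `φ + εv` is deduced from the exact expansion of the
truncations and the convergence of its four coefficients. No quasi-invariance of the measure under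
shifts is needed. -/
theorem ae_isGradientAt_wickLim (hβ : β < 0) (hβ1 : β ≤ 1) {n : ℕ → ℕ} (hn : StrictMono n)
    (htail : ∀ j, tail 2 β (n j) ≤ 4⁻¹ ^ j) :
    ∀ᵐ φ ∂gauss 2 2 β, IsGradientAt hβ1 (wickLim β n) φ (gradLim β n φ) := by
  filter_upwards [ae_exists_tendsto_wickB hβ hn htail, ae_exists_tendsto_gradTwo hβ hn htail,
    ae_triOK hβ] with φ hW hD hok
  have hW' : Tendsto (fun j => wickB 2 (n j) β φ) atTop (𝓝 (wickLim β n φ)) :=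
    tendsto_nhds_limUnder hW
  have hD' : Tendsto (fun j => gradTwo (n j) β φ.coeff) atTop (𝓝 (gradLim β n φ)) :=
    tendsto_nhds_limUnder hD
  refine isGradientAt_of_expansion hβ1 fun v => ?_
  obtain ⟨h1, h2, h3, h4⟩ := hok v
  -- The counterterm is linear in `φ`, so the quadratic and cubic coefficients contain none of it.
  -- `Tendsto.limUnder_eq` identifies `wickLim` at the shifted point with the limit of the
  -- expansion.
  refine ⟨Sob.ofCoeff β (tri φ.coeff v.coeff v.coeff) +
    Sob.ofCoeff β (tri v.coeff φ.coeff v.coeff) +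
    Sob.ofCoeff β (tri v.coeff v.coeff φ.coeff), Sob.ofCoeff β (tri v.coeff v.coeff v.coeff),
    fun ε => Tendsto.limUnder_eq ?_⟩
  simp_rw [wickB_add_smul]
  have hDv : Tendsto (fun j => gradTwo (n j) β φ.coeff v) atTop (𝓝 (gradLim β n φ v)) :=
    ((ContinuousLinearMap.apply ℝ (Sob 2 β) v).continuous.tendsto _).comp hD'
  have hna := hn.tendsto_atTop
  exact ((hW'.add (hDv.const_smul ε)).add ((((h1.tendsto_truncTri.comp hna).add
    (h2.tendsto_truncTri.comp hna)).add (h3.tendsto_truncTri.comp hna)).const_smul _)).add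
    ((h4.tendsto_truncTri.comp hna).const_smul _)

theorem ae_tendsto_wickLim (hβ : β < 0) {n : ℕ → ℕ} (hn : StrictMono n)
    (htail : ∀ j, tail 2 β (n j) ≤ 4⁻¹ ^ j) :
    ∀ᵐ φ ∂gauss 2 2 β, Tendsto (fun j => wickB 2 (n j) β φ) atTop (𝓝 (wickLim β n φ)) := by
  filter_upwards [ae_exists_tendsto_wickB hβ hn htail] with φ hφ
  exact tendsto_nhds_limUnder hφ

theorem ae_tendsto_gradLim (hβ : β < 0) {n : ℕ → ℕ} (hn : StrictMono n)
    (htail : ∀ j, tail 2 β (n j) ≤ 4⁻¹ ^ j) :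
    ∀ᵐ φ ∂gauss 2 2 β, ∀ v,
      Tendsto (fun j => gradTwo (n j) β φ.coeff v) atTop (𝓝 (gradLim β n φ v)) := by
  filter_upwards [ae_exists_tendsto_gradTwo hβ hn htail] with φ hφ v
  exact ((ContinuousLinearMap.apply ℝ (Sob 2 β) v).continuous.tendsto _).comp
    (tendsto_nhds_limUnder hφ)

/-! ### Measurability and moments of the limit and its gradient. -/

theorem aestronglyMeasurable_wickLim (hβ : β < 0) {n : ℕ → ℕ} (hn : StrictMono n)
    (htail : ∀ j, tail 2 β (n j) ≤ 4⁻¹ ^ j) :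
    AEStronglyMeasurable (wickLim β n) (gauss 2 2 β) :=
  aestronglyMeasurable_of_tendsto_ae atTop
    (fun j => (stronglyMeasurable_wickB (n j) β).aestronglyMeasurable)
    (ae_tendsto_wickLim hβ hn htail)

theorem aestronglyMeasurable_gradLim (hβ : β < 0) {n : ℕ → ℕ} (hn : StrictMono n)
    (htail : ∀ j, tail 2 β (n j) ≤ 4⁻¹ ^ j) (v : Sob 2 1) :
    AEStronglyMeasurable (fun φ => gradLim β n φ v) (gauss 2 2 β) :=
  aestronglyMeasurable_of_tendsto_ae atTop
    (fun j => (stronglyMeasurable_gradTwo (n j) β v).aestronglyMeasurable)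
    ((ae_tendsto_gradLim hβ hn htail).mono fun _ h => h v)

/-- Fatou in the second truncation index of the difference estimate. The bound holds for every `N`,
so the whole sequence converges in `L^{2p}`, to a limit independent of `p`. -/
theorem lintegral_wickB_sub_wickLim_le (hβ : β < 0) {n : ℕ → ℕ} (hn : StrictMono n)
    (htail : ∀ j, tail 2 β (n j) ≤ 4⁻¹ ^ j) (N : ℕ) {p : ℕ} (hp : 1 ≤ p) :
    ∫⁻ φ, ‖wickB 2 N β φ - wickLim β n φ‖ₑ ^ (2 * p) ∂gauss 2 2 β ≤
      wickConst p * (8 * tail 2 β N) ^ p := by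
  refine lintegral_le_of_tendsto
    (f := fun j φ => ‖wickB 2 N β φ - wickB 2 (n j) β φ‖ₑ ^ (2 * p)) (fun j => ?_) ?_ ?_
  · exact (((stronglyMeasurable_wickB N β).sub
      (stronglyMeasurable_wickB (n j) β)).enorm.pow_const _).aemeasurable
  · filter_upwards [ae_tendsto_wickLim hβ hn htail] with φ hφ
    exact ENNReal.Tendsto.pow (tendsto_const_nhds.sub hφ).enorm
  · filter_upwards [hn.tendsto_atTop.eventually_ge_atTop N] with j hj
    exact lintegral_wickB_sub_pow (tsum_weight_lt_top hβ) hj hp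

/-- Fatou is applied twice: along the subsequence for finitely many basis vectors, where convergence
on each vector is enough, then along an exhaustion of the basis. -/
theorem lintegral_gradLim_le (hβ : β < 0) {n : ℕ → ℕ} (hn : StrictMono n)
    (htail : ∀ j, tail 2 β (n j) ≤ 4⁻¹ ^ j) {p : ℕ} (hp : 1 ≤ p) :
    ∫⁻ φ, hsNorm (Sob.basis 2 1) (gradLim β n φ) ^ (2 * p) ∂gauss 2 2 β ≤
      gradConst p * tail 2 β 0 ^ p := by
  have hfin : ∀ s : Finset (Freq 2 × Fin 2),
      ∫⁻ φ, (∑ i ∈ s, ‖gradLim β n φ (Sob.basis 2 1 i)‖ₑ ^ 2) ^ p ∂gauss 2 2 β ≤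
        gradConst p * tail 2 β 0 ^ p := fun s => by
    refine lintegral_le_of_tendsto (f := fun j (φ : Sob 2 β) =>
      (∑ i ∈ s, ‖gradTwo (n j) β φ.coeff (Sob.basis 2 1 i)‖ₑ ^ 2) ^ p) (fun j => ?_) ?_
      (Eventually.of_forall fun j => ?_)
    · refine ((Finset.measurable_fun_sum s fun i _ => ?_).pow_const p).aemeasurable
      exact (stronglyMeasurable_gradTwo (n j) β _).enorm.pow_const 2
    · filter_upwards [ae_tendsto_gradLim hβ hn htail] with φ hφ
      exact ENNReal.Tendsto.pow (tendsto_finsetSum s fun i _ =>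
        ENNReal.Tendsto.pow (hφ (Sob.basis 2 1 i)).enorm)
    · refine (lintegral_mono fun φ => ?_).trans (lintegral_gradTwo_pow_le hβ (n j) hp)
      rw [hsNorm_pow]
      gcongr
      exact ENNReal.sum_le_tsum s
  refine lintegral_le_of_tendsto (f := fun N φ =>
    (∑ i ∈ Freq.ball 2 N ×ˢ Finset.univ, ‖gradLim β n φ (Sob.basis 2 1 i)‖ₑ ^ 2) ^ p)
    (fun N => ?_) (ae_of_all _ fun φ => ?_) (Eventually.of_forall fun N => hfin _)
  · refine (Finset.aemeasurable_fun_sum _ fun i _ => ?_).pow_const p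
    exact (aestronglyMeasurable_gradLim hβ hn htail _).enorm.pow_const 2
  · rw [hsNorm_pow]
    refine ENNReal.Tendsto.pow (ENNReal.summable.hasSum.comp (tendsto_atTop_finset_of_monotone
      (fun N M h => Finset.product_subset_product_left (ball_mono h)) fun i => ?_))
    obtain ⟨N, hN⟩ := (eventually_mem_ball i.1).exists
    exact ⟨N, by simp [hN]⟩

theorem tendsto_eLpNorm_wickLim (hβ : β < 0) {n : ℕ → ℕ} (hn : StrictMono n)
    (htail : ∀ j, tail 2 β (n j) ≤ 4⁻¹ ^ j) {p : ℕ} (hp : 1 ≤ p) :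
    Tendsto (fun N => eLpNorm (wickB 2 N β - wickLim β n) ((2 * p : ℕ) : ℝ≥0∞) (gauss 2 2 β))
      atTop (𝓝 0) := by
  simp_rw [eLpNorm_eq_lintegral_pow _ (show 1 ≤ 2 * p by omega)]
  have hpos : 0 < 1 / ((2 * p : ℕ) : ℝ) := by
    have : 0 < 2 * p := by omega
    positivity
  have h1 : Tendsto (fun N => wickConst p * (8 * tail 2 β N) ^ p) atTop (𝓝 0) := by
    have h2 := ENNReal.Tendsto.const_mul (a := 8) (tendsto_tail (qsum_wt_lt_top hβ)) (by simp)
    have h3 := ENNReal.Tendsto.const_mul (a := wickConst p) (ENNReal.Tendsto.pow (n := p) h2)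
      (Or.inr (wickConst_lt_top p).ne)
    simpa [show p ≠ 0 by omega] using h3
  have h4 : Tendsto (fun N => ∫⁻ φ, ‖(wickB 2 N β - wickLim β n) φ‖ₑ ^ (2 * p) ∂gauss 2 2 β)
      atTop (𝓝 0) := tendsto_of_tendsto_of_tendsto_of_le_of_le tendsto_const_nhds h1
    (fun _ => zero_le) fun N => lintegral_wickB_sub_wickLim_le hβ hn htail N hp
  have h5 := (ENNReal.continuous_rpow_const (y := 1 / ((2 * p : ℕ) : ℝ))).tendsto 0 |>.comp h4
  rwa [ENNReal.zero_rpow_of_pos hpos] at h5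

theorem wickConst_mul_lt_top (hβ : β < 0) (p : ℕ) : wickConst p * (8 * tail 2 β 0) ^ p < ∞ :=
  ENNReal.mul_lt_top (wickConst_lt_top p)
    (ENNReal.pow_lt_top (ENNReal.mul_lt_top (by simp) (tail_lt_top hβ 0)))

theorem memLp_wickB (hβ : β < 0) (N : ℕ) {p : ℕ} (hp : 1 ≤ p) :
    MemLp (wickB 2 N β) ((2 * p : ℕ) : ℝ≥0∞) (gauss 2 2 β) := by
  refine memLp_of_lintegral_pow_lt_top (by omega)
    (stronglyMeasurable_wickB N β).aestronglyMeasurable ?_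
  have h := lintegral_wickB_sub_pow (tsum_weight_lt_top hβ) N.zero_le hp
  simp only [wickB_zero, zero_sub, enorm_neg] at h
  exact h.trans_lt (wickConst_mul_lt_top hβ p)

theorem memLp_wickLim (hβ : β < 0) {n : ℕ → ℕ} (hn : StrictMono n)
    (htail : ∀ j, tail 2 β (n j) ≤ 4⁻¹ ^ j) {p : ℕ} (hp : 1 ≤ p) :
    MemLp (wickLim β n) ((2 * p : ℕ) : ℝ≥0∞) (gauss 2 2 β) := by
  refine memLp_of_lintegral_pow_lt_top (by omega) (aestronglyMeasurable_wickLim hβ hn htail) ?_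
  have h := lintegral_wickB_sub_wickLim_le hβ hn htail 0 hp
  simp only [wickB_zero, zero_sub, enorm_neg] at h
  exact h.trans_lt (wickConst_mul_lt_top hβ p)

theorem dimension_two (hβ : β < 0) (hβ1 : β ≤ 1) :
    IsProbabilityMeasure (gauss 2 2 β) ∧
      (∃ DN : ℕ → Sob 2 β → Sob 2 1 →L[ℝ] Sob 2 β,
        (∀ N φ, IsGradientAt hβ1 (wickB 2 N β) φ (DN N φ)) ∧
        ∀ p : ℕ, 1 ≤ p →
          (∀ N, MemLpHS (DN N) (2 * p) (gauss 2 2 β)) ∧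
          ∃ C : ℝ≥0, ∀ N,
            ∫⁻ φ, hsNorm (Sob.basis 2 1) (DN N φ) ^ (2 * p) ∂gauss 2 2 β ≤ C) ∧
      ∃ (F : Sob 2 β → Sob 2 β) (DF : Sob 2 β → Sob 2 1 →L[ℝ] Sob 2 β),
        (∀ p : ℕ, 1 ≤ p →
          MemLp F ((2 * p : ℕ) : ℝ≥0∞) (gauss 2 2 β) ∧
          (∀ N, MemLp (wickB 2 N β) ((2 * p : ℕ) : ℝ≥0∞) (gauss 2 2 β)) ∧
          Tendsto (fun N => eLpNorm (wickB 2 N β - F) ((2 * p : ℕ) : ℝ≥0∞)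
            (gauss 2 2 β)) atTop (𝓝 0)) ∧
        (∀ᵐ φ ∂gauss 2 2 β, IsGradientAt hβ1 F φ (DF φ)) ∧
        ∀ p : ℕ, 1 ≤ p → MemLpHS DF (2 * p) (gauss 2 2 β) := by
  obtain ⟨n, hn, htail⟩ := exists_subseq_tail hβ
  refine ⟨isProbabilityMeasure_gauss (tsum_weight_lt_top hβ),
    ⟨fun N φ => gradTwo N β φ.coeff, fun N φ => isGradientAt_gradTwo hβ1 N φ, fun p hp =>
      ⟨fun N => ⟨fun v => (stronglyMeasurable_gradTwo N β v).aestronglyMeasurable,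
        (lintegral_gradTwo_pow_le hβ N hp).trans_lt (gradConst_mul_lt_top hβ p)⟩,
        (gradConst p * tail 2 β 0 ^ p).toNNReal, fun N => ?_⟩⟩,
    wickLim β n, gradLim β n, fun p hp => ⟨memLp_wickLim hβ hn htail hp,
      fun N => memLp_wickB hβ N hp, tendsto_eLpNorm_wickLim hβ hn htail hp⟩,
    ae_isGradientAt_wickLim hβ hβ1 hn htail, fun p hp =>
      ⟨aestronglyMeasurable_gradLim hβ hn htail,
        (lintegral_gradLim_le hβ hn htail hp).trans_lt (gradConst_mul_lt_top hβ p)⟩⟩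
  rw [ENNReal.coe_toNNReal (gradConst_mul_lt_top hβ p).ne]
  exact lintegral_gradTwo_pow_le hβ N hp

end DimTwo

end NLS

end

theorem proposition3p2 (β : ℝ) (hβ : β < 0) :
    -- dimension one
    (IsProbabilityMeasure (NLS.gauss 1 2 β) ∧
      (∀ᵐ φ ∂NLS.gauss 1 2 β, ∀ v : NLS.Sob 1 1,
        NLS.CubicDefined β (φ + NLS.Sob.incl (by linarith) v : NLS.Sob 1 β).coeff) ∧
      ∃ DB : NLS.Sob 1 β → NLS.Sob 1 1 →L[ℝ] NLS.Sob 1 β,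
        (∀ᵐ φ ∂NLS.gauss 1 2 β, NLS.IsGradientAt (by linarith) (NLS.B 1 β) φ (DB φ)) ∧
        ∀ p : ℕ, 1 ≤ p → NLS.MemLpHS DB (2 * p) (NLS.gauss 1 2 β)) ∧
    -- dimension two
    (IsProbabilityMeasure (NLS.gauss 2 2 β) ∧
      -- the gradients of the truncated fields, bounded uniformly in the truncation
      (∃ DN : ℕ → NLS.Sob 2 β → NLS.Sob 2 1 →L[ℝ] NLS.Sob 2 β,
        (∀ N φ, NLS.IsGradientAt (by linarith) (NLS.wickB 2 N β) φ (DN N φ)) ∧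
        ∀ p : ℕ, 1 ≤ p →
          (∀ N, NLS.MemLpHS (DN N) (2 * p) (NLS.gauss 2 2 β)) ∧
          ∃ C : ℝ≥0, ∀ N,
            ∫⁻ φ, NLS.hsNorm (NLS.Sob.basis 2 1) (DN N φ) ^ (2 * p) ∂NLS.gauss 2 2 β ≤ C) ∧
      -- the limit `:B:` and its gradient
      ∃ (F : NLS.Sob 2 β → NLS.Sob 2 β) (DF : NLS.Sob 2 β → NLS.Sob 2 1 →L[ℝ] NLS.Sob 2 β),
        (∀ p : ℕ, 1 ≤ p →
          MemLp F ((2 * p : ℕ) : ℝ≥0∞) (NLS.gauss 2 2 β) ∧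
          (∀ N, MemLp (NLS.wickB 2 N β) ((2 * p : ℕ) : ℝ≥0∞) (NLS.gauss 2 2 β)) ∧
          Tendsto (fun N => eLpNorm (NLS.wickB 2 N β - F) ((2 * p : ℕ) : ℝ≥0∞)
            (NLS.gauss 2 2 β)) atTop (𝓝 0)) ∧
        (∀ᵐ φ ∂NLS.gauss 2 2 β, NLS.IsGradientAt (by linarith) F φ (DF φ)) ∧
        ∀ p : ℕ, 1 ≤ p → NLS.MemLpHS DF (2 * p) (NLS.gauss 2 2 β)) := by
  exact ⟨NLS.dimension_one hβ (by linarith), NLS.dimension_two hβ (by linarith)⟩
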